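/- Let $\tau\in\mathbb C$ with $\operatorname{Im}\tau>0$, $m\in\mathbb Z_{>0}$. For $u=e^{2\pi i x}$, $q=e^{2\pi i\tau}$ put $$\theta(x)=\frac{\sin \pi x}{\pi}\prod_{j\ge1}\frac{(1-q^{j}u)(1-q^{j}u^{-1})}{(1-q^j)^2},\qquad \rho=\theta'/\theta,\qquad \sigma(x,w)=\frac{\theta(x+w)}{\theta(x)\theta(w)}.$$ **Bethe algebra.** Let $z=(z_1,\dots,z_{2m})\in\mathbb C^{2m}$ be pairwise distinct modulo $\mathbb Z+\tau\mathbb Z$. Let $\mathbb C^2$, with standard basis $v_1,v_2$, be the two-dimensional $\mathfrak{sl}_2$-module considered as a $\mathfrak{gl}_2$-module on which $e_{11}+e_{22}$ acts by $0$. Let $V=(\mathbb C^2)^{\otimes 2m}$, let $V[0]$ be its zero weight subspace, and let $\operatorname{Fun}(V[0])$ be the space of $V[0]$-valued meromorphic functions of $\lambda_{12}=\lambda_1-\lambda_2\in\mathbb C$. Write $\lambda_{21}=-\lambda_{12}$, and let $g^{(k)}$ denote $g$ acting in the $k$-th tensor factor. Put $$L_{11}=\sum_k\rho(x-z_k)e_{11}^{(k)}+\rho(\lambda_{12})e_{22},\qquad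 L_{22}=\sum_k\rho(x-z_k)e_{22}^{(k)}+\rho(\lambda_{21})e_{11},$$ $$L_{12}=\sum_k\sigma(x-z_k,\lambda_{21})e_{21}^{(k)},\qquad L_{21}=\sum_k\sigma(x-z_k,\lambda_{12})e_{12}^{(k)},$$ where $e_{11},e_{22}$ without superscript act on $V$ as $\sum_k e_{jj}^{(k)}$, and define $S_1(x),S_2(x)$ by $$(\partial_x-\partial_{\lambda_1}+L_{11})(\partial_x-\partial_{\lambda_2}+L_{22})-L_{21}L_{12}=\partial_x^2+S_1(x)\partial_x+S_2(x).$$ The dynamical elliptic Bethe algebra $\mathcal B^V(z)$ is the algebra of operators on $\operatorname{Fun}(V[0])$ generated by the identity and all $S_1(x),S_2(x)$, $x\notin\bigcup_k (z_k+\mathbb Z+\tau\mathbb Z)$. **Solutions of the Bethe ansatz equations.** Consider the tuples $(\mu,t,z)\in\mathbb C\times\mathbb C^m\times\mathbb C^{2m}$, with $\mu\notin\mathbb Z$ and with the $t_j$ distinct from each other and from all $z_a$ modulo $\mathbb Z+\tau\mathbb Z$, that satisfy $$2\pi i\mu+2\sum_{k\ne j}\rho(t_j-t_k)-\sum_{a=1}^{2m}\rho(t_j-z_a)=0,\qquad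 j=1,\dots,m.$$ Let $\operatorname{Sol}^1_m$ be the set of their equivalence classes with respect to permutations of the $t_j$, permutations of the $z_a$, and the transformations $t_j\mapsto t_j\pm1$; $(\mu,t_j)\mapsto(\mu\mp2,t_j\pm\tau)$; $z_a\mapsto z_a\pm1$; $(\mu,z_a)\mapsto(\mu\pm1,z_a\pm\tau)$. **Pairs of theta-polynomials.** A theta-polynomial of degree $m$ with multipliers $A,B\in\mathbb C^\times$ is an entire function $f$ with $f(x+1)=A(-1)^mf(x)$ and $f(x+\tau)=B(-1)^me^{-\pi i m\tau-2\pi i m x}f(x)$. Consider the pairs $(f,g)$ of nonzero theta-polynomials of degree $m$ with first multipliers $1$ and $A\ne1$, respectively, up to multiplication of $f$ and of $g$ by nonzero constants and simultaneous multiplication of $f$ and $g$ by $e^{2\pi i k x}$, $k\in\mathbb Z$. Let $\operatorname{Wr}(f,g)=fg'-f'g$. Let $\operatorname{Pairs}_m$ be the set of classes of those pairs for which neither $f$ nor $g$ has a common zero with $\operatorname{Wr}(f,g)$. The analytic involution is $\iota_{\rm an}:(f,g)\mapsto(e^{2\pi i\nu x}g,e^{2\pi i\nu x}f)$, where $e^{2\pi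 i\nu}=A^{-1}$. Let $\beta$ send the class of $(\mu,t,z)$ to the class of $(f,g)$, where $f=\prod_j\theta(x-t_j)$ and $g$ is the theta-polynomial of degree $m$ such that $\operatorname{Wr}(f,g)=e^{-2\pi i\mu x}\prod_a\theta(x-z_a)$. Let $\operatorname{Sol}_m=\beta^{-1}(\operatorname{Pairs}_m)$. The map $\beta^{-1}\circ\iota_{\rm an}\circ\beta$ is the analytic involution on $\operatorname{Sol}_m$. **Bethe eigenfunctions.** For a solution $(\mu,t,z)$ let $$\Psi(\lambda_{12},\mu,t,z)=e^{\pi i\mu\lambda_{12}}\sum_{I=\{i_1<\dots<i_m\}\subset\{1,\dots,2m\}}\ \sum_{\kappa\in S_m}\prod_{j=1}^m\sigma(t_{\kappa(j)}-z_{i_j},-\lambda_{12})\,v_I,$$ where $v_I$ is the tensor product with $v_2$ in the positions $i\in I$ and $v_1$ in the other positions. The Weyl involution is $(s\Psi)(\lambda_{12})=s.(\Psi(-\lambda_{12}))$, where $s$ acts on each factor $\mathbb C^2$ by $v_1\mapsto -v_2$, $v_2\mapsto v_1$. **Theorem.** Let $(\mu,t,z)$ and $(\mu',t',z)$ be solutions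 with the same $z$, with $z_1,\dots,z_{2m}$ pairwise distinct modulo $\mathbb Z+\tau\mathbb Z$, whose classes lie in $\operatorname{Sol}_m$. Suppose that $\Psi(\lambda_{12},\mu,t,z)$ and $\Psi(\lambda_{12},\mu',t',z)$ have the same eigenvalues for every element of the Bethe algebra, that is, for every $T\in\mathcal B^V(z)$ there is $e\in\mathbb C$ such that $T\Psi(\cdot,\mu,t,z)=e\,\Psi(\cdot,\mu,t,z)$ and $T\Psi(\cdot,\mu',t',z)=e\,\Psi(\cdot,\mu',t',z)$. Then either the classes of $(\mu,t,z)$ and $(\mu',t',z)$ are equal, or the class of $(\mu,t,z)$ is the image of the class of $(\mu',t',z)$ under the analytic involution $\beta^{-1}\circ\iota_{\rm an}\circ\beta$. Consequently the Bethe algebra separates the Weyl orbits of Bethe eigenfunctions: $\Psi(\cdot,\mu',t',z)$ is a nonzero constant multiple of $\Psi(\cdot,\mu,t,z)$ or of $s(\Psi(\cdot,\mu,t,z))$. -/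

import Mathlib

open scoped Topology UpperHalfPlane

noncomputable section

namespace EllipticBethe

/-! ### Theta function -/

/-- The infinite product `(a; q) = ∏_{j ≥ 0} (1 - a q^j)`. -/
def qProd (a q : ℂ) : ℂ := ∏' j : ℕ, (1 - a * q ^ j)

/-- The nome `q = e^{2πiτ}`. -/
def nome (τ : ℍ) : ℂ := Complex.exp (2 * Real.pi * Complex.I * (τ : ℂ))

/-- The first Jacobi theta function, normalized by `θ'(0) = 1`:
`θ(x,τ) = (sin(πx)/π) (qz;q)(q/z;q)(q;q)^{-2}` with `z = e^{2πix}`, `q = e^{2πiτ}`. -/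
def theta (τ : ℍ) (x : ℂ) : ℂ :=
  Complex.sin (Real.pi * x) / Real.pi *
    qProd (nome τ * Complex.exp (2 * Real.pi * Complex.I * x)) (nome τ) *
    qProd (nome τ * Complex.exp (-(2 * Real.pi * Complex.I * x))) (nome τ) *
    (qProd (nome τ) (nome τ))⁻¹ ^ 2

/-- `ρ = θ'/θ`. -/
def rho (τ : ℍ) (x : ℂ) : ℂ := deriv (theta τ) x / theta τ x

/-- `σ(x,w) = θ(x+w) / (θ(x) θ(w))`. -/
def sigma (τ : ℍ) (x w : ℂ) : ℂ := theta τ (x + w) / (theta τ x * theta τ w)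

/-- Membership in the lattice `ℤ + τℤ`. -/
def InLattice (τ : ℍ) (x : ℂ) : Prop := ∃ k l : ℤ, x = k + l * (τ : ℂ)

lemma norm_nome_lt_one (τ : ℍ) : ‖nome τ‖ < 1 := by
  have h := UpperHalfPlane.norm_exp_two_pi_I_lt_one τ
  simpa [nome] using h

lemma differentiable_qProd {q : ℂ} (hq : ‖q‖ < 1) : Differentiable ℂ (fun a => qProd a q) := by
  have hU : MultipliableLocallyUniformlyOn (fun (j : ℕ) (a : ℂ) => 1 - a * q ^ j) Set.univ := by
    refine ⟨fun a => ∏' j, (1 - a * q ^ j), ?_⟩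
    simp_rw [sub_eq_add_neg]
    apply hasProdLocallyUniformlyOn_of_forall_compact isOpen_univ
    intro K _ hcK
    obtain ⟨C, hC⟩ := hcK.isBounded.exists_norm_le
    refine ((summable_geometric_of_lt_one (norm_nonneg q) hq).mul_left C).hasProdUniformlyOn_nat_one_add
      hcK (.of_forall fun n x hx => ?_) (fun _ => by fun_prop)
    rw [norm_neg, norm_mul, norm_pow]
    exact mul_le_mul_of_nonneg_right (hC x hx) (by positivity)
  have h := hU.hasProdLocallyUniformlyOn.differentiableOn
    (.of_forall fun _ => by simpa [Finset.prod_fn] using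
      DifferentiableOn.finsetProd (fun _ _ => by fun_prop)) isOpen_univ
  exact differentiableOn_univ.mp h

lemma differentiable_theta (τ : ℍ) : Differentiable ℂ (theta τ) := by
  have h := differentiable_qProd (norm_nome_lt_one τ)
  have h1 : Differentiable ℂ
      (fun x : ℂ => qProd (nome τ * Complex.exp (2 * Real.pi * Complex.I * x)) (nome τ)) :=
    h.comp (g := fun a => qProd a (nome τ)) (by fun_prop)
  have h2 : Differentiable ℂ
      (fun x : ℂ => qProd (nome τ * Complex.exp (-(2 * Real.pi * Complex.I * x))) (nome τ)) :=
    h.comp (g := fun a => qProd a (nome τ)) (by fun_prop)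
  unfold theta
  fun_prop

lemma meromorphic_theta (τ : ℍ) : Meromorphic (theta τ) :=
  fun x => ((differentiable_theta τ).analyticAt x).meromorphicAt

lemma meromorphic_theta_comp (τ : ℍ) {g : ℂ → ℂ} (hg : Differentiable ℂ g) :
    Meromorphic (fun x => theta τ (g x)) :=
  fun x => (((differentiable_theta τ).comp hg).analyticAt x).meromorphicAt

lemma meromorphic_rho_comp (τ : ℍ) {g : ℂ → ℂ} (hg : Differentiable ℂ g) :
    Meromorphic (fun x => rho τ (g x)) := by
  have h : Differentiable ℂ (deriv (theta τ)) :=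
    fun x => ((differentiable_theta τ).analyticAt x).deriv.differentiableAt
  exact Meromorphic.fun_div (fun x => ((h.comp hg).analyticAt x).meromorphicAt)
    (meromorphic_theta_comp τ hg)

lemma meromorphic_sigma_comp (τ : ℍ) (a : ℂ) {g : ℂ → ℂ} (hg : Differentiable ℂ g) :
    Meromorphic (fun x => sigma τ a (g x)) :=
  (meromorphic_theta_comp τ (g := fun x => a + g x) (by fun_prop)).fun_div
    ((Meromorphic.const _).fun_mul (meromorphic_theta_comp τ hg))

/-! ### The differential algebra of meromorphic functions on `ℂ` -/

/-- Functions on `ℂ` that are meromorphic at every point. -/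
def meroFun : Subalgebra ℂ (ℂ → ℂ) where
  carrier := {f | Meromorphic f}
  mul_mem' hf hg := Meromorphic.mul hf hg
  add_mem' hf hg := Meromorphic.add hf hg
  algebraMap_mem' c := Meromorphic.const c

/-- Meromorphic functions that vanish outside a closed discrete set. -/
def meroNull : Ideal meroFun where
  carrier := {f | ∀ x, ∀ᶠ y in 𝓝[≠] x, (f : ℂ → ℂ) y = 0}
  add_mem' {f g} hf hg x := by
    filter_upwards [hf x, hg x] with y h1 h2
    simp [h1, h2]
  zero_mem' x := by simp
  smul_mem' c f hf x := by
    filter_upwards [hf x] with y h1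
    simp [h1]

/-- The algebra (in fact field) of meromorphic functions on `ℂ`. The irrelevant values that an
actual function takes at its poles are divided out. -/
def Mero : Type := meroFun ⧸ meroNull

instance : CommRing Mero := inferInstanceAs (CommRing (meroFun ⧸ meroNull))

instance : Algebra ℂ Mero := inferInstanceAs (Algebra ℂ (meroFun ⧸ meroNull))

/-- The quotient map. -/
def Mero.of : meroFun →ₐ[ℂ] Mero := Ideal.Quotient.mkₐ ℂ meroNull

/-- The meromorphic function given by an actual function. -/
def Mero.mk (f : ℂ → ℂ) (hf : Meromorphic f) : Mero := Mero.of ⟨f, hf⟩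

lemma Mero.mk_eq_mk {f g : ℂ → ℂ} (hf : Meromorphic f) (hg : Meromorphic g) :
    Mero.mk f hf = Mero.mk g hg ↔ ∀ x, ∀ᶠ y in 𝓝[≠] x, f y = g y := by
  have h : Mero.mk f hf = Mero.mk g hg ↔ ∀ x, ∀ᶠ y in 𝓝[≠] x, f y - g y = 0 :=
    Ideal.Quotient.eq (I := meroNull) (x := ⟨f, hf⟩) (y := ⟨g, hg⟩)
  simpa only [sub_eq_zero] using h

lemma Mero.exists_rep (F : Mero) : ∃ (f : ℂ → ℂ) (hf : Meromorphic f), F = Mero.mk f hf := by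
  obtain ⟨⟨f, hf⟩, rfl⟩ := Ideal.Quotient.mk_surjective F
  exact ⟨f, hf, rfl⟩

/-- An additive map of meromorphic functions obtained from an operation `T` on actual functions
that is local and linear outside closed discrete sets. -/
def Mero.lift (T : (ℂ → ℂ) → (ℂ → ℂ)) (hT : ∀ f, Meromorphic f → Meromorphic (T f))
    (h0 : ∀ f, Meromorphic f → (∀ x, ∀ᶠ y in 𝓝[≠] x, f y = 0) → ∀ x, ∀ᶠ y in 𝓝[≠] x, T f y = 0)
    (hadd : ∀ f g, Meromorphic f → Meromorphic g →
      ∀ x, ∀ᶠ y in 𝓝[≠] x, T (f + g) y = T f y + T g y)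
    (hsmul : ∀ (c : ℂ) f, Meromorphic f → ∀ x, ∀ᶠ y in 𝓝[≠] x, T (c • f) y = c * T f y) :
    Mero →ₗ[ℂ] Mero :=
  let φ : meroFun →+ Mero :=
    AddMonoidHom.mk' (fun f => Mero.mk (T f) (hT f f.2)) (by
      intro f g
      exact (Mero.mk_eq_mk (hT _ (f + g).2) (Meromorphic.add (hT f f.2) (hT g g.2))).2
        (hadd f g f.2 g.2))
  { QuotientAddGroup.lift meroNull.toAddSubgroup φ (by
      intro f hf
      exact (Mero.mk_eq_mk (hT f f.2) (Meromorphic.const (0 : ℂ))).2 (h0 f f.2 hf)) with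
    map_smul' := by
      intro c F
      obtain ⟨f, rfl⟩ := Ideal.Quotient.mk_surjective F
      exact (Mero.mk_eq_mk (hT _ (c • f).2) (Meromorphic.const_smul (hT f f.2) c)).2
        (hsmul c f f.2) }

lemma eventually_differentiableAt {f : ℂ → ℂ} (hf : Meromorphic f) (x : ℂ) :
    ∀ᶠ y in 𝓝[≠] x, DifferentiableAt ℂ f y := by
  filter_upwards [(hf x).eventually_analyticAt] with y hy
  exact hy.differentiableAt

/-- The derivation `d/dλ` of the algebra of meromorphic functions. -/
def Mero.D : Mero →ₗ[ℂ] Mero :=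
  Mero.lift deriv (fun _ hf => hf.deriv)
    (by
      intro f _ h x
      have h' := eventually_eventually_nhdsWithin.2 (h x)
      filter_upwards [h', self_mem_nhdsWithin] with y hy hyx
      have hy' : f =ᶠ[𝓝 y] fun _ => 0 := by
        rwa [nhdsWithin_eq_nhds.2 (isOpen_compl_singleton.mem_nhds hyx)] at hy
      rw [hy'.deriv_eq]
      simp)
    (by
      intro f g hf hg x
      filter_upwards [eventually_differentiableAt hf x, eventually_differentiableAt hg x]
        with y h1 h2
      exact deriv_add h1 h2)
    (by
      intro c f hf x
      filter_upwards [eventually_differentiableAt hf x] with y h1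
      simpa using deriv_const_smul c h1)

/-- The substitution `λ ↦ -λ`. -/
def Mero.neg : Mero →ₗ[ℂ] Mero :=
  Mero.lift (fun f y => f (-y))
    (fun f hf x => (hf (-x)).comp_analyticAt (f := f) (g := fun y => -y) (by fun_prop))
    (by
      intro f _ h x
      have h2 : Filter.Tendsto (fun y : ℂ => -y) (𝓝[≠] x) (𝓝[≠] (-x)) := by
        refine tendsto_nhdsWithin_iff.2 ⟨(continuous_neg.tendsto x).mono_left nhdsWithin_le_nhds, ?_⟩
        filter_upwards [self_mem_nhdsWithin] with y hy
        simpa using hy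
      exact h2.eventually (h (-x)))
    (fun _ _ _ _ _ => Filter.Eventually.of_forall fun _ => rfl)
    (fun _ _ _ _ => Filter.Eventually.of_forall fun _ => rfl)

/-! ### Functions with values in `V = (ℂ²)^{⊗n}` -/

/-- Meromorphic functions of `λ = λ₁₂` with values in `V = (ℂ²)^{⊗n}`, given by their coordinates in
the basis `v_{w 0} ⊗ ⋯ ⊗ v_{w (n-1)}`. The index `0 : Fin 2` stands for the basis
vector `v₁` of `ℂ²` and the index `1 : Fin 2` for `v₂`. -/
abbrev VFun (n : ℕ) : Type := (Fin n → Fin 2) → Mero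

/-- The operator `A^{(k)} = 1 ⊗ ⋯ ⊗ A ⊗ ⋯ ⊗ 1` with the matrix `A` in the `k`-th factor. -/
def site {n : ℕ} (A : Matrix (Fin 2) (Fin 2) ℂ) (k : Fin n) : Module.End ℂ (VFun n) where
  toFun F w := ∑ a : Fin 2, A (w k) a • F (Function.update w k a)
  map_add' F G := by
    funext w
    simp [smul_add, Finset.sum_add_distrib]
  map_smul' c F := by
    funext w
    simp [smul_comm c]

/-- The action of `e_{jl} ∈ gl₂` on `ℂ²`, where `ℂ²` is the `sl₂`-module considered as a
`gl₂`-module on which `e₁₁ + e₂₂` acts by zero. -/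
def E (j l : Fin 2) : Matrix (Fin 2) (Fin 2) ℂ :=
  Matrix.single j l 1 - (if j = l then (1 / 2 : ℂ) else 0) • (1 : Matrix (Fin 2) (Fin 2) ℂ)

/-- The action of a matrix on the tensor product: `∑_k A^{(k)}`. -/
def total (n : ℕ) (A : Matrix (Fin 2) (Fin 2) ℂ) : Module.End ℂ (VFun n) := ∑ k, site A k

/-- Multiplication by a scalar meromorphic function. -/
def mulBy {n : ℕ} (c : Mero) : Module.End ℂ (VFun n) :=
  LinearMap.pi fun w => LinearMap.mulLeft ℂ c ∘ₗ LinearMap.proj w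

/-- The partial derivative `∂/∂λ_j` on functions of `λ = λ₁₂ = λ₁ - λ₂`. -/
def pd {n : ℕ} (j : Fin 2) : Module.End ℂ (VFun n) :=
  (if j = 0 then (1 : ℂ) else -1) • LinearMap.pi fun w => Mero.D ∘ₗ LinearMap.proj w

/-- `Fun(V[0])`: meromorphic functions of `λ₁₂` with values in the zero weight subspace
`V[0] = {v | e_{jj} v = 0, j = 1, 2}`. -/
def FunV0 (n : ℕ) : Submodule ℂ (VFun n) := ⨅ j : Fin 2, LinearMap.ker (total n (E j j))

/-! ### The RST operator for `N = 2` and the dynamical elliptic Bethe algebra -/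

/-- `λ_{jl} = λ_j - λ_l` as a function of `λ = λ₁₂`. -/
def lam (j l : Fin 2) (v : ℂ) : ℂ := (((l : ℕ) : ℂ) - ((j : ℕ) : ℂ)) * v

lemma differentiable_lam (j l : Fin 2) : Differentiable ℂ (lam j l) := by
  unfold lam
  fun_prop

/-- The meromorphic function `λ ↦ ρ(λ_{jl})`. -/
def rhoLam (τ : ℍ) (j l : Fin 2) : Mero :=
  Mero.mk (fun v => rho τ (lam j l v)) (meromorphic_rho_comp τ (differentiable_lam j l))

/-- The meromorphic function `λ ↦ σ(a, λ_{jl})`. -/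
def sigmaLam (τ : ℍ) (a : ℂ) (j l : Fin 2) : Mero :=
  Mero.mk (fun v => sigma τ a (lam j l v)) (meromorphic_sigma_comp τ a (differentiable_lam j l))

/-- `e⁺_{jj}(x) = ∑_k ρ(x - z_k) e_{jj}^{(k)}` and
`e⁺_{jl}(x) = ∑_k σ(x - z_k, λ_{jl}) e_{jl}^{(k)}` for `j ≠ l`. -/
def ePlus (τ : ℍ) {n : ℕ} (z : Fin n → ℂ) (x : ℂ) (j l : Fin 2) : Module.End ℂ (VFun n) :=
  if j = l then ∑ k, rho τ (x - z k) • site (E j j) k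
  else ∑ k, mulBy (sigmaLam τ (x - z k) j l) * site (E j l) k

/-- The matrix `L(x)`: `L_{jj} = e⁺_{jj}(x) + ∑_{l ≠ j} ρ(λ_{jl}) e_{ll}` and
`L_{jl} = e⁺_{lj}(x)` for `j ≠ l`. -/
def L (τ : ℍ) {n : ℕ} (z : Fin n → ℂ) (x : ℂ) (j l : Fin 2) : Module.End ℂ (VFun n) :=
  if j = l then ePlus τ z x j j + ∑ i ∈ Finset.univ.erase j, mulBy (rhoLam τ j i) * total n (E i i)
  else ePlus τ z x l j

/-- The derivative `∂L_{jj}/∂x = ∑_k ρ'(x - z_k) e_{jj}^{(k)}`. -/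
def dL (τ : ℍ) {n : ℕ} (z : Fin n → ℂ) (x : ℂ) (j : Fin 2) : Module.End ℂ (VFun n) :=
  ∑ k, deriv (rho τ) (x - z k) • site (E j j) k

/-- The coefficient `S₁(x)` of the RST operator, acting on `V`-valued functions. The RST operator is
the column determinant of the matrix `(δ_{jl}∂_x - δ_{jl}∂_{λ_j} + L_{jl}(x))`, that is,
`(∂_x - ∂_{λ₁} + L₁₁)(∂_x - ∂_{λ₂} + L₂₂) - L₂₁ L₁₂ = ∂_x² + S₁(x) ∂_x + S₂(x)`. -/
def S1 (τ : ℍ) {n : ℕ} (z : Fin n → ℂ) (x : ℂ) : Module.End ℂ (VFun n) :=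
  (L τ z x 0 0 - pd 0) + (L τ z x 1 1 - pd 1)

/-- The coefficient `S₂(x)` of the RST operator, acting on `V`-valued functions. -/
def S2 (τ : ℍ) {n : ℕ} (z : Fin n → ℂ) (x : ℂ) : Module.End ℂ (VFun n) :=
  (L τ z x 0 0 - pd 0) * (L τ z x 1 1 - pd 1) + dL τ z x 1 - L τ z x 1 0 * L τ z x 0 1

lemma site_mul_site {n : ℕ} (A B : Matrix (Fin 2) (Fin 2) ℂ) (k : Fin n) :
    site A k * site B k = site (A * B) k := by
  refine LinearMap.ext fun F => ?_
  funext w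
  simp only [site, Module.End.mul_apply, LinearMap.coe_mk, AddHom.coe_mk, Function.update_self,
    Function.update_idem, Matrix.mul_apply, Fin.sum_univ_two]
  module

lemma site_comm {n : ℕ} (A B : Matrix (Fin 2) (Fin 2) ℂ) {i k : Fin n} (h : i ≠ k) :
    site A i * site B k = site B k * site A i := by
  refine LinearMap.ext fun F => ?_
  funext w
  simp only [site, Module.End.mul_apply, LinearMap.coe_mk, AddHom.coe_mk, Fin.sum_univ_two,
    Function.update_of_ne h, Function.update_of_ne h.symm, Function.update_comm h]
  module

lemma site_sub {n : ℕ} (A B : Matrix (Fin 2) (Fin 2) ℂ) (k : Fin n) :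
    site (A - B) k = site A k - site B k := by
  refine LinearMap.ext fun F => ?_
  funext w
  simp only [site, LinearMap.coe_mk, AddHom.coe_mk, Fin.sum_univ_two, LinearMap.sub_apply,
    Pi.sub_apply, Matrix.sub_apply]
  module

lemma site_smul {n : ℕ} (c : ℂ) (A : Matrix (Fin 2) (Fin 2) ℂ) (k : Fin n) :
    site (c • A) k = c • site A k := by
  refine LinearMap.ext fun F => ?_
  funext w
  simp only [site, LinearMap.coe_mk, AddHom.coe_mk, Fin.sum_univ_two, LinearMap.smul_apply,
    Pi.smul_apply, Matrix.smul_apply, smul_eq_mul]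
  module

lemma total_mul_site {n : ℕ} (A B : Matrix (Fin 2) (Fin 2) ℂ) (k : Fin n) :
    total n A * site B k = site B k * total n A + site (A * B - B * A) k := by
  have h : ∀ i ∈ Finset.univ.erase k, site A i * site B k = site B k * site A i :=
    fun i hi => site_comm A B (Finset.ne_of_mem_erase hi)
  unfold total
  rw [Finset.sum_mul, Finset.mul_sum, ← Finset.add_sum_erase _ _ (Finset.mem_univ k),
    ← Finset.add_sum_erase (a := k) (f := fun i => site B k * site A i) _ (Finset.mem_univ k),
    Finset.sum_congr rfl h, site_mul_site, site_mul_site, site_sub]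
  abel

lemma mulBy_comm_site {n : ℕ} (c : Mero) (A : Matrix (Fin 2) (Fin 2) ℂ) (k : Fin n) :
    Commute (site A k) (mulBy c) := by
  refine LinearMap.ext fun F => ?_
  funext w
  simp [site, mulBy, mul_add]

lemma mulBy_comm_total {n : ℕ} (c : Mero) (A : Matrix (Fin 2) (Fin 2) ℂ) :
    Commute (total n A) (mulBy c) :=
  Commute.sum_left _ _ _ fun k _ => mulBy_comm_site c A k

lemma pd_comm_total {n : ℕ} (j : Fin 2) (A : Matrix (Fin 2) (Fin 2) ℂ) :
    Commute (total n A) (pd j) := by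
  refine Commute.sum_left _ _ _ fun k _ => Commute.smul_right ?_ _
  refine LinearMap.ext fun F => ?_
  funext w
  simp [site]

lemma E_diag_comm (i j : Fin 2) : E i i * E j j - E j j * E i i = 0 := by
  fin_cases i <;> fin_cases j <;> ext a b <;> fin_cases a <;> fin_cases b <;>
    (simp [E, Matrix.mul_apply, Matrix.one_apply] <;> ring)

/-- The number `w` with `[e_{jj}, e₁₂] = w e₁₂`. -/
def wt (j : Fin 2) : ℂ := if j = 0 then 1 else -1

lemma E_comm_01 (j : Fin 2) : E j j * E 0 1 - E 0 1 * E j j = wt j • E 0 1 := by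
  fin_cases j <;> ext a b <;> fin_cases a <;> fin_cases b <;>
    (simp [E, wt, Matrix.mul_apply, Matrix.one_apply]; try norm_num)

lemma E_comm_10 (j : Fin 2) : E j j * E 1 0 - E 1 0 * E j j = (-wt j) • E 1 0 := by
  fin_cases j <;> ext a b <;> fin_cases a <;> fin_cases b <;>
    (simp [E, wt, Matrix.mul_apply, Matrix.one_apply]; try norm_num)

lemma total_comm_site_diag {n : ℕ} (i j : Fin 2) (k : Fin n) :
    Commute (total n (E i i)) (site (E j j) k) := by
  have h := total_mul_site (E i i) (E j j) k
  rw [E_diag_comm] at h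
  have h0 : site (0 : Matrix (Fin 2) (Fin 2) ℂ) k = 0 := by
    simpa using site_smul (0 : ℂ) (0 : Matrix (Fin 2) (Fin 2) ℂ) k
  rw [h0, add_zero] at h
  exact h

lemma total_comm_L_diag (τ : ℍ) {n : ℕ} (z : Fin n → ℂ) (x : ℂ) (i j : Fin 2) :
    Commute (total n (E i i)) (L τ z x j j) := by
  unfold L ePlus
  rw [if_pos rfl, if_pos rfl]
  refine Commute.add_right (Commute.sum_right _ _ _ fun k _ =>
    (total_comm_site_diag i j k).smul_right _) (Commute.sum_right _ _ _ fun l _ => ?_)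
  exact (mulBy_comm_total _ _).mul_right
    (Commute.sum_right _ _ _ fun k _ => total_comm_site_diag i l k)

lemma total_mul_L10 (τ : ℍ) {n : ℕ} (z : Fin n → ℂ) (x : ℂ) (j : Fin 2) :
    total n (E j j) * L τ z x 1 0 = L τ z x 1 0 * total n (E j j) + wt j • L τ z x 1 0 := by
  have h : L τ z x 1 0 = ∑ k, mulBy (sigmaLam τ (x - z k) 0 1) * site (E 0 1) k := by
    simp [L, ePlus]
  rw [h, Finset.mul_sum, Finset.sum_mul, Finset.smul_sum, ← Finset.sum_add_distrib]
  refine Finset.sum_congr rfl fun k _ => ?_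
  rw [← mul_assoc, (mulBy_comm_total _ _).eq, mul_assoc, total_mul_site, E_comm_01, site_smul,
    mul_add, mul_smul_comm, mul_assoc]

lemma total_mul_L01 (τ : ℍ) {n : ℕ} (z : Fin n → ℂ) (x : ℂ) (j : Fin 2) :
    total n (E j j) * L τ z x 0 1 = L τ z x 0 1 * total n (E j j) + (-wt j) • L τ z x 0 1 := by
  have h : L τ z x 0 1 = ∑ k, mulBy (sigmaLam τ (x - z k) 1 0) * site (E 1 0) k := by
    simp [L, ePlus]
  rw [h, Finset.mul_sum, Finset.sum_mul, Finset.smul_sum, ← Finset.sum_add_distrib]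
  refine Finset.sum_congr rfl fun k _ => ?_
  rw [← mul_assoc, (mulBy_comm_total _ _).eq, mul_assoc, total_mul_site, E_comm_10, site_smul,
    mul_add, mul_smul_comm, mul_assoc]

lemma total_comm_S1 (τ : ℍ) {n : ℕ} (z : Fin n → ℂ) (x : ℂ) (j : Fin 2) :
    Commute (total n (E j j)) (S1 τ z x) :=
  ((total_comm_L_diag τ z x j 0).sub_right (pd_comm_total 0 _)).add_right
    ((total_comm_L_diag τ z x j 1).sub_right (pd_comm_total 1 _))

lemma total_comm_S2 (τ : ℍ) {n : ℕ} (z : Fin n → ℂ) (x : ℂ) (j : Fin 2) :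
    Commute (total n (E j j)) (S2 τ z x) := by
  refine ((((total_comm_L_diag τ z x j 0).sub_right (pd_comm_total 0 _)).mul_right
    ((total_comm_L_diag τ z x j 1).sub_right (pd_comm_total 1 _))).add_right
    (Commute.sum_right _ _ _ fun k _ => (total_comm_site_diag j 1 k).smul_right _)).sub_right ?_
  change _ * (_ * _) = (_ * _) * _
  rw [← mul_assoc, total_mul_L10, add_mul, mul_assoc, total_mul_L01, mul_add, mul_assoc,
    smul_mul_assoc, mul_smul_comm]
  module

lemma mem_FunV0 {n : ℕ} {F : VFun n} : F ∈ FunV0 n ↔ ∀ j, total n (E j j) F = 0 := by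
  simp [FunV0]

lemma FunV0_invariant {n : ℕ} {T : Module.End ℂ (VFun n)}
    (hT : ∀ j, Commute (total n (E j j)) T) : ∀ F ∈ FunV0 n, T F ∈ FunV0 n := by
  intro F hF
  rw [mem_FunV0] at hF ⊢
  intro j
  have h := LinearMap.congr_fun (hT j).eq F
  simpa [hF j] using h

/-- The operators `S₁(x)` (for `i = 0`) and `S₂(x)` (for `i = 1`) on `Fun(V[0])`. -/
def S (τ : ℍ) {n : ℕ} (z : Fin n → ℂ) (i : Fin 2) (x : ℂ) : Module.End ℂ (FunV0 n) :=
  if i = 0 then (S1 τ z x).restrict (FunV0_invariant (total_comm_S1 τ z x))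
  else (S2 τ z x).restrict (FunV0_invariant (total_comm_S2 τ z x))

/-- The dynamical elliptic Bethe algebra `B^V(z₁,…,z_n,τ)`, `V = (ℂ²)^{⊗n}`: the algebra of operators
on `Fun(V[0])` generated by the identity and the values of `S₁(x)`, `S₂(x)` at all `x` where they
are defined, i.e. outside the poles `z_k + ℤ + τℤ`. -/
def betheAlgebra (τ : ℍ) {n : ℕ} (z : Fin n → ℂ) : Subalgebra ℂ (Module.End ℂ (FunV0 n)) :=
  Algebra.adjoin ℂ {T | ∃ i x, (∀ k, ¬ InLattice τ (x - z k)) ∧ T = S τ z i x}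

/-! ### Solutions of the Bethe ansatz equations -/

/-- A solution `(μ, t₁,…,t_m, z₁,…,z_{2m})` of the Bethe ansatz equations with `μ ∉ ℤ`. The terms
of the equations make sense only if the `t_j` are distinct from each other and from the `z_a` modulo
the lattice. -/
structure BetheSolution (τ : ℍ) (m : ℕ) where
  mu : ℂ
  t : Fin m → ℂ
  z : Fin (2 * m) → ℂ
  t_distinct : ∀ i j, i ≠ j → ¬ InLattice τ (t i - t j)
  t_ne_z : ∀ j a, ¬ InLattice τ (t j - z a)
  bethe_equation : ∀ j, 2 * Real.pi * Complex.I * mu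
    + 2 * ∑ k ∈ Finset.univ.erase j, rho τ (t j - t k) - ∑ a, rho τ (t j - z a) = 0
  mu_not_int : ∀ k : ℤ, mu ≠ k

/-- The elementary transformations of solutions: permutations of the `t_j` and of the `z_a`,
`t_j ↦ t_j + 1`, `(μ, t_j) ↦ (μ - 2, t_j + τ)`, `z_a ↦ z_a + 1`, `(μ, z_a) ↦ (μ + 1, z_a + τ)`. -/
inductive Step {τ : ℍ} {m : ℕ} (a b : BetheSolution τ m) : Prop
  | perm_t (s : Equiv.Perm (Fin m)) (hmu : b.mu = a.mu) (ht : b.t = a.t ∘ s) (hz : b.z = a.z)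
  | perm_z (s : Equiv.Perm (Fin (2 * m))) (hmu : b.mu = a.mu) (ht : b.t = a.t) (hz : b.z = a.z ∘ s)
  | t_one (j : Fin m) (hmu : b.mu = a.mu) (ht : b.t = Function.update a.t j (a.t j + 1))
      (hz : b.z = a.z)
  | t_tau (j : Fin m) (hmu : b.mu = a.mu - 2) (ht : b.t = Function.update a.t j (a.t j + (τ : ℂ)))
      (hz : b.z = a.z)
  | z_one (k : Fin (2 * m)) (hmu : b.mu = a.mu) (ht : b.t = a.t)
      (hz : b.z = Function.update a.z k (a.z k + 1))
  | z_tau (k : Fin (2 * m)) (hmu : b.mu = a.mu + 1) (ht : b.t = a.t)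
      (hz : b.z = Function.update a.z k (a.z k + (τ : ℂ)))

/-- Solutions are equivalent if one is obtained from the other by a sequence of elementary
transformations and their inverses. -/
instance solutionSetoid (τ : ℍ) (m : ℕ) : Setoid (BetheSolution τ m) :=
  Relation.EqvGen.setoid Step

/-- `Sol_m¹`: equivalence classes of solutions with `μ ∉ ℤ`. -/
abbrev Sol1 (τ : ℍ) (m : ℕ) : Type := Quotient (solutionSetoid τ m)

/-! ### Pairs of theta-polynomials and the analytic involution -/

/-- `f` is a theta-polynomial of degree `m` with multipliers `A, B ∈ ℂˣ`. -/
structure IsThetaPoly (τ : ℍ) (m : ℕ) (A B : ℂ) (f : ℂ → ℂ) : Prop where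
  entire : Differentiable ℂ f
  A_ne : A ≠ 0
  B_ne : B ≠ 0
  add_one : ∀ x, f (x + 1) = A * (-1) ^ m * f x
  add_tau : ∀ x, f (x + (τ : ℂ)) =
    B * (-1) ^ m * Complex.exp (-(Real.pi * Complex.I * m * (τ : ℂ)) - 2 * Real.pi * Complex.I * m * x)
      * f x

/-- A pair `(f, g)` of nonzero theta-polynomials of degree `m` such that `f` has first multiplier `1`
and `g` has first multiplier `A ≠ 1`. -/
structure ThetaPair (τ : ℍ) (m : ℕ) where
  f : ℂ → ℂ
  g : ℂ → ℂ
  A : ℂ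
  f_theta : ∃ B, IsThetaPoly τ m 1 B f
  g_theta : ∃ B, IsThetaPoly τ m A B g
  f_ne : f ≠ 0
  g_ne : g ≠ 0
  A_ne_one : A ≠ 1

/-- Two pairs are identified if they differ by multiplication of `f` and `g` by nonzero constants and
simultaneous multiplication of `f` and `g` by `e^{2πikx}`, `k ∈ ℤ`. -/
def ThetaPair.Rel {τ : ℍ} {m : ℕ} (p q : ThetaPair τ m) : Prop :=
  ∃ (a b : ℂ) (k : ℤ), a ≠ 0 ∧ b ≠ 0 ∧
    (∀ x, q.f x = a * Complex.exp (2 * Real.pi * Complex.I * k * x) * p.f x) ∧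
    (∀ x, q.g x = b * Complex.exp (2 * Real.pi * Complex.I * k * x) * p.g x)

instance pairSetoid (τ : ℍ) (m : ℕ) : Setoid (ThetaPair τ m) where
  r := ThetaPair.Rel
  iseqv :=
    { refl := fun p => ⟨1, 1, 0, one_ne_zero, one_ne_zero, by simp, by simp⟩
      symm := by
        rintro p q ⟨a, b, k, ha, hb, h1, h2⟩
        have hk : ∀ x : ℂ, Complex.exp (2 * Real.pi * Complex.I * ((-k : ℤ) : ℂ) * x) *
            Complex.exp (2 * Real.pi * Complex.I * k * x) = 1 := by
          intro x
          rw [← Complex.exp_add, ← Complex.exp_zero]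
          congr 1
          push_cast
          ring
        refine ⟨a⁻¹, b⁻¹, -k, inv_ne_zero ha, inv_ne_zero hb, fun x => ?_, fun x => ?_⟩
        · rw [h1]
          calc p.f x = (a⁻¹ * a) * 1 * p.f x := by rw [inv_mul_cancel₀ ha]; ring
            _ = _ := by rw [← hk x]; ring
        · rw [h2]
          calc p.g x = (b⁻¹ * b) * 1 * p.g x := by rw [inv_mul_cancel₀ hb]; ring
            _ = _ := by rw [← hk x]; ring
      trans := by
        rintro p q r ⟨a, b, k, ha, hb, h1, h2⟩ ⟨a', b', k', ha', hb', h1', h2'⟩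
        have hk : ∀ x : ℂ, Complex.exp (2 * Real.pi * Complex.I * ((k' + k : ℤ) : ℂ) * x) =
            Complex.exp (2 * Real.pi * Complex.I * k' * x) *
            Complex.exp (2 * Real.pi * Complex.I * k * x) := by
          intro x
          rw [← Complex.exp_add]
          congr 1
          push_cast
          ring
        refine ⟨a' * a, b' * b, k' + k, mul_ne_zero ha' ha, mul_ne_zero hb' hb,
          fun x => ?_, fun x => ?_⟩
        · rw [h1', h1, hk]; ring
        · rw [h2', h2, hk]; ring }

/-- The space `(P_{m,1} × (P_m - P_{m,1}))/ℤ`. -/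
abbrev PairSpace (τ : ℍ) (m : ℕ) : Type := Quotient (pairSetoid τ m)

/-- The Wronskian determinant `Wr(f,g) = f g' - f' g`. -/
def Wr (f g : ℂ → ℂ) (x : ℂ) : ℂ := f x * deriv g x - deriv f x * g x

/-- Multiplication of a theta-polynomial by `e^{2πiνx}`. -/
def shift (ν : ℂ) (f : ℂ → ℂ) (x : ℂ) : ℂ := Complex.exp (2 * Real.pi * Complex.I * ν * x) * f x

lemma shift_ne_zero (ν : ℂ) {f : ℂ → ℂ} (hf : f ≠ 0) : shift ν f ≠ 0 := by
  intro h
  apply hf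
  funext x
  have := congrFun h x
  simpa [shift, Complex.exp_ne_zero] using this

lemma IsThetaPoly.shift {τ : ℍ} {m : ℕ} {A B : ℂ} {f : ℂ → ℂ} (h : IsThetaPoly τ m A B f) (ν : ℂ) :
    IsThetaPoly τ m (Complex.exp (2 * Real.pi * Complex.I * ν) * A)
      (Complex.exp (2 * Real.pi * Complex.I * ν * (τ : ℂ)) * B) (shift ν f) where
  entire := by
    have := h.entire
    unfold EllipticBethe.shift
    fun_prop
  A_ne := mul_ne_zero (Complex.exp_ne_zero _) h.A_ne
  B_ne := mul_ne_zero (Complex.exp_ne_zero _) h.B_ne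
  add_one x := by
    unfold EllipticBethe.shift
    rw [h.add_one, mul_add, Complex.exp_add, mul_one]
    ring
  add_tau x := by
    unfold EllipticBethe.shift
    rw [h.add_tau, mul_add, Complex.exp_add]
    ring

/-- A number `μ` with `e^{2πiμ} = A⁻¹`. -/
def ThetaPair.mu {τ : ℍ} {m : ℕ} (p : ThetaPair τ m) : ℂ :=
  Complex.log p.A⁻¹ / (2 * Real.pi * Complex.I)

lemma ThetaPair.A_ne_zero {τ : ℍ} {m : ℕ} (p : ThetaPair τ m) : p.A ≠ 0 := by
  obtain ⟨B, h⟩ := p.g_theta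
  exact h.A_ne

lemma ThetaPair.exp_mu {τ : ℍ} {m : ℕ} (p : ThetaPair τ m) :
    Complex.exp (2 * Real.pi * Complex.I * p.mu) = p.A⁻¹ := by
  unfold ThetaPair.mu
  rw [mul_div_cancel₀ _ Complex.two_pi_I_ne_zero, Complex.exp_log (inv_ne_zero p.A_ne_zero)]

/-- The analytic involution on pairs: `(f, g) ↦ (e^{2πiμx} g, e^{2πiμx} f)`. -/
def ThetaPair.swap {τ : ℍ} {m : ℕ} (p : ThetaPair τ m) : ThetaPair τ m where
  f := shift p.mu p.g
  g := shift p.mu p.f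
  A := p.A⁻¹
  f_theta := by
    obtain ⟨B, h⟩ := p.g_theta
    have h' := h.shift p.mu
    rw [p.exp_mu, inv_mul_cancel₀ p.A_ne_zero] at h'
    exact ⟨_, h'⟩
  g_theta := by
    obtain ⟨B, h⟩ := p.f_theta
    have h' := h.shift p.mu
    rw [p.exp_mu, mul_one] at h'
    exact ⟨_, h'⟩
  f_ne := shift_ne_zero _ p.g_ne
  g_ne := shift_ne_zero _ p.f_ne
  A_ne_one := inv_ne_one.2 p.A_ne_one

lemma ThetaPair.Rel.A_eq {τ : ℍ} {m : ℕ} {p q : ThetaPair τ m} (h : p.Rel q) : p.A = q.A := by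
  obtain ⟨a, b, k, _, hb, _, h2⟩ := h
  obtain ⟨B, hp⟩ := p.g_theta
  obtain ⟨B', hq⟩ := q.g_theta
  obtain ⟨x, hx⟩ := Function.ne_iff.1 p.g_ne
  have e := hq.add_one x
  have hexp : Complex.exp (2 * Real.pi * Complex.I * k * (x + 1)) =
      Complex.exp (2 * Real.pi * Complex.I * k * x) := by
    rw [mul_add, Complex.exp_add, mul_one, mul_comm (2 * Real.pi * Complex.I) (k : ℂ),
      Complex.exp_int_mul_two_pi_mul_I, mul_one]
  rw [h2, h2, hp.add_one, hexp] at e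
  have hE := Complex.exp_ne_zero (2 * Real.pi * Complex.I * k * x)
  have hm : ((-1 : ℂ)) ^ m ≠ 0 := pow_ne_zero _ (by norm_num)
  have hx' : p.g x ≠ 0 := hx
  have : (b * Complex.exp (2 * Real.pi * Complex.I * k * x) * (-1) ^ m * p.g x) * (p.A - q.A) = 0 := by
    linear_combination e
  have hne : b * Complex.exp (2 * Real.pi * Complex.I * k * x) * (-1) ^ m * p.g x ≠ 0 :=
    mul_ne_zero (mul_ne_zero (mul_ne_zero hb hE) hm) hx'
  exact sub_eq_zero.1 ((mul_eq_zero.1 this).resolve_left hne)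

/-- The analytic involution `ι_an` on `(P_{m,1} × (P_m - P_{m,1}))/ℤ`. -/
def analyticInvolution {τ : ℍ} {m : ℕ} : PairSpace τ m → PairSpace τ m :=
  Quotient.map ThetaPair.swap (by
    intro p q h
    have hmu : q.mu = p.mu := by
      unfold ThetaPair.mu
      rw [ThetaPair.Rel.A_eq h]
    obtain ⟨a, b, k, ha, hb, h1, h2⟩ := h
    refine ⟨b, a, k, hb, ha, fun x => ?_, fun x => ?_⟩
    · simp only [ThetaPair.swap, shift, hmu, h2]
      ring
    · simp only [ThetaPair.swap, shift, hmu, h1]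
      ring)

/-- `(f, g)` has generic first and second coordinates: neither `f` nor `g` has a common zero with
`Wr(f,g)`. -/
def ThetaPair.Generic {τ : ℍ} {m : ℕ} (p : ThetaPair τ m) : Prop :=
  (∀ x, p.f x = 0 → Wr p.f p.g x ≠ 0) ∧ (∀ x, p.g x = 0 → Wr p.f p.g x ≠ 0)

/-- `Pairs_m`: the points with generic first and second coordinates. -/
def Pairs (τ : ℍ) (m : ℕ) : Set (PairSpace τ m) := {P | ∃ p : ThetaPair τ m, ⟦p⟧ = P ∧ p.Generic}

/-- The graph of the bijection `β`: the class of `(μ, t, z)` corresponds to the class of `(f, g)`,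
where `f(x) = ∏_j θ(x - t_j)` and `g` is the theta-polynomial of degree `m` determined by
`Wr(f,g)(x) = e^{-2πiμx} ∏_a θ(x - z_a)`. -/
def Beta {τ : ℍ} {m : ℕ} (c : Sol1 τ m) (P : PairSpace τ m) : Prop :=
  ∃ (s : BetheSolution τ m) (p : ThetaPair τ m), ⟦s⟧ = c ∧ ⟦p⟧ = P ∧
    (∀ x, p.f x = ∏ j, theta τ (x - s.t j)) ∧
    (∀ x, Wr p.f p.g x =
      Complex.exp (-(2 * Real.pi * Complex.I * s.mu * x)) * ∏ a, theta τ (x - s.z a))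

/-- `Sol_m = β⁻¹(Pairs_m)`. -/
def Sol (τ : ℍ) (m : ℕ) : Set (Sol1 τ m) := {c | ∃ P ∈ Pairs τ m, Beta c P}

/-- `c` is the image of `c'` under the analytic involution `β⁻¹ ∘ ι_an ∘ β`. -/
def IsAnalyticImage {τ : ℍ} {m : ℕ} (c c' : Sol1 τ m) : Prop :=
  ∃ P, Beta c' P ∧ Beta c (analyticInvolution P)

/-! ### Bethe eigenfunctions and the Weyl involution -/

/-- The function `W_I(λ,t,z) = ∑_{s ∈ S_m} ∏_j σ(t_{s(j)} - z_{i_j}, -λ)` for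
`I = {i_1 < ⋯ < i_m}`. -/
def weightFun (τ : ℍ) {m : ℕ} (t : Fin m → ℂ) (z : Fin (2 * m) → ℂ) (I : Finset (Fin (2 * m)))
    (hI : I.card = m) (v : ℂ) : ℂ :=
  ∑ s : Equiv.Perm (Fin m), ∏ j, sigma τ (t (s j) - z (I.orderEmbOfFin hI j)) (-v)

lemma meromorphic_weightFun (τ : ℍ) {m : ℕ} (μ : ℂ) (t : Fin m → ℂ) (z : Fin (2 * m) → ℂ)
    (I : Finset (Fin (2 * m))) (hI : I.card = m) :
    Meromorphic (fun v => Complex.exp (Real.pi * Complex.I * μ * v) * weightFun τ t z I hI v) := by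
  have h1 : Meromorphic (fun v : ℂ => Complex.exp (Real.pi * Complex.I * μ * v)) := by
    have h : Differentiable ℂ (fun v : ℂ => Complex.exp (Real.pi * Complex.I * μ * v)) := by
      fun_prop
    exact fun x => (h.analyticAt x).meromorphicAt
  refine h1.fun_mul ?_
  unfold weightFun
  exact Meromorphic.fun_sum fun s _ => Meromorphic.fun_prod fun j _ =>
    meromorphic_sigma_comp τ _ (g := fun v => -v) (by fun_prop)

/-- The set of tensor positions of a word that carry the basis vector `v₂`. -/
def ones {n : ℕ} (w : Fin n → Fin 2) : Finset (Fin n) := Finset.univ.filter fun k => w k = 1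

/-- The function `Ψ(λ₁₂,μ,t,z) = e^{πiμλ₁₂} ∑_{|I| = m} W_I(λ₁₂,t,z) v_I`. -/
def PsiV {τ : ℍ} {m : ℕ} (s : BetheSolution τ m) : VFun (2 * m) := fun w =>
  if h : (ones w).card = m then
    Mero.mk (fun v => Complex.exp (Real.pi * Complex.I * s.mu * v) *
      weightFun τ s.t s.z (ones w) h v) (meromorphic_weightFun τ s.mu s.t s.z (ones w) h)
  else 0

lemma PsiV_mem {τ : ℍ} {m : ℕ} (s : BetheSolution τ m) : PsiV s ∈ FunV0 (2 * m) := by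
  rw [mem_FunV0]
  intro j
  funext w
  have hE : ∀ k, (site (E j j) k (PsiV s)) w = E j j (w k) (w k) • PsiV s w := by
    intro k
    have h : ∀ a, a ≠ w k → E j j (w k) a = 0 := by
      intro a ha
      have h1 : (Matrix.single j j (1 : ℂ)) (w k) a = 0 := by
        rw [Matrix.single_apply, if_neg]
        rintro ⟨h1, h2⟩
        exact ha (h2.symm.trans h1)
      simp [E, h1, ha.symm]
    change ∑ a : Fin 2, E j j (w k) a • PsiV s (Function.update w k a) = _
    rw [Finset.sum_eq_single (w k) (fun a _ ha => by rw [h a ha, zero_smul]) (by simp),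
      Function.update_eq_self]
  have hsum : total (2 * m) (E j j) (PsiV s) w = (∑ k, E j j (w k) (w k)) • PsiV s w := by
    simp only [total, LinearMap.sum_apply, Finset.sum_apply, hE, Finset.sum_smul]
  rw [hsum]
  by_cases hw : (ones w).card = m
  · have hval : ∀ k, E j j (w k) (w k) = wt j * (1 / 2 - if w k = 1 then 1 else 0) := by
      intro k
      generalize w k = a
      fin_cases j <;> fin_cases a <;> simp [E, wt] <;> norm_num
    have hc : (∑ k : Fin (2 * m), if w k = 1 then (1 : ℂ) else 0) = m := by
      rw [Finset.sum_boole]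
      exact_mod_cast hw
    have h0 : ∑ k, E j j (w k) (w k) = 0 := by
      simp only [hval]
      rw [← Finset.mul_sum, Finset.sum_sub_distrib, hc, Finset.sum_const, Finset.card_univ,
        Fintype.card_fin, nsmul_eq_mul]
      push_cast
      ring
    rw [h0, zero_smul]
    rfl
  · have : PsiV s w = 0 := by simp [PsiV, hw]
    rw [this, smul_zero]
    rfl

/-- The Bethe eigenfunction `Ψ(λ₁₂,μ,t,z)` as an element of `Fun(V[0])`. -/
def Psi {τ : ℍ} {m : ℕ} (s : BetheSolution τ m) : FunV0 (2 * m) := ⟨PsiV s, PsiV_mem s⟩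

/-- The Weyl involution `ψ(λ) ↦ s.(ψ(-λ))`, where `s` acts on every factor `ℂ²` by
`v₁ ↦ -v₂`, `v₂ ↦ v₁`. -/
def weyl {n : ℕ} (F : VFun n) : VFun n := fun w =>
  (∏ k, if w k = 1 then (-1 : ℂ) else 1) • Mero.neg (F fun k => 1 - w k)

end EllipticBethe

end

namespace EllipticBethe

/-! ### The theta function -/

/-! The eigenvalue of S₂(x) is read near its poles x = z_a. There its double pole has coefficient
−3/4, and its residue E_a turns the eigenvalue equation, which is of second order in λ, into a first
order equation for every a (`polarPart_eigenvalue`, `exists_isFirstOrder`). Joint eigenfunctions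
with equal eigenvalues share the numbers E_a and hence satisfy the same first order equations.

Up to sign, multiplication by θ(λ)^m turns the coordinates of Ψ into entire functions `numer` of
theta type of degree m, all equal to m! at λ = 0, whatever the solution and the word. Such a
solution of the first order system is determined by its multipliers and its values at 0
(`IsSystemSolution.eq_zero`). Indeed, if the difference of two solutions is divisible by θⁿ with 1 ≤
n ≤ m, the leading coefficients at 0 satisfy a transposition equation with parameter n − m. That
equation has only the zero solution unless its parameter is 1 or −m (`eq_zero_of_swap_equation`). So
the difference vanishes to order greater than its degree m, and is zero.

Differentiating the system at λ = 0 gives E_a = πiμ − ∑_j ρ(t_j − z_a) − ½∑_{b≠a} ρ(z_a − z_b)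
(`eigenvalue_eq`). The first two terms are the logarithmic derivative at z_a of F(x) = e^{πiμx}∏_j
θ(x − t_j). Let G be this function for the second solution. Equal eigenvalues force Wr(F,G) to
vanish at all 2m points z_a. Being of degree 2m, it equals C e^{cx}∏_a θ(x − z_a), and the Bethe
equations at one t_j give c = 0 (`exists_wr_eq`).

If C = 0, then F and G are proportional. Their zeros agree modulo the lattice, so the classes
coincide (`class_eq_of_proportional`), and the multipliers agree, so uniqueness gives equal
eigenfunctions. If C ≠ 0, then F and G, rescaled by an exponential, form the pair attached to the
first solution, and exchanging them is the analytic involution (`isAnalyticImage_of_wr`). The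
multipliers of the Wronskian show that the Weyl reflection of one eigenfunction has the multipliers
of the other, and uniqueness identifies the two (`numer_eq_reflect`). -/

lemma summable_norm_qProd {q : ℂ} (hq : ‖q‖ < 1) (a : ℂ) :
    Summable fun j : ℕ => ‖-(a * q ^ j)‖ := by
  simp only [norm_neg, norm_mul, norm_pow]
  exact (summable_geometric_of_lt_one (norm_nonneg q) hq).mul_left _

lemma qProd_eq {q : ℂ} (hq : ‖q‖ < 1) (a : ℂ) : qProd a q = (1 - a) * qProd (a * q) q := by
  have h : Multipliable fun j : ℕ => 1 - a * q ^ (j + 1) := by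
    have := multipliable_one_add_of_summable (summable_norm_qProd hq (a * q))
    have e : (fun j : ℕ => 1 - a * q ^ (j + 1)) = fun j : ℕ => 1 + -(a * q * q ^ j) := by
      funext j
      ring
    rwa [e]
  have e := tprod_eq_zero_mul' (f := fun j : ℕ => 1 - a * q ^ j) h
  rw [qProd, e, qProd]
  simp only [pow_zero, mul_one, pow_succ', mul_assoc]

lemma qProd_ne_zero {q : ℂ} (hq : ‖q‖ < 1) {a : ℂ} (h : ∀ j : ℕ, a * q ^ j ≠ 1) :
    qProd a q ≠ 0 := by
  have := tprod_one_add_ne_zero_of_summable (f := fun j : ℕ => -(a * q ^ j))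
    (fun j h0 => h j (by linear_combination -h0)) (summable_norm_qProd hq a)
  simpa [qProd, sub_eq_add_neg] using this

lemma nome_ne_zero (τ : ℍ) : nome τ ≠ 0 := Complex.exp_ne_zero _

lemma qProd_nome_ne_zero (τ : ℍ) : qProd (nome τ) (nome τ) ≠ 0 := by
  refine qProd_ne_zero (norm_nome_lt_one τ) fun j h => ?_
  have h1 : ‖nome τ ^ (j + 1)‖ < 1 := by
    rw [norm_pow]
    exact pow_lt_one₀ (norm_nonneg _) (norm_nome_lt_one τ) (by simp)
  rw [pow_succ', h] at h1
  simp at h1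

lemma theta_neg (τ : ℍ) (x : ℂ) : theta τ (-x) = -theta τ x := by
  have h1 : Complex.exp (2 * Real.pi * Complex.I * -x) =
      Complex.exp (-(2 * Real.pi * Complex.I * x)) := by congr 1; ring
  have h2 : Complex.exp (-(2 * Real.pi * Complex.I * -x)) =
      Complex.exp (2 * Real.pi * Complex.I * x) := by congr 1; ring
  rw [theta, theta, h1, h2, mul_neg, Complex.sin_neg]
  ring

lemma theta_zero (τ : ℍ) : theta τ 0 = 0 := by simp [theta]

lemma theta_add_one (τ : ℍ) (x : ℂ) : theta τ (x + 1) = -theta τ x := by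
  have h1 : Complex.exp (2 * Real.pi * Complex.I * (x + 1)) =
      Complex.exp (2 * Real.pi * Complex.I * x) := by
    rw [mul_add, mul_one, Complex.exp_add, Complex.exp_two_pi_mul_I, mul_one]
  have h2 : Complex.exp (-(2 * Real.pi * Complex.I * (x + 1))) =
      Complex.exp (-(2 * Real.pi * Complex.I * x)) := by
    rw [Complex.exp_neg, h1, Complex.exp_neg]
  rw [theta, theta, h1, h2, mul_add, mul_one, Complex.sin_add_pi]
  ring

/-- Replacing x by x + τ replaces u by qu. The product in qu loses its factor 1 − qu, the product in
u⁻¹ gains the factor 1 − u⁻¹, and these combine with the two sines into the exponential. -/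
lemma theta_add_tau (τ : ℍ) (x : ℂ) : theta τ (x + τ) =
    -Complex.exp (-(Real.pi * Complex.I * τ) - 2 * Real.pi * Complex.I * x) * theta τ x := by
  set q := nome τ with hq
  set u := Complex.exp (2 * Real.pi * Complex.I * x) with hu
  set v := Complex.exp (Real.pi * Complex.I * x) with hv
  set p := Complex.exp (Real.pi * Complex.I * τ) with hp
  have hv0 : v ≠ 0 := Complex.exp_ne_zero _
  have hp0 : p ≠ 0 := Complex.exp_ne_zero _
  have huv : u = v ^ 2 := by rw [hu, hv, ← Complex.exp_nat_mul]; congr 1; push_cast; ring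
  have hqp : q = p ^ 2 := by
    rw [hq, hp, nome, ← Complex.exp_nat_mul]; congr 1; push_cast; ring
  have h1 : Complex.exp (2 * Real.pi * Complex.I * (x + τ)) = u * q := by
    rw [mul_add, Complex.exp_add]; rfl
  have h2 : Complex.exp (-(2 * Real.pi * Complex.I * (x + τ))) = u⁻¹ * q⁻¹ := by
    rw [Complex.exp_neg, h1, mul_inv]
  have h3 : Complex.exp (-(2 * Real.pi * Complex.I * x)) = u⁻¹ := Complex.exp_neg _
  have h4 : Complex.exp (-(Real.pi * Complex.I * τ) - 2 * Real.pi * Complex.I * x) =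
      p⁻¹ * u⁻¹ := by
    rw [sub_eq_add_neg, Complex.exp_add, h3, Complex.exp_neg]
  have s1 : Complex.sin (Real.pi * x) = (v⁻¹ - v) * Complex.I / 2 := by
    rw [Complex.sin, hv, ← Complex.exp_neg]
    congr 4 <;> ring_nf
  have s2 : Complex.sin (Real.pi * (x + τ)) = ((v * p)⁻¹ - v * p) * Complex.I / 2 := by
    rw [Complex.sin, hv, hp, ← Complex.exp_add, ← Complex.exp_neg]
    congr 4 <;> ring_nf
  have hq0 : q ≠ 0 := nome_ne_zero τ
  have e1 := qProd_eq (norm_nome_lt_one τ) (q * u)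
  have e2 := qProd_eq (norm_nome_lt_one τ) u⁻¹
  rw [← hq] at e1 e2
  have a1 : q * (u * q) = q * u * q := by ring
  have a2 : q * (u⁻¹ * q⁻¹) = u⁻¹ := by field_simp
  rw [theta, theta, h1, h2, h3, h4, s1, s2, ← hq, a1, a2, e2, mul_comm q u⁻¹, e1, huv]
  generalize qProd (q * v ^ 2 * q) q = X
  generalize qProd ((v ^ 2)⁻¹ * q) q = Y
  generalize (qProd q q)⁻¹ = Z
  rw [hqp]
  have hpi : (Real.pi : ℂ) ≠ 0 := by exact_mod_cast Real.pi_ne_zero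
  field_simp
  ring

lemma theta_sub_comm (τ : ℍ) (x y : ℂ) : theta τ (x - y) = -theta τ (y - x) := by
  rw [← theta_neg, neg_sub]

lemma inLattice_of_exp {τ : ℍ} {x : ℂ} {n : ℤ}
    (h : Complex.exp (2 * Real.pi * Complex.I * x) * nome τ ^ n = 1) : InLattice τ x := by
  rw [nome, ← Complex.exp_int_mul, ← Complex.exp_add, Complex.exp_eq_one_iff] at h
  obtain ⟨k, hk⟩ := h
  refine ⟨k, -n, ?_⟩
  have := Complex.two_pi_I_ne_zero
  apply mul_left_cancel₀ this
  push_cast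
  linear_combination hk

lemma InLattice.neg {τ : ℍ} {x : ℂ} (h : InLattice τ x) : InLattice τ (-x) := by
  obtain ⟨k, l, rfl⟩ := h
  exact ⟨-k, -l, by push_cast; ring⟩

lemma InLattice.add {τ : ℍ} {x y : ℂ} (hx : InLattice τ x) (hy : InLattice τ y) :
    InLattice τ (x + y) := by
  obtain ⟨k, l, rfl⟩ := hx
  obtain ⟨k', l', rfl⟩ := hy
  exact ⟨k + k', l + l', by push_cast; ring⟩

lemma inLattice_neg {τ : ℍ} {x : ℂ} : InLattice τ (-x) ↔ InLattice τ x :=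
  ⟨fun h => by simpa using h.neg, InLattice.neg⟩

/-- A convergent product of this kind vanishes only when one of its factors does. The sine gives the
integers, and the factors 1 − q^{j+1}u^{±1} give the rest of the lattice. -/
lemma inLattice_of_theta_eq_zero {τ : ℍ} {x : ℂ} (h : theta τ x = 0) : InLattice τ x := by
  have hpi : (Real.pi : ℂ) ≠ 0 := by exact_mod_cast Real.pi_ne_zero
  have hc : (qProd (nome τ) (nome τ))⁻¹ ^ 2 ≠ 0 :=
    pow_ne_zero _ (inv_ne_zero (qProd_nome_ne_zero τ))
  rcases mul_eq_zero.1 ((mul_eq_zero.1 h).resolve_right hc) with h | h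
  · rcases mul_eq_zero.1 h with h | h
    · have h := (div_eq_zero_iff.1 h).resolve_right hpi
      obtain ⟨k, hk⟩ := Complex.sin_eq_zero_iff.1 h
      refine ⟨k, 0, ?_⟩
      apply mul_left_cancel₀ hpi
      rw [hk]
      push_cast
      ring
    · by_contra hx
      refine qProd_ne_zero (norm_nome_lt_one τ) (fun j hj => hx ?_) h
      refine inLattice_of_exp (n := j + 1) ?_
      rw [← hj, zpow_add₀ (nome_ne_zero τ)]
      simp
      ring
  · by_contra hx
    refine qProd_ne_zero (norm_nome_lt_one τ) (fun j hj => hx ?_) h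
    rw [← inLattice_neg]
    refine inLattice_of_exp (n := j + 1) ?_
    rw [← hj, zpow_add₀ (nome_ne_zero τ)]
    simp
    ring

/-- Induction over the lattice. -/
lemma lattice_induction (τ : ℍ) {P : ℂ → Prop} (h0 : P 0) (h1 : ∀ x, P x ↔ P (x + 1))
    (h2 : ∀ x, P x ↔ P (x + τ)) (k l : ℤ) : P (k + l * τ) := by
  have hk : P k := by
    induction k using Int.induction_on with
    | zero => simpa using h0
    | succ i ih => simpa using (h1 _).1 ih
    | pred i ih => exact (h1 _).2 (by simpa using ih)
  induction l using Int.induction_on with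
  | zero => simpa using hk
  | succ i ih =>
    have := (h2 _).1 ih
    convert this using 1
    push_cast; ring
  | pred i ih =>
    refine (h2 _).2 ?_
    convert ih using 1
    push_cast; ring

lemma hasDerivAt_theta (τ : ℍ) (x : ℂ) : HasDerivAt (theta τ) (deriv (theta τ) x) x :=
  (differentiable_theta τ x).hasDerivAt

lemma differentiable_deriv_theta (τ : ℍ) : Differentiable ℂ (deriv (theta τ)) :=
  fun x => ((differentiable_theta τ).analyticAt x).deriv.differentiableAt

/-- The sine vanishes at 0, so only its own derivative contributes. The two remaining products both
equal (q;q) there and cancel against the normalization. -/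
lemma deriv_theta_zero (τ : ℍ) : deriv (theta τ) 0 = 1 := by
  have hpi : (Real.pi : ℂ) ≠ 0 := by exact_mod_cast Real.pi_ne_zero
  have h := differentiable_qProd (norm_nome_lt_one τ)
  have h1 : Differentiable ℂ
      (fun x : ℂ => qProd (nome τ * Complex.exp (2 * Real.pi * Complex.I * x)) (nome τ)) :=
    h.comp (g := fun a => qProd a (nome τ)) (by fun_prop)
  have h2 : Differentiable ℂ
      (fun x : ℂ => qProd (nome τ * Complex.exp (-(2 * Real.pi * Complex.I * x))) (nome τ)) :=
    h.comp (g := fun a => qProd a (nome τ)) (by fun_prop)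
  have h3 : HasDerivAt (fun x : ℂ => Complex.sin (Real.pi * x) / Real.pi)
      (Complex.cos (Real.pi * 0) * (Real.pi * 1) / Real.pi) 0 :=
    ((((hasDerivAt_id (0 : ℂ)).const_mul (Real.pi : ℂ)).csin).div_const _)
  have h4 := ((h3.mul (h1 0).hasDerivAt).mul (h2 0).hasDerivAt).mul_const
    ((qProd (nome τ) (nome τ))⁻¹ ^ 2)
  have h5 : deriv (theta τ) 0 = _ := h4.deriv
  rw [h5]
  have := qProd_nome_ne_zero τ
  simp
  field_simp

lemma deriv_theta_add_one (τ : ℍ) (x : ℂ) :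
    deriv (theta τ) (x + 1) = -deriv (theta τ) x := by
  have h : HasDerivAt (fun y => theta τ (y + 1)) (deriv (theta τ) (x + 1)) x :=
    (hasDerivAt_theta τ (x + 1)).comp_add_const x 1
  simp only [theta_add_one] at h
  exact h.unique (hasDerivAt_theta τ x).neg

lemma deriv_theta_add_tau (τ : ℍ) (x : ℂ) : deriv (theta τ) (x + τ) =
    -Complex.exp (-(Real.pi * Complex.I * τ) - 2 * Real.pi * Complex.I * x) *
      (deriv (theta τ) x - 2 * Real.pi * Complex.I * theta τ x) := by
  have h : HasDerivAt (fun y => theta τ (y + τ)) (deriv (theta τ) (x + τ)) x :=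
    (hasDerivAt_theta τ (x + τ)).comp_add_const x τ
  simp only [theta_add_tau] at h
  have h1 : HasDerivAt (fun y : ℂ => -(Real.pi * Complex.I * τ) - 2 * Real.pi * Complex.I * y)
      (-(2 * Real.pi * Complex.I * 1)) x :=
    ((hasDerivAt_id x).const_mul (2 * Real.pi * Complex.I)).const_sub _
  rw [h.unique (h1.cexp.fun_neg.mul (hasDerivAt_theta τ x))]
  ring

/-- The zeros are simple. The two conditions are propagated together, since the derivative at x + τ
also involves θ(x). -/
lemma theta_eq_zero_and_deriv (τ : ℍ) (k l : ℤ) :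
    theta τ (k + l * τ) = 0 ∧ deriv (theta τ) (k + l * τ) ≠ 0 := by
  refine lattice_induction τ (P := fun x => theta τ x = 0 ∧ deriv (theta τ) x ≠ 0)
    ⟨theta_zero τ, by simp [deriv_theta_zero]⟩ (fun x => ?_) (fun x => ?_) k l
  · simp [theta_add_one, deriv_theta_add_one]
  · rw [theta_add_tau, deriv_theta_add_tau]
    constructor
    · rintro ⟨h, h'⟩
      simp [h, h', Complex.exp_ne_zero]
    · rintro ⟨h, h'⟩
      have h := (mul_eq_zero.1 h).resolve_left (neg_ne_zero.2 (Complex.exp_ne_zero _))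
      refine ⟨h, fun h0 => h' ?_⟩
      simp [h, h0]

lemma theta_eq_zero_iff {τ : ℍ} {x : ℂ} : theta τ x = 0 ↔ InLattice τ x :=
  ⟨inLattice_of_theta_eq_zero, fun ⟨k, l, h⟩ => h ▸ (theta_eq_zero_and_deriv τ k l).1⟩

lemma deriv_theta_ne_zero {τ : ℍ} {x : ℂ} (h : InLattice τ x) : deriv (theta τ) x ≠ 0 := by
  obtain ⟨k, l, rfl⟩ := h
  exact (theta_eq_zero_and_deriv τ k l).2

lemma rho_add_one (τ : ℍ) (x : ℂ) : rho τ (x + 1) = rho τ x := by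
  simp [rho, theta_add_one, deriv_theta_add_one]

lemma rho_add_tau (τ : ℍ) {x : ℂ} (hx : ¬ InLattice τ x) :
    rho τ (x + τ) = rho τ x - 2 * Real.pi * Complex.I := by
  have h : theta τ x ≠ 0 := fun h => hx (theta_eq_zero_iff.1 h)
  have := Complex.exp_ne_zero (-(Real.pi * Complex.I * τ) - 2 * Real.pi * Complex.I * x)
  rw [rho, rho, theta_add_tau, deriv_theta_add_tau]
  field_simp

lemma deriv_theta_neg (τ : ℍ) (x : ℂ) : deriv (theta τ) (-x) = deriv (theta τ) x := by
  have h : deriv (fun y => theta τ (-y)) x = -deriv (theta τ) (-x) := deriv_comp_neg _ x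
  simp only [theta_neg] at h
  rw [deriv.fun_neg] at h
  linear_combination h

lemma rho_neg (τ : ℍ) (x : ℂ) : rho τ (-x) = -rho τ x := by
  simp [rho, theta_neg, deriv_theta_neg, div_neg]

/-- The multiplier of θ under a τ-step has logarithmic derivative −2πi, so ρ fails to be elliptic
only by a constant counting τ-steps. -/
lemma InLattice.rho_add {τ : ℍ} {x : ℂ} (hx : ¬ InLattice τ x) (k l : ℤ) :
    rho τ (x + (k + l * τ)) = rho τ x - 2 * Real.pi * Complex.I * l := by
  have key : InLattice τ (k + l * τ) ∧
      ∃ l' : ℤ, l' = l ∧ rho τ (x + (k + l * τ)) = rho τ x - 2 * Real.pi * Complex.I * l' := by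
    refine ⟨⟨k, l, rfl⟩, l, rfl, ?_⟩
    have h1 : ∀ k : ℤ, rho τ (x + k) = rho τ x := by
      intro k
      induction k using Int.induction_on with
      | zero => simp
      | succ i ih =>
        rw [← ih, ← rho_add_one τ (x + (i : ℤ))]
        congr 1; push_cast; ring
      | pred i ih =>
        rw [← ih, ← rho_add_one]
        congr 1; push_cast; ring
    have hn : ∀ i : ℤ, ¬ InLattice τ (x + (k + i * τ)) := by
      intro i h
      refine hx ?_
      have := h.add (show InLattice τ (-(k + i * τ)) from InLattice.neg ⟨k, i, rfl⟩)
      rwa [add_neg_cancel_right] at this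
    induction l using Int.induction_on with
    | zero => simp [h1]
    | succ i ih =>
      have := rho_add_tau τ (hn i)
      rw [ih] at this
      rw [show x + ((k : ℂ) + ((i + 1 : ℤ) : ℂ) * τ) = x + (k + (i : ℤ) * τ) + τ by
        push_cast; ring, this]
      push_cast; ring
    | pred i ih =>
      have := rho_add_tau τ (hn (-i - 1))
      rw [show x + ((k : ℂ) + ((-i - 1 : ℤ) : ℂ) * τ) + τ = x + (k + (-i : ℤ) * τ) by
        push_cast; ring, ih] at this
      linear_combination -this + 2 * Real.pi * Complex.I * (by push_cast; ring :
        (((-i - 1 : ℤ) : ℂ)) = ((-i : ℤ) : ℂ) - 1)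
  obtain ⟨_, l', rfl, h⟩ := key
  exact h

/-- The constant absorbs everything independent of x. Only the exponential rate 2πil matters later,
where it is compared with the change of μ. -/
lemma theta_sub_lattice (τ : ℍ) (k l : ℤ) : ∃ c : ℂ, c ≠ 0 ∧
    ∀ x, theta τ (x - (k + l * τ)) = c * Complex.exp (2 * Real.pi * Complex.I * l * x) * theta τ x := by
  have h1 : ∃ c : ℂ, c ≠ 0 ∧ ∀ x, theta τ (x - k) = c * theta τ x := by
    induction k using Int.induction_on with
    | zero => exact ⟨1, one_ne_zero, by simp⟩
    | succ i ih =>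
      obtain ⟨c, hc, h⟩ := ih
      refine ⟨-c, neg_ne_zero.2 hc, fun x => ?_⟩
      have := theta_add_one τ (x - ((i : ℤ) + 1))
      rw [show x - (((i : ℤ) : ℂ) + 1) + 1 = x - (i : ℤ) by ring, h] at this
      push_cast at this ⊢
      linear_combination this
    | pred i ih =>
      obtain ⟨c, hc, h⟩ := ih
      refine ⟨-c, neg_ne_zero.2 hc, fun x => ?_⟩
      have := theta_add_one τ (x - (-i : ℤ))
      rw [h] at this
      rw [show x - ((-i - 1 : ℤ) : ℂ) = x - (-i : ℤ) + 1 by push_cast; ring, this]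
      ring
  induction l using Int.induction_on with
  | zero => simpa using h1
  | succ i ih =>
    obtain ⟨c, hc, h⟩ := ih
    set d := Complex.exp (-(Real.pi * Complex.I * τ) +
      2 * Real.pi * Complex.I * (k + (i + 1) * τ)) with hd
    refine ⟨-c * d⁻¹, mul_ne_zero (neg_ne_zero.2 hc) (inv_ne_zero (Complex.exp_ne_zero _)),
      fun x => ?_⟩
    have := theta_add_tau τ (x - (k + (i + 1) * τ))
    rw [show x - ((k : ℂ) + (i + 1) * τ) + τ = x - (k + (i : ℤ) * τ) by push_cast; ring, h] at this
    have e1 : Complex.exp (-(Real.pi * Complex.I * τ) -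
        2 * Real.pi * Complex.I * (x - (k + (i + 1) * τ))) =
        d * (Complex.exp (2 * Real.pi * Complex.I * x))⁻¹ := by
      rw [hd, ← Complex.exp_neg, ← Complex.exp_add]; congr 1; ring
    have e2 : Complex.exp (2 * Real.pi * Complex.I * ((i + 1 : ℤ) : ℂ) * x) =
        Complex.exp (2 * Real.pi * Complex.I * (i : ℤ) * x) *
          Complex.exp (2 * Real.pi * Complex.I * x) := by
      rw [← Complex.exp_add]; congr 1; push_cast; ring
    rw [e1] at this
    rw [e2]
    have hd0 : d ≠ 0 := Complex.exp_ne_zero _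
    have hE := Complex.exp_ne_zero (2 * Real.pi * Complex.I * x)
    push_cast at this ⊢
    field_simp at this ⊢
    linear_combination this
  | pred i ih =>
    obtain ⟨c, hc, h⟩ := ih
    set d := Complex.exp (-(Real.pi * Complex.I * τ) +
      2 * Real.pi * Complex.I * (k - i * τ)) with hd
    refine ⟨-c * d, mul_ne_zero (neg_ne_zero.2 hc) (Complex.exp_ne_zero _), fun x => ?_⟩
    have := theta_add_tau τ (x - (k + (-i : ℤ) * τ))
    rw [h] at this
    rw [show x - ((k : ℂ) + (-i - 1 : ℤ) * τ) = x - (k + (-i : ℤ) * τ) + τ by push_cast; ring, this]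
    have e1 : Complex.exp (-(Real.pi * Complex.I * τ) -
        2 * Real.pi * Complex.I * (x - (k + (-i : ℤ) * τ))) =
        d * Complex.exp (-(2 * Real.pi * Complex.I * x)) := by
      rw [hd, ← Complex.exp_add]; congr 1; push_cast; ring
    have e2 : Complex.exp (2 * Real.pi * Complex.I * ((-i - 1 : ℤ) : ℂ) * x) =
        Complex.exp (2 * Real.pi * Complex.I * (-i : ℤ) * x) *
          Complex.exp (-(2 * Real.pi * Complex.I * x)) := by
      rw [← Complex.exp_add]; congr 1; push_cast; ring
    rw [e1, e2]
    ring

lemma dense_theta_ne_zero (τ : ℍ) (z : ℂ) : Dense {x | theta τ (x - z) ≠ 0} := by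
  have h : {x | theta τ (x - z) = 0}.Countable := by
    refine (Set.countable_range fun p : ℤ × ℤ => z + (p.1 + p.2 * (τ : ℂ))).mono ?_
    intro x hx
    obtain ⟨k, l, h⟩ := theta_eq_zero_iff.1 hx
    exact ⟨(k, l), by simp only [← h]; ring⟩
  exact h.dense_compl ℂ

/-- Allows θ to be cancelled even at its zeros: their complement is dense and both sides are
continuous. -/
lemma eq_of_theta_mul_eq {τ : ℍ} {z : ℂ} {F G : ℂ → ℂ} (hF : Continuous F) (hG : Continuous G)
    (h : ∀ x, theta τ (x - z) * F x = theta τ (x - z) * G x) (x : ℂ) : F x = G x :=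
  congrFun (Continuous.ext_on (dense_theta_ne_zero τ z) hF hG fun y hy =>
    mul_left_cancel₀ hy (h y)) x


/-! ### Entire quasi-periodic functions -/

/-- Entire functions with `f(x+1) = α f(x)` and `f(x+τ) = β e^{-2πidx} f(x)`, where `α, β ≠ 0`. -/
structure QuasiPeriodic (τ : ℍ) (d : ℕ) (α β : ℂ) (f : ℂ → ℂ) : Prop where
  entire : Differentiable ℂ f
  α_ne : α ≠ 0
  β_ne : β ≠ 0
  add_one : ∀ x, f (x + 1) = α * f x
  add_tau : ∀ x, f (x + τ) = β * Complex.exp (-(2 * Real.pi * Complex.I * d * x)) * f x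

lemma exists_real_coords (τ : ℍ) (x : ℂ) : ∃ r s : ℝ, x = r + s * (τ : ℂ) := by
  have h : τ.im ≠ 0 := τ.im_ne_zero
  refine ⟨x.re - x.im / τ.im * τ.re, x.im / τ.im, ?_⟩
  apply Complex.ext
  · simp
  · simp [div_mul_cancel₀ _ h]

/-- A continuous function whose absolute value is doubly periodic is bounded. -/
lemma bounded_of_norm_periodic (τ : ℍ) {H : ℂ → ℂ} (hH : Continuous H)
    (h1 : ∀ x, ‖H (x + 1)‖ = ‖H x‖) (h2 : ∀ x, ‖H (x + τ)‖ = ‖H x‖) :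
    Bornology.IsBounded (Set.range H) := by
  have hK : IsCompact ((fun p : ℝ × ℝ => H (p.1 + p.2 * (τ : ℂ))) ''
      (Set.Icc (0 : ℝ) 1 ×ˢ Set.Icc (0 : ℝ) 1)) :=
    (isCompact_Icc.prod isCompact_Icc).image (by fun_prop)
  obtain ⟨C, hC⟩ := hK.isBounded.exists_norm_le
  refine isBounded_iff_forall_norm_le.2 ⟨C, ?_⟩
  rintro _ ⟨x, rfl⟩
  obtain ⟨r, s, rfl⟩ := exists_real_coords τ x
  have hper : ∀ k l : ℤ, ∀ y, ‖H (y + (k + l * τ))‖ = ‖H y‖ := by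
    intro k l
    refine lattice_induction τ (P := fun v => ∀ y, ‖H (y + v)‖ = ‖H y‖) (by simp)
      (fun v => ?_) (fun v => ?_) k l
    · simp only [← add_assoc, h1]
    · simp only [← add_assoc, h2]
  have := hper ⌊r⌋ ⌊s⌋ (Int.fract r + Int.fract s * (τ : ℂ))
  have e : ((Int.fract r : ℝ) : ℂ) + (Int.fract s : ℝ) * (τ : ℂ) + (⌊r⌋ + ⌊s⌋ * τ) =
      r + s * τ := by
    conv_rhs => rw [← Int.fract_add_floor r, ← Int.fract_add_floor s]
    push_cast
    ring
  rw [e] at this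
  rw [this]
  exact hC _ ⟨(Int.fract r, Int.fract s),
    ⟨⟨Int.fract_nonneg _, (Int.fract_lt_one _).le⟩, Int.fract_nonneg _, (Int.fract_lt_one _).le⟩, rfl⟩

/-- Liouville: after division by a suitable exponential both multipliers have modulus 1, so the
modulus is doubly periodic and the function bounded, hence constant. -/
lemma QuasiPeriodic.eq_exp {τ : ℍ} {α β : ℂ} {f : ℂ → ℂ} (h : QuasiPeriodic τ 0 α β f) :
    ∃ c : ℂ, ∀ x, f x = f 0 * Complex.exp (c * x) := by
  have him : τ.im ≠ 0 := τ.im_ne_zero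
  -- The exponent c = r + is is chosen with Re c = log|α| and Re(cτ) = log|β|. This real linear
  -- system is solvable because Im τ ≠ 0.
  set r := Real.log ‖α‖ with hr
  set s := (r * τ.re - Real.log ‖β‖) / τ.im with hs
  set c : ℂ := ⟨r, s⟩ with hc
  have e1 : ‖Complex.exp (-c)‖ = ‖α‖⁻¹ := by
    rw [Complex.norm_exp, Complex.neg_re, Real.exp_neg, hc, hr,
      Real.exp_log (norm_pos_iff.2 h.α_ne)]
  have e2 : ‖Complex.exp (-(c * τ))‖ = ‖β‖⁻¹ := by
    have : (c * τ).re = Real.log ‖β‖ := by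
      simp only [Complex.mul_re, hc, UpperHalfPlane.coe_re, UpperHalfPlane.coe_im, hs]
      field_simp
      ring
    rw [Complex.norm_exp, Complex.neg_re, Real.exp_neg, this, Real.exp_log (norm_pos_iff.2 h.β_ne)]
  set H : ℂ → ℂ := fun x => f x * Complex.exp (-(c * x)) with hH
  have hHd : Differentiable ℂ H := by
    have := h.entire
    fun_prop
  have hb : Bornology.IsBounded (Set.range H) := by
    refine bounded_of_norm_periodic τ hHd.continuous (fun x => ?_) (fun x => ?_)
    · have : Complex.exp (-(c * (x + 1))) = Complex.exp (-(c * x)) * Complex.exp (-c) := by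
        rw [← Complex.exp_add]; congr 1; ring
      simp only [hH, h.add_one, this, norm_mul, e1]
      have := norm_ne_zero_iff.2 h.α_ne
      field_simp
    · have : Complex.exp (-(c * (x + τ))) = Complex.exp (-(c * x)) * Complex.exp (-(c * τ)) := by
        rw [← Complex.exp_add]; congr 1; ring
      simp only [hH, h.add_tau, this, norm_mul, e2]
      have := norm_ne_zero_iff.2 h.β_ne
      simp
      field_simp
  refine ⟨c, fun x => ?_⟩
  have := hHd.apply_eq_apply_of_bounded hb x 0
  simp only [hH, mul_zero, neg_zero, Complex.exp_zero, mul_one] at this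
  rw [← this, mul_assoc, ← Complex.exp_add]
  simp

lemma QuasiPeriodic.eq_zero_of_zero {τ : ℍ} {α β : ℂ} {f : ℂ → ℂ} (h : QuasiPeriodic τ 0 α β f)
    (h0 : f 0 = 0) (x : ℂ) : f x = 0 := by
  obtain ⟨c, hc⟩ := h.eq_exp
  simp [hc x, h0]

lemma QuasiPeriodic.apply_add_lattice {τ : ℍ} {d : ℕ} {α β z : ℂ} {f : ℂ → ℂ}
    (h : QuasiPeriodic τ d α β f) (hz : f z = 0) {w : ℂ} (hw : InLattice τ w) : f (z + w) = 0 := by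
  obtain ⟨k, l, rfl⟩ := hw
  refine lattice_induction τ (P := fun v => f (z + v) = 0) (by simpa using hz)
    (fun v => ?_) (fun v => ?_) k l
  · rw [← add_assoc, h.add_one]
    simp [h.α_ne]
  · rw [← add_assoc, h.add_tau]
    simp [h.β_ne, Complex.exp_ne_zero]

/-- An entire function that vanishes on a translate of the lattice is divisible by the
corresponding translate of `θ`. -/
lemma exists_eq_theta_mul (τ : ℍ) (z : ℂ) {f : ℂ → ℂ} (hf : Differentiable ℂ f)
    (h0 : ∀ w, InLattice τ w → f (z + w) = 0) :
    ∃ K : ℂ → ℂ, Differentiable ℂ K ∧ ∀ x, f x = theta τ (x - z) * K x := by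
  set g : ℂ → ℂ := fun x => theta τ (x - z) with hg
  have hgd : Differentiable ℂ g := (differentiable_theta τ).comp (by fun_prop)
  have hg' : ∀ x, deriv g x = deriv (theta τ) (x - z) := fun x =>
    deriv_comp_sub_const (theta τ) z x
  have hf0 : ∀ x, g x = 0 → f x = 0 := fun x hx => by
    simpa using h0 _ (theta_eq_zero_iff.1 hx)
  have hg0 : ∀ x, g x = 0 → deriv g x ≠ 0 := fun x hx => by
    rw [hg']
    exact deriv_theta_ne_zero (theta_eq_zero_iff.1 hx)
  -- At a zero of θ(x − z) the quotient takes the ratio of derivatives as its value. Near such a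
  -- point p it equals the ratio of the difference quotients of f and g based at p, which is
  -- differentiable because the zero of g is simple.
  refine ⟨fun x => if g x = 0 then deriv f x / deriv g x else f x / g x, fun p => ?_, fun x => ?_⟩
  · by_cases hp : g p = 0
    · have d1 : DifferentiableAt ℂ (dslope f p) p :=
        (Complex.differentiableOn_dslope Filter.univ_mem).2 hf.differentiableOn |>.differentiableAt
          Filter.univ_mem
      have d2 : DifferentiableAt ℂ (dslope g p) p :=
        (Complex.differentiableOn_dslope Filter.univ_mem).2 hgd.differentiableOn |>.differentiableAt
          Filter.univ_mem
      have hne : dslope g p p ≠ 0 := by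
        rw [dslope_same]
        exact hg0 p hp
      refine (d1.div d2 hne).congr_of_eventuallyEq ?_
      filter_upwards [d2.continuousAt.eventually_ne hne] with x hx
      have ef := sub_smul_dslope_of_zero (hf0 p hp) x
      have eg := sub_smul_dslope_of_zero hp x
      simp only [smul_eq_mul] at ef eg
      rcases eq_or_ne x p with rfl | hxp
      · simp [hp, dslope_same]
      · have hxp' : x - p ≠ 0 := sub_ne_zero.2 hxp
        have hgx : g x ≠ 0 := by
          rw [← eg]
          exact mul_ne_zero hxp' hx
        simp only [hgx, if_false, Pi.div_apply]
        rw [← ef, ← eg]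
        field_simp
    · refine ((hf p).div (hgd p) hp).congr_of_eventuallyEq ?_
      filter_upwards [(hgd p).continuousAt.eventually_ne hp] with x hx
      simp [hx]
  · by_cases hx : g x = 0
    · have hx' : theta τ (x - z) = 0 := hx
      simp [hf0 x hx, hx']
    · have hx' : theta τ (x - z) ≠ 0 := hx
      simp only [hx, if_false]
      field_simp
      rfl

/-- Dividing by one theta factor lowers the degree by one. The new multipliers are the quotients of
the old ones by those of θ(x − z). -/
lemma QuasiPeriodic.exists_eq_theta_mul {τ : ℍ} {d : ℕ} {α β z : ℂ} {f : ℂ → ℂ}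
    (h : QuasiPeriodic τ (d + 1) α β f) (hz : f z = 0) :
    ∃ K : ℂ → ℂ, QuasiPeriodic τ d (-α)
      (-β * Complex.exp (Real.pi * Complex.I * τ - 2 * Real.pi * Complex.I * z)) K ∧
      ∀ x, f x = theta τ (x - z) * K x := by
  obtain ⟨K, hK, e⟩ := EllipticBethe.exists_eq_theta_mul τ z h.entire
    (fun w hw => h.apply_add_lattice hz hw)
  refine ⟨K, ⟨hK, neg_ne_zero.2 h.α_ne, mul_ne_zero (neg_ne_zero.2 h.β_ne) (Complex.exp_ne_zero _),
    ?_, ?_⟩, e⟩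
  · refine eq_of_theta_mul_eq (τ := τ) (z := z) (hK.continuous.comp (by fun_prop))
      (by have := hK.continuous; fun_prop) fun x => ?_
    have := h.add_one x
    rw [e, e, show x + 1 - z = x - z + 1 by ring, theta_add_one] at this
    linear_combination -this
  · refine eq_of_theta_mul_eq (τ := τ) (z := z) (hK.continuous.comp (by fun_prop))
      (by have := hK.continuous; fun_prop) fun x => ?_
    have := h.add_tau x
    rw [e, e, show x + τ - z = x - z + τ by ring, theta_add_tau] at this
    set E := Complex.exp (Real.pi * Complex.I * τ - 2 * Real.pi * Complex.I * z)
    have e1 : Complex.exp (-(Real.pi * Complex.I * τ) - 2 * Real.pi * Complex.I * (x - z)) * E =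
        Complex.exp (-(2 * Real.pi * Complex.I * x)) := by
      rw [← Complex.exp_add]; congr 1; ring
    have e2 : Complex.exp (-(2 * Real.pi * Complex.I * ((d + 1 : ℕ) : ℂ) * x)) =
        Complex.exp (-(2 * Real.pi * Complex.I * d * x)) *
          Complex.exp (-(2 * Real.pi * Complex.I * x)) := by
      rw [← Complex.exp_add]; congr 1; push_cast; ring
    rw [e2, ← e1] at this
    have hE : Complex.exp (-(Real.pi * Complex.I * τ) - 2 * Real.pi * Complex.I * (x - z)) ≠ 0 :=
      Complex.exp_ne_zero _
    apply mul_left_cancel₀ hE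
    linear_combination -this

/-- A quasi-periodic function of degree `n` with `n` given zeros that are distinct modulo the
lattice. -/
lemma QuasiPeriodic.exists_eq_prod_mul_exp {τ : ℍ} {n : ℕ} {α β : ℂ} {f : ℂ → ℂ} (z : Fin n → ℂ)
    (hz : ∀ i j, i ≠ j → ¬ InLattice τ (z i - z j)) (h : QuasiPeriodic τ n α β f)
    (h0 : ∀ i, f (z i) = 0) :
    ∃ C c : ℂ, ∀ x, f x = C * Complex.exp (c * x) * ∏ i, theta τ (x - z i) := by
  induction n generalizing α β f with
  | zero =>
    obtain ⟨c, hc⟩ := h.eq_exp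
    exact ⟨f 0, c, by simpa using hc⟩
  | succ n ih =>
    obtain ⟨K, hK, e⟩ := h.exists_eq_theta_mul (h0 0)
    obtain ⟨C, c, hC⟩ := ih (fun i => z i.succ)
      (fun i j hij => hz _ _ (by simpa using hij)) hK (fun i => by
        have := h0 i.succ
        rw [e] at this
        -- The other prescribed zeros are not congruent to the first one, so they are zeros of the
        -- quotient.
        refine (mul_eq_zero.1 this).resolve_left fun h => ?_
        exact hz _ _ (Fin.succ_ne_zero i) (theta_eq_zero_iff.1 h))
    refine ⟨C, c, fun x => ?_⟩
    rw [e, hC, Fin.prod_univ_succ]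
    ring

/-! ### Products, sums, derivatives and Wronskians of quasi-periodic functions. -/

lemma QuasiPeriodic.theta_sub (τ : ℍ) (t : ℂ) : QuasiPeriodic τ 1 (-1)
    (-Complex.exp (-(Real.pi * Complex.I * τ) + 2 * Real.pi * Complex.I * t))
    (fun x => theta τ (x - t)) where
  entire := (differentiable_theta τ).comp (by fun_prop)
  α_ne := by simp
  β_ne := neg_ne_zero.2 (Complex.exp_ne_zero _)
  add_one x := by
    rw [show x + 1 - t = x - t + 1 by ring, theta_add_one]
    ring
  add_tau x := by
    rw [show x + τ - t = x - t + τ by ring, theta_add_tau, neg_mul, neg_mul, neg_mul,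
      ← Complex.exp_add]
    congr 3
    push_cast
    ring

lemma QuasiPeriodic.one (τ : ℍ) : QuasiPeriodic τ 0 1 1 (fun _ => 1) where
  entire := by fun_prop
  α_ne := one_ne_zero
  β_ne := one_ne_zero
  add_one x := by simp
  add_tau x := by simp

lemma QuasiPeriodic.mul {τ : ℍ} {d e : ℕ} {α β α' β' : ℂ} {f g : ℂ → ℂ}
    (hf : QuasiPeriodic τ d α β f) (hg : QuasiPeriodic τ e α' β' g) :
    QuasiPeriodic τ (d + e) (α * α') (β * β') (fun x => f x * g x) where
  entire := hf.entire.mul hg.entire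
  α_ne := mul_ne_zero hf.α_ne hg.α_ne
  β_ne := mul_ne_zero hf.β_ne hg.β_ne
  add_one x := by rw [hf.add_one, hg.add_one]; ring
  add_tau x := by
    have : Complex.exp (-(2 * Real.pi * Complex.I * ((d + e : ℕ) : ℂ) * x)) =
        Complex.exp (-(2 * Real.pi * Complex.I * d * x)) *
        Complex.exp (-(2 * Real.pi * Complex.I * e * x)) := by
      rw [← Complex.exp_add]; congr 1; push_cast; ring
    rw [hf.add_tau, hg.add_tau, this]; ring

lemma QuasiPeriodic.exp (τ : ℍ) (c : ℂ) :
    QuasiPeriodic τ 0 (Complex.exp c) (Complex.exp (c * τ)) (fun x => Complex.exp (c * x)) where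
  entire := by fun_prop
  α_ne := Complex.exp_ne_zero _
  β_ne := Complex.exp_ne_zero _
  add_one x := by rw [← Complex.exp_add]; congr 1; ring
  add_tau x := by simp [← Complex.exp_add]; ring_nf

lemma QuasiPeriodic.prod {τ : ℍ} {ι : Type*} (s : Finset ι) {d : ι → ℕ} {α β : ι → ℂ}
    {f : ι → ℂ → ℂ} (h : ∀ i ∈ s, QuasiPeriodic τ (d i) (α i) (β i) (f i)) :
    QuasiPeriodic τ (∑ i ∈ s, d i) (∏ i ∈ s, α i) (∏ i ∈ s, β i) (fun x => ∏ i ∈ s, f i x) := by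
  classical
  induction s using Finset.induction_on with
  | empty => simpa using QuasiPeriodic.one τ
  | insert i s hi ih =>
    simp only [Finset.sum_insert hi, Finset.prod_insert hi]
    exact (h i (Finset.mem_insert_self i s)).mul
      (ih fun j hj => h j (Finset.mem_insert_of_mem hj))

lemma QuasiPeriodic.prod_theta_sub (τ : ℍ) {n : ℕ} (t : Fin n → ℂ) :
    QuasiPeriodic τ n ((-1) ^ n) ((-1) ^ n * Complex.exp (-(Real.pi * Complex.I * n * τ) +
      2 * Real.pi * Complex.I * ∑ j, t j)) (fun x => ∏ j, theta τ (x - t j)) := by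
  have h := QuasiPeriodic.prod Finset.univ fun j _ => QuasiPeriodic.theta_sub τ (t j)
  convert h using 1
  · simp
  · simp
  · rw [Finset.prod_neg, ← Complex.exp_sum, Finset.sum_add_distrib, ← Finset.mul_sum]
    simp only [Finset.card_univ, Fintype.card_fin, Finset.sum_const, nsmul_eq_mul]
    congr 3
    ring

lemma QuasiPeriodic.sub {τ : ℍ} {d : ℕ} {α β : ℂ} {f g : ℂ → ℂ}
    (hf : QuasiPeriodic τ d α β f) (hg : QuasiPeriodic τ d α β g) :
    QuasiPeriodic τ d α β (fun x => f x - g x) where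
  entire := hf.entire.sub hg.entire
  α_ne := hf.α_ne
  β_ne := hf.β_ne
  add_one x := by rw [hf.add_one, hg.add_one]; ring
  add_tau x := by rw [hf.add_tau, hg.add_tau]; ring

lemma QuasiPeriodic.sum {τ : ℍ} {d : ℕ} {α β : ℂ} {ι : Type*} (s : Finset ι) {f : ι → ℂ → ℂ}
    (hα : α ≠ 0) (hβ : β ≠ 0) (h : ∀ i ∈ s, QuasiPeriodic τ d α β (f i)) :
    QuasiPeriodic τ d α β (fun x => ∑ i ∈ s, f i x) where
  entire := Differentiable.fun_sum fun i hi => (h i hi).entire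
  α_ne := hα
  β_ne := hβ
  add_one x := by
    rw [Finset.mul_sum]
    exact Finset.sum_congr rfl fun i hi => (h i hi).add_one x
  add_tau x := by
    rw [Finset.mul_sum]
    exact Finset.sum_congr rfl fun i hi => (h i hi).add_tau x

lemma QuasiPeriodic.deriv_add_one {τ : ℍ} {d : ℕ} {α β : ℂ} {f : ℂ → ℂ}
    (h : QuasiPeriodic τ d α β f) (x : ℂ) : deriv f (x + 1) = α * deriv f x := by
  have e : HasDerivAt (fun y => f (y + 1)) (deriv f (x + 1)) x :=
    (h.entire (x + 1)).hasDerivAt.comp_add_const x 1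
  simp only [h.add_one] at e
  exact e.unique ((h.entire x).hasDerivAt.const_mul α)

lemma QuasiPeriodic.deriv_add_tau {τ : ℍ} {d : ℕ} {α β : ℂ} {f : ℂ → ℂ}
    (h : QuasiPeriodic τ d α β f) (x : ℂ) : deriv f (x + τ) =
      β * Complex.exp (-(2 * Real.pi * Complex.I * d * x)) *
        (deriv f x - 2 * Real.pi * Complex.I * d * f x) := by
  have e : HasDerivAt (fun y => f (y + τ)) (deriv f (x + τ)) x :=
    (h.entire (x + τ)).hasDerivAt.comp_add_const x τ
  simp only [h.add_tau] at e
  have h1 : HasDerivAt (fun y : ℂ => -(2 * Real.pi * Complex.I * d * y))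
      (-(2 * Real.pi * Complex.I * d * 1)) x :=
    ((hasDerivAt_id x).const_mul (2 * Real.pi * Complex.I * d)).fun_neg
  rw [e.unique ((h1.cexp.const_mul β).mul (h.entire x).hasDerivAt)]
  ring

/-- Under x ↦ x + τ each derivative picks up an extra multiple −2πid of the function itself. As both
degrees are d, the two extra terms cancel in the Wronskian. -/
lemma QuasiPeriodic.wr {τ : ℍ} {d : ℕ} {α β α' β' : ℂ} {f g : ℂ → ℂ}
    (hf : QuasiPeriodic τ d α β f) (hg : QuasiPeriodic τ d α' β' g) :
    QuasiPeriodic τ (d + d) (α * α') (β * β') (Wr f g) where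
  entire := by
    have h1 : Differentiable ℂ (deriv f) := fun x => (hf.entire.analyticAt x).deriv.differentiableAt
    have h2 : Differentiable ℂ (deriv g) := fun x => (hg.entire.analyticAt x).deriv.differentiableAt
    exact (hf.entire.mul h2).sub (h1.mul hg.entire)
  α_ne := mul_ne_zero hf.α_ne hg.α_ne
  β_ne := mul_ne_zero hf.β_ne hg.β_ne
  add_one x := by
    simp only [Wr, hf.add_one, hg.add_one, hf.deriv_add_one, hg.deriv_add_one]
    ring
  add_tau x := by
    have : Complex.exp (-(2 * Real.pi * Complex.I * ((d + d : ℕ) : ℂ) * x)) =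
        Complex.exp (-(2 * Real.pi * Complex.I * d * x)) *
        Complex.exp (-(2 * Real.pi * Complex.I * d * x)) := by
      rw [← Complex.exp_add]; congr 1; push_cast; ring
    simp only [Wr, hf.add_tau, hg.add_tau, hf.deriv_add_tau, hg.deriv_add_tau, this]
    ring

/-- The multipliers of a nonzero quasi-periodic function are determined. -/
lemma QuasiPeriodic.multipliers_eq {τ : ℍ} {d : ℕ} {α β α' β' : ℂ} {f g : ℂ → ℂ} {C : ℂ}
    (hf : QuasiPeriodic τ d α β f) (hg : QuasiPeriodic τ d α' β' g) (h : ∀ x, f x = C * g x)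
    (h0 : f ≠ 0) : α = α' ∧ β = β' := by
  obtain ⟨x, hx⟩ := Function.ne_iff.1 h0
  have hx : f x ≠ 0 := hx
  constructor
  · have := hf.add_one x
    rw [h, hg.add_one, mul_left_comm, ← h] at this
    exact (mul_right_cancel₀ hx this).symm
  · have := hf.add_tau x
    rw [h, hg.add_tau, mul_left_comm, ← h] at this
    exact (mul_right_cancel₀ (Complex.exp_ne_zero _) (mul_right_cancel₀ hx this)).symm


/-! ### The first order system and uniqueness of its solutions -/

lemma card_ones_comp_perm {n : ℕ} (w : Fin n → Fin 2) (s : Equiv.Perm (Fin n)) :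
    (ones (w ∘ s)).card = (ones w).card := by
  have : ones w = (ones (w ∘ s)).map s.toEmbedding := by
    ext k
    simp [ones, Finset.mem_map_equiv]
  rw [this, Finset.card_map]

lemma card_ne {m : ℕ} {w : Fin (2 * m) → Fin 2} (hw : (ones w).card = m) (a : Fin (2 * m)) :
    (Finset.univ.filter fun l => w l ≠ w a).card = m := by
  have h : (Finset.univ.filter fun k => ¬ w k = 1).card = m := by
    have := Finset.card_filter_add_card_filter_not (s := (Finset.univ : Finset (Fin (2 * m))))
      (fun k => w k = 1)
    have h1 : (Finset.univ.filter fun k => w k = 1).card = m := hw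
    rw [h1, Finset.card_univ, Fintype.card_fin] at this
    omega
  by_cases ha : w a = 1
  · simpa [ha] using h
  · have ha0 : w a = 0 := by
      generalize w a = b at ha
      fin_cases b <;> simp_all
    have : (Finset.univ.filter fun l => w l ≠ w a) = ones w := by
      ext l
      simp only [ones, Finset.mem_filter, Finset.mem_univ, true_and, ha0]
      generalize w l = b
      fin_cases b <;> simp
    rw [this, hw]

/-- Let P consist of a and the positions whose letter differs from w a. The words on either side are
exactly those in which one position of P carries the letter w a, the others in P carry the opposite
letter, and positions outside P are unchanged. This family is the same whether one starts from w at
a or from the transposed word at l. -/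
lemma swap_sum_eq {n : ℕ} (c : (Fin n → Fin 2) → ℂ) (w : Fin n → Fin 2) {a l : Fin n}
    (h : w l ≠ w a) :
    c w + ∑ b with w b ≠ w a, c (w ∘ Equiv.swap a b) =
      c (w ∘ Equiv.swap a l) + ∑ b with (w ∘ Equiv.swap a l) b ≠ (w ∘ Equiv.swap a l) l,
        c ((w ∘ Equiv.swap a l) ∘ Equiv.swap l b) := by
  have hal : a ≠ l := fun e => h (by rw [e])
  have e1 : (Finset.univ.filter fun b => w b ≠ w a) =
      insert l (Finset.univ.filter fun b => w b ≠ w a ∧ b ≠ l) := by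
    ext b
    by_cases hb : b = l <;> simp [hb, h]
  have e2 : (Finset.univ.filter fun b => (w ∘ Equiv.swap a l) b ≠ (w ∘ Equiv.swap a l) l) =
      insert a (Finset.univ.filter fun b => w b ≠ w a ∧ b ≠ l) := by
    ext b
    by_cases hb : b = l
    · subst hb
      simp [hal.symm]
    · by_cases hb' : b = a
      · subst hb'
        simp [h]
      · simp [hb, hb', Equiv.swap_apply_of_ne_of_ne]
  rw [e1, e2, Finset.sum_insert (by simp), Finset.sum_insert (by simp)]
  have e3 : (w ∘ Equiv.swap a l) ∘ Equiv.swap l a = w := by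
    funext b
    simp [Equiv.swap_comm l a]
  have e4 : ∀ b ∈ Finset.univ.filter (fun b => w b ≠ w a ∧ b ≠ l),
      c (w ∘ Equiv.swap a b) = c ((w ∘ Equiv.swap a l) ∘ Equiv.swap l b) := by
    intro b hb
    simp only [Finset.mem_filter, Finset.mem_univ, true_and] at hb
    obtain ⟨hb1, hb2⟩ := hb
    have hba : b ≠ a := fun e => hb1 (by rw [e])
    congr 1
    funext i
    simp only [Function.comp_apply]
    by_cases hi : i = l
    · subst hi
      rw [Equiv.swap_apply_left, Equiv.swap_apply_of_ne_of_ne hba hb2,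
        Equiv.swap_apply_of_ne_of_ne hal.symm hb2.symm]
      -- In a two-letter alphabet, two letters that both differ from w a are equal.
      revert h hb1
      generalize w b = x
      generalize w i = y
      generalize w a = u
      revert x y u
      decide
    · by_cases hib : i = b
      · subst hib
        rw [Equiv.swap_apply_right, Equiv.swap_apply_right, Equiv.swap_apply_right]
      · rw [Equiv.swap_apply_of_ne_of_ne hi hib]
        by_cases hia : i = a
        · subst hia
          rw [Equiv.swap_apply_left, Equiv.swap_apply_left]
          revert h hb1
          generalize w b = x
          generalize w i = y
          generalize w l = u
          revert x y u
          decide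
        · rw [Equiv.swap_apply_of_ne_of_ne hia hib, Equiv.swap_apply_of_ne_of_ne hia hi]
  rw [e3, Finset.sum_congr rfl e4]
  ring

/-- Adding c w to the transposition sum, the equation says that (1 − k) c w equals the full sum of
`swap_sum_eq`. That sum is the same for w at a and for the transposed word at l, so k ≠ 1 makes c
equal on both words. The sum then has m equal terms and the equation becomes (k + m) c w = 0. -/
lemma eq_zero_of_swap_equation {m : ℕ} (hm : 0 < m) {k : ℂ} (hk1 : k ≠ 1) (hkm : k ≠ -m)
    (c : (Fin (2 * m) → Fin 2) → ℂ)
    (h : ∀ w, (ones w).card = m → ∀ a,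
      k * c w = -∑ b with w b ≠ w a, c (w ∘ Equiv.swap a b))
    {w : Fin (2 * m) → Fin 2} (hw : (ones w).card = m) : c w = 0 := by
  have a : Fin (2 * m) := ⟨0, by omega⟩
  have hc : ∀ l, w l ≠ w a → c (w ∘ Equiv.swap a l) = c w := by
    intro l hl
    have h1 := h w hw a
    have h2 := h (w ∘ Equiv.swap a l) (by rw [card_ones_comp_perm, hw]) l
    have h3 := swap_sum_eq c w hl
    have : (1 - k) * (c (w ∘ Equiv.swap a l) - c w) = 0 := by
      linear_combination -h2 + h1 - h3
    exact sub_eq_zero.1 ((mul_eq_zero.1 this).resolve_left (sub_ne_zero.2 hk1.symm))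
  have h1 := h w hw a
  rw [Finset.sum_congr rfl (fun l hl => hc l (Finset.mem_filter.1 hl).2), Finset.sum_const,
    card_ne hw, nsmul_eq_mul] at h1
  have : (k + m) * c w = 0 := by linear_combination h1
  exact (mul_eq_zero.1 this).resolve_left fun h => hkm (by linear_combination h)

/-- The system satisfied by the coordinates of an eigenfunction multiplied by `θ(λ)^m`. -/
def IsSystemSolution (τ : ℍ) {m : ℕ} (z : Fin (2 * m) → ℂ)
    (C : (Fin (2 * m) → Fin 2) → Fin (2 * m) → ℂ) (N : (Fin (2 * m) → Fin 2) → ℂ → ℂ) : Prop :=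
  ∀ w, (ones w).card = m → ∀ a x,
    theta τ x * deriv (N w) x - m * deriv (theta τ) x * N w x =
      C w a * theta τ x * N w x - ∑ l with w l ≠ w a,
        theta τ (z a - z l - wt (w a) * x) / theta τ (z a - z l) * N (w ∘ Equiv.swap a l) x

lemma IsSystemSolution.sub {τ : ℍ} {m : ℕ} {z : Fin (2 * m) → ℂ}
    {C : (Fin (2 * m) → Fin 2) → Fin (2 * m) → ℂ} {N N' : (Fin (2 * m) → Fin 2) → ℂ → ℂ}
    (h : IsSystemSolution τ z C N) (h' : IsSystemSolution τ z C N')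
    (hd : ∀ w, Differentiable ℂ (N w)) (hd' : ∀ w, Differentiable ℂ (N' w)) :
    IsSystemSolution τ z C (fun w x => N w x - N' w x) := by
  intro w hw a x
  have e1 := h w hw a x
  have e2 := h' w hw a x
  rw [deriv_fun_sub (hd w x) (hd' w x)]
  simp only [mul_sub, Finset.sum_sub_distrib]
  linear_combination e1 - e2

lemma eq_of_theta_pow_mul_eq {τ : ℍ} (n : ℕ) {F G : ℂ → ℂ} (hF : Continuous F) (hG : Continuous G)
    (h : ∀ x, theta τ x ^ n * F x = theta τ x ^ n * G x) (x : ℂ) : F x = G x :=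
  congrFun (Continuous.ext_on (dense_theta_ne_zero τ 0) hF hG fun y hy =>
    mul_left_cancel₀ (pow_ne_zero n (by simpa using hy)) (h y)) x

/-- If `θⁿ K` solves the system, then the values at `0` of the functions `K w` satisfy the swap
equation. -/
lemma IsSystemSolution.swap_equation {τ : ℍ} {m : ℕ} {z : Fin (2 * m) → ℂ}
    (hz : ∀ i j, i ≠ j → ¬ InLattice τ (z i - z j))
    {C : (Fin (2 * m) → Fin 2) → Fin (2 * m) → ℂ} {N K : (Fin (2 * m) → Fin 2) → ℂ → ℂ}
    (h : IsSystemSolution τ z C N) (n : ℕ)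
    (hK : ∀ w, (ones w).card = m → Differentiable ℂ (K w))
    (hN : ∀ w, (ones w).card = m → ∀ x, N w x = theta τ x ^ n * K w x)
    (w : Fin (2 * m) → Fin 2) (hw : (ones w).card = m) (a : Fin (2 * m)) :
    ((n : ℂ) - m) * K w 0 = -∑ b with w b ≠ w a, K (w ∘ Equiv.swap a b) 0 := by
  have hsw : ∀ l, (ones (w ∘ Equiv.swap a l)).card = m := fun l => by rw [card_ones_comp_perm, hw]
  have hcd : Continuous (deriv (K w)) :=
    Differentiable.continuous (𝕜 := ℂ) fun x =>
      ((hK w hw).analyticAt x).deriv.differentiableAt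
  have hct : Continuous (theta τ) := (differentiable_theta τ).continuous
  have hct' : Continuous (deriv (theta τ)) := (differentiable_deriv_theta τ).continuous
  have hcK := fun l => (hK _ (hsw l)).continuous
  have hcw := (hK w hw).continuous
  -- After θⁿ is cancelled, the system can be evaluated at 0, where θ = 0 and θ′ = 1. On the left
  -- only (n − m)K survives, since differentiating θⁿ contributes n and the term −mθ′ contributes
  -- −m.
  have key := eq_of_theta_pow_mul_eq (τ := τ) n
    (F := fun x => ((n : ℂ) - m) * deriv (theta τ) x * K w x + theta τ x * deriv (K w) x)
    (G := fun x => C w a * theta τ x * K w x - ∑ l with w l ≠ w a,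
        theta τ (z a - z l - wt (w a) * x) / theta τ (z a - z l) * K (w ∘ Equiv.swap a l) x)
    (by fun_prop) (by fun_prop) (fun x => by
      have e := h w hw a x
      have ed : deriv (N w) x = (n * theta τ x ^ (n - 1) * deriv (theta τ) x) * K w x +
          theta τ x ^ n * deriv (K w) x := by
        have : N w = fun x => theta τ x ^ n * K w x := funext (hN w hw)
        rw [this]
        exact (((hasDerivAt_theta τ x).fun_pow n).mul ((hK w hw) x).hasDerivAt).deriv
      -- The case n = 0 is separate because the exponent n − 1 is then truncated to 0; the
      -- coefficient n kills that term.
      have en : theta τ x * ((n : ℂ) * theta τ x ^ (n - 1)) = n * theta τ x ^ n := by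
        cases n with
        | zero => simp
        | succ n => simp; ring
      rw [ed, hN w hw] at e
      simp only [hN _ (hsw _)] at e
      rw [mul_sub (theta τ x ^ n), Finset.mul_sum]
      have e3 : ∀ l ∈ Finset.univ.filter (fun l => w l ≠ w a),
          theta τ (z a - z l - wt (w a) * x) / theta τ (z a - z l) *
            (theta τ x ^ n * K (w ∘ Equiv.swap a l) x) =
          theta τ x ^ n * (theta τ (z a - z l - wt (w a) * x) / theta τ (z a - z l) *
            K (w ∘ Equiv.swap a l) x) := fun l _ => by ring
      rw [Finset.sum_congr rfl e3] at e
      linear_combination e - deriv (theta τ) x * K w x * en) 0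
  simp only [theta_zero, deriv_theta_zero, mul_one, zero_mul, add_zero, mul_zero, sub_zero,
    zero_sub] at key
  rw [key]
  congr 1
  refine Finset.sum_congr rfl fun l hl => ?_
  have hla : a ≠ l := fun e => (Finset.mem_filter.1 hl).2 (by rw [e])
  have : theta τ (z a - z l) ≠ 0 := fun e => hz a l hla (theta_eq_zero_iff.1 e)
  field_simp

/-- A quasi-periodic solution of the system that vanishes at `0` is zero. -/
lemma IsSystemSolution.eq_zero {τ : ℍ} {m : ℕ} (hm : 0 < m) {z : Fin (2 * m) → ℂ}
    (hz : ∀ i j, i ≠ j → ¬ InLattice τ (z i - z j))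
    {C : (Fin (2 * m) → Fin 2) → Fin (2 * m) → ℂ} {N : (Fin (2 * m) → Fin 2) → ℂ → ℂ}
    (h : IsSystemSolution τ z C N) {α β : (Fin (2 * m) → Fin 2) → ℂ}
    (hN : ∀ w, (ones w).card = m → QuasiPeriodic τ m (α w) (β w) (N w))
    (h0 : ∀ w, (ones w).card = m → N w 0 = 0) {w : Fin (2 * m) → Fin 2} (hw : (ones w).card = m)
    (x : ℂ) : N w x = 0 := by
  -- The factors θ are split off one at a time: N = θⁿK with K of degree m − n and still K(0) = 0,
  -- which is what permits the next division.
  have key : ∀ n d : ℕ, n + d = m → ∃ (K : (Fin (2 * m) → Fin 2) → ℂ → ℂ)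
      (α β : (Fin (2 * m) → Fin 2) → ℂ),
      (∀ w, (ones w).card = m → QuasiPeriodic τ d (α w) (β w) (K w)) ∧
      (∀ w, (ones w).card = m → ∀ x, N w x = theta τ x ^ n * K w x) ∧
      (∀ w, (ones w).card = m → K w 0 = 0) := by
    intro n
    induction n with
    | zero =>
      intro d hd
      obtain rfl : d = m := by omega
      exact ⟨N, α, β, hN, by simp, h0⟩
    | succ n ih =>
      intro d hd
      obtain ⟨K, α, β, h1, h2, h3⟩ := ih (d + 1) (by omega)
      have hex : ∀ w, ∃ K' : ℂ → ℂ, (ones w).card = m → QuasiPeriodic τ d (-α w)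
          (-β w * Complex.exp (Real.pi * Complex.I * τ - 2 * Real.pi * Complex.I * 0)) K' ∧
          ∀ x, K w x = theta τ x * K' x := by
        intro w
        by_cases hw : (ones w).card = m
        · obtain ⟨K', hK', e⟩ := (h1 w hw).exists_eq_theta_mul (h3 w hw)
          exact ⟨K', fun _ => ⟨hK', by simpa using e⟩⟩
        · exact ⟨0, fun h => absurd h hw⟩
      choose K' hK' using hex
      have hN' : ∀ w, (ones w).card = m → ∀ x, N w x = theta τ x ^ (n + 1) * K' w x := by
        intro w hw x
        rw [h2 w hw, (hK' w hw).2]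
        ring
      refine ⟨K', _, _, fun w hw => (hK' w hw).1, hN', fun w hw => ?_⟩
      have hnm : n + 1 ≤ m := by omega
      -- Here 1 ≤ n + 1 ≤ m, so the parameter lies between 1 − m and 0 and avoids both exceptional
      -- values 1 and −m. The value −m corresponds to order 0 and is excluded by the hypothesis that
      -- N vanishes at 0.
      refine eq_zero_of_swap_equation hm (k := ((n + 1 : ℕ) : ℂ) - m) ?_ ?_ (fun w => K' w 0)
        (h.swap_equation hz (n + 1) (fun w hw => (hK' w hw).1.entire) hN') hw
      · intro e
        have e : ((n + 1 : ℕ) : ℂ) = ((m + 1 : ℕ) : ℂ) := by push_cast at e ⊢; linear_combination e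
        have := Nat.cast_injective e
        omega
      · intro e
        have e : ((n + 1 : ℕ) : ℂ) = ((0 : ℕ) : ℂ) := by push_cast at e ⊢; linear_combination e
        have := Nat.cast_injective e
        omega
  -- After m divisions the degree is 0, so K is a multiple of an exponential, and K(0) = 0 leaves
  -- only zero.
  obtain ⟨K, α', β', h1, h2, h3⟩ := key m 0 (by omega)
  rw [h2 w hw, (h1 w hw).eq_zero_of_zero (h3 w hw), mul_zero]


/-! ### Representing functions -/

/-- `F` is the class of the function `f`. -/
def Mero.Rep (F : Mero) (f : ℂ → ℂ) : Prop := ∃ hf : Meromorphic f, F = Mero.mk f hf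

lemma Mero.Rep.add {F G : Mero} {f g : ℂ → ℂ} (hF : F.Rep f) (hG : G.Rep g) :
    (F + G).Rep (fun x => f x + g x) := by
  obtain ⟨hf, rfl⟩ := hF
  obtain ⟨hg, rfl⟩ := hG
  exact ⟨Meromorphic.add hf hg, rfl⟩

lemma Mero.Rep.mul {F G : Mero} {f g : ℂ → ℂ} (hF : F.Rep f) (hG : G.Rep g) :
    (F * G).Rep (fun x => f x * g x) := by
  obtain ⟨hf, rfl⟩ := hF
  obtain ⟨hg, rfl⟩ := hG
  exact ⟨Meromorphic.mul hf hg, rfl⟩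

lemma Mero.Rep.smul {F : Mero} {f : ℂ → ℂ} (hF : F.Rep f) (c : ℂ) :
    (c • F).Rep (fun x => c * f x) := by
  obtain ⟨hf, rfl⟩ := hF
  exact ⟨Meromorphic.const_smul hf c, rfl⟩

lemma Mero.Rep.D {F : Mero} {f : ℂ → ℂ} (hF : F.Rep f) : (Mero.D F).Rep (deriv f) := by
  obtain ⟨hf, rfl⟩ := hF
  exact ⟨hf.deriv, rfl⟩

lemma Mero.Rep.neg {F : Mero} {f : ℂ → ℂ} (hF : F.Rep f) : (-F).Rep (fun x => -f x) := by
  have := hF.smul (-1)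
  simpa using this

lemma Mero.Rep.sub {F G : Mero} {f g : ℂ → ℂ} (hF : F.Rep f) (hG : G.Rep g) :
    (F - G).Rep (fun x => f x - g x) := by
  rw [sub_eq_add_neg]
  simpa only [sub_eq_add_neg] using hF.add hG.neg

lemma Mero.Rep.zero : (0 : Mero).Rep (fun _ => 0) := ⟨Meromorphic.const 0, rfl⟩

lemma Mero.Rep.sum {ι : Type*} (s : Finset ι) {F : ι → Mero} {f : ι → ℂ → ℂ}
    (h : ∀ i ∈ s, (F i).Rep (f i)) : (∑ i ∈ s, F i).Rep (fun x => ∑ i ∈ s, f i x) := by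
  classical
  induction s using Finset.induction_on with
  | empty => simpa using Mero.Rep.zero
  | insert i s hi ih =>
    simp only [Finset.sum_insert hi]
    exact (h i (Finset.mem_insert_self i s)).add (ih fun j hj => h j (Finset.mem_insert_of_mem hj))

lemma Mero.Rep.reflect {F : Mero} {f : ℂ → ℂ} (hF : F.Rep f) :
    (Mero.neg F).Rep (fun x => f (-x)) := by
  obtain ⟨hf, rfl⟩ := hF
  exact ⟨fun x => (hf (-x)).comp_analyticAt (f := f) (g := fun y => -y) (by fun_prop), rfl⟩

/-- Two representing functions of the same element agree where both are continuous. -/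
lemma Mero.Rep.eq_at {F : Mero} {f g : ℂ → ℂ} (hf : F.Rep f) (hg : F.Rep g) {x : ℂ}
    (hfc : ContinuousAt f x) (hgc : ContinuousAt g x) : f x = g x := by
  obtain ⟨hf, e1⟩ := hf
  obtain ⟨hg, e2⟩ := hg
  have h := (Mero.mk_eq_mk hf hg).1 (e1.symm.trans e2) x
  exact tendsto_nhds_unique_of_eventuallyEq (hfc.tendsto.mono_left nhdsWithin_le_nhds)
    (hgc.tendsto.mono_left nhdsWithin_le_nhds) h

lemma Mero.Rep.eq {F G : Mero} {f : ℂ → ℂ} (hF : F.Rep f) (hG : G.Rep f) : F = G := by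
  obtain ⟨hf, rfl⟩ := hF
  obtain ⟨hg, rfl⟩ := hG
  rfl

/-! ### The action of `S₂(x)` in coordinates -/

lemma E_diag_apply (j b b' : Fin 2) : E j j b b' = if b = b' then wt j * wt b / 2 else 0 := by
  fin_cases j <;> fin_cases b <;> fin_cases b' <;> simp [E, wt] <;> norm_num

lemma E_01_apply (b b' : Fin 2) : E 0 1 b b' = if b = 0 ∧ b' = 1 then 1 else 0 := by
  fin_cases b <;> fin_cases b' <;> simp [E]

lemma E_10_apply (b b' : Fin 2) : E 1 0 b b' = if b = 1 ∧ b' = 0 then 1 else 0 := by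
  fin_cases b <;> fin_cases b' <;> simp [E]

lemma site_diag_apply {n : ℕ} (j : Fin 2) (k : Fin n) (F : VFun n) (w : Fin n → Fin 2) :
    site (E j j) k F w = (wt j * wt (w k) / 2) • F w := by
  change ∑ a : Fin 2, E j j (w k) a • F (Function.update w k a) = _
  simp only [E_diag_apply, ite_smul, zero_smul]
  rw [Finset.sum_ite_eq]
  simp

lemma site_01_apply {n : ℕ} (k : Fin n) (F : VFun n) (w : Fin n → Fin 2) :
    site (E 0 1) k F w = if w k = 0 then F (Function.update w k 1) else 0 := by
  change ∑ a : Fin 2, E 0 1 (w k) a • F (Function.update w k a) = _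
  simp only [E_01_apply, Fin.sum_univ_two]
  by_cases h : w k = 0 <;> simp [h]

lemma site_10_apply {n : ℕ} (k : Fin n) (F : VFun n) (w : Fin n → Fin 2) :
    site (E 1 0) k F w = if w k = 1 then F (Function.update w k 0) else 0 := by
  change ∑ a : Fin 2, E 1 0 (w k) a • F (Function.update w k a) = _
  simp only [E_10_apply, Fin.sum_univ_two]
  by_cases h : w k = 1 <;> simp [h]

/-- The diagonal coefficient `½ ∑_k ρ(x - z_k) h_k`. -/
noncomputable def diagCoeff (τ : ℍ) {n : ℕ} (z : Fin n → ℂ) (w : Fin n → Fin 2) (x : ℂ) : ℂ :=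
  ∑ k, rho τ (x - z k) * wt (w k) / 2

/-- The diagonal coefficient `½ ∑_k ρ'(x - z_k) h_k`. -/
noncomputable def diagCoeff' (τ : ℍ) {n : ℕ} (z : Fin n → ℂ) (w : Fin n → Fin 2) (x : ℂ) : ℂ :=
  ∑ k, deriv (rho τ) (x - z k) * wt (w k) / 2

lemma ePlus_diag_apply (τ : ℍ) {n : ℕ} (z : Fin n → ℂ) (x : ℂ) (j : Fin 2) (F : VFun n)
    (w : Fin n → Fin 2) : ePlus τ z x j j F w = (wt j * diagCoeff τ z w x) • F w := by
  simp only [ePlus, if_true, LinearMap.sum_apply, Finset.sum_apply, LinearMap.smul_apply,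
    Pi.smul_apply, site_diag_apply, smul_smul, diagCoeff, Finset.mul_sum, Finset.sum_smul]
  refine Finset.sum_congr rfl fun k _ => ?_
  congr 1
  ring

lemma dL_one_apply (τ : ℍ) {n : ℕ} (z : Fin n → ℂ) (x : ℂ) (F : VFun n) (w : Fin n → Fin 2) :
    dL τ z x 1 F w = (-diagCoeff' τ z w x) • F w := by
  simp only [dL, LinearMap.sum_apply, Finset.sum_apply, LinearMap.smul_apply,
    Pi.smul_apply, site_diag_apply, smul_smul, diagCoeff', ← Finset.sum_neg_distrib,
    Finset.sum_smul]
  refine Finset.sum_congr rfl fun k _ => ?_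
  congr 1
  have : wt 1 = -1 := by simp [wt]
  rw [this]
  ring

/-- The terms ρ(λ_{jl})e_{ll} act by zero on the zero weight subspace, so only e⁺_{jj} remains. -/
lemma L_diag_apply (τ : ℍ) {n : ℕ} (z : Fin n → ℂ) (x : ℂ) (j : Fin 2) {F : VFun n}
    (hF : F ∈ FunV0 n) (w : Fin n → Fin 2) :
    L τ z x j j F w = (wt j * diagCoeff τ z w x) • F w := by
  rw [← ePlus_diag_apply]
  rw [mem_FunV0] at hF
  simp [L, hF]

lemma pd_apply {n : ℕ} (j : Fin 2) (F : VFun n) (w : Fin n → Fin 2) :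
    pd j F w = wt j • Mero.D (F w) := by
  fin_cases j <;> simp [pd, wt]

lemma L10_apply (τ : ℍ) {n : ℕ} (z : Fin n → ℂ) (x : ℂ) (F : VFun n) (w : Fin n → Fin 2) :
    L τ z x 1 0 F w = ∑ k with w k = 0, sigmaLam τ (x - z k) 0 1 * F (Function.update w k 1) := by
  have h : L τ z x 1 0 = ∑ k, mulBy (sigmaLam τ (x - z k) 0 1) * site (E 0 1) k := by
    simp [L, ePlus]
  rw [h, LinearMap.sum_apply, Finset.sum_apply, Finset.sum_filter]
  refine Finset.sum_congr rfl fun k _ => ?_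
  change sigmaLam τ (x - z k) 0 1 * site (E 0 1) k F w = _
  rw [site_01_apply, mul_ite, mul_zero]

lemma L01_apply (τ : ℍ) {n : ℕ} (z : Fin n → ℂ) (x : ℂ) (F : VFun n) (w : Fin n → Fin 2) :
    L τ z x 0 1 F w = ∑ k with w k = 1, sigmaLam τ (x - z k) 1 0 * F (Function.update w k 0) := by
  have h : L τ z x 0 1 = ∑ k, mulBy (sigmaLam τ (x - z k) 1 0) * site (E 1 0) k := by
    simp [L, ePlus]
  rw [h, LinearMap.sum_apply, Finset.sum_apply, Finset.sum_filter]
  refine Finset.sum_congr rfl fun k _ => ?_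
  change sigmaLam τ (x - z k) 1 0 * site (E 1 0) k F w = _
  rw [site_10_apply, mul_ite, mul_zero]

/-- The letters 1 of the updated word sit at k and at the old positions of 1. Resetting k restores
w, while resetting l ≠ k transposes the letters at k and l. -/
lemma L01_update_apply (τ : ℍ) {n : ℕ} (z : Fin n → ℂ) (x : ℂ) (F : VFun n) (w : Fin n → Fin 2)
    {k : Fin n} (hk : w k = 0) :
    L τ z x 0 1 F (Function.update w k 1) = sigmaLam τ (x - z k) 1 0 * F w +
      ∑ l with w l = 1, sigmaLam τ (x - z l) 1 0 * F (w ∘ Equiv.swap k l) := by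
  have e : (Finset.univ.filter fun l => Function.update w k 1 l = 1) =
      insert k (Finset.univ.filter fun l => w l = 1) := by
    ext l
    by_cases h : l = k
    · subst h; simp
    · simp [h]
  rw [L01_apply, e, Finset.sum_insert (by simp [hk])]
  congr 1
  · congr 2
    rw [Function.update_idem, ← hk, Function.update_eq_self]
  · refine Finset.sum_congr rfl fun l hl => ?_
    have hl1 : w l = 1 := (Finset.mem_filter.1 hl).2
    have hkl : k ≠ l := fun e => by rw [e, hl1] at hk; exact one_ne_zero hk
    congr 2
    funext i
    by_cases hi : i = l
    · subst hi
      simp [hk]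
    · by_cases hik : i = k
      · subst hik
        simp [hkl, hl1]
      · simp [hi, hik, Equiv.swap_apply_of_ne_of_ne]

lemma S2_apply (τ : ℍ) {n : ℕ} (z : Fin n → ℂ) (x : ℂ) {F : VFun n} (hF : F ∈ FunV0 n)
    (w : Fin n → Fin 2) :
    S2 τ z x F w =
      (diagCoeff τ z w x • (Mero.D (F w) - diagCoeff τ z w x • F w) -
        Mero.D (Mero.D (F w) - diagCoeff τ z w x • F w)) - diagCoeff' τ z w x • F w -
      ∑ k with w k = 0, sigmaLam τ (x - z k) 0 1 * (sigmaLam τ (x - z k) 1 0 * F w +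
        ∑ l with w l = 1, sigmaLam τ (x - z l) 1 0 * F (w ∘ Equiv.swap k l)) := by
  -- The inner factor preserves the zero weight space, so the diagonal formula applies to the outer
  -- factor as well.
  have hG : (L τ z x 1 1 - pd 1 : Module.End ℂ (VFun n)) F ∈ FunV0 n :=
    FunV0_invariant (fun j => (total_comm_L_diag τ z x j 1).sub_right (pd_comm_total 1 _)) F hF
  have hGw : (L τ z x 1 1 - pd 1 : Module.End ℂ (VFun n)) F w = Mero.D (F w) - diagCoeff τ z w x • F w := by
    rw [LinearMap.sub_apply, Pi.sub_apply, L_diag_apply τ z x 1 hF, pd_apply]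
    simp [wt]
    abel
  have h1 : ((L τ z x 0 0 - pd 0) * (L τ z x 1 1 - pd 1) : Module.End ℂ (VFun n)) F w =
      diagCoeff τ z w x • (Mero.D (F w) - diagCoeff τ z w x • F w) -
        Mero.D (Mero.D (F w) - diagCoeff τ z w x • F w) := by
    rw [Module.End.mul_apply, ← hGw, LinearMap.sub_apply, Pi.sub_apply,
      L_diag_apply τ z x 0 hG, pd_apply]
    simp [wt]
  have h2 : (L τ z x 1 0 * L τ z x 0 1) F w =
      ∑ k with w k = 0, sigmaLam τ (x - z k) 0 1 * (sigmaLam τ (x - z k) 1 0 * F w +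
        ∑ l with w l = 1, sigmaLam τ (x - z l) 1 0 * F (w ∘ Equiv.swap k l)) := by
    rw [Module.End.mul_apply, L10_apply]
    exact Finset.sum_congr rfl fun k hk => by
      rw [L01_update_apply τ z x F w (Finset.mem_filter.1 hk).2]
  rw [S2, LinearMap.sub_apply, LinearMap.add_apply, Pi.sub_apply, Pi.add_apply, h1, h2,
    dL_one_apply, neg_smul]
  abel

lemma continuousAt_sigma (τ : ℍ) {a v : ℂ} (ha : ¬ InLattice τ a) (hv : ¬ InLattice τ v) :
    ContinuousAt (sigma τ a) v := by
  have hc := (differentiable_theta τ).continuous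
  have h : theta τ a * theta τ v ≠ 0 :=
    mul_ne_zero (fun h => ha (theta_eq_zero_iff.1 h)) (fun h => hv (theta_eq_zero_iff.1 h))
  unfold sigma
  exact ContinuousAt.div (by fun_prop) (by fun_prop) h

/-- The eigenvalue equation for `S₂(x)` at a point. -/
lemma eigen_equation (τ : ℍ) {n : ℕ} (z : Fin n → ℂ) {x : ℂ} (hx : ∀ k, ¬ InLattice τ (x - z k))
    (F : FunV0 n) (ψ : (Fin n → Fin 2) → ℂ → ℂ) (hψ : ∀ w, ((F : VFun n) w).Rep (ψ w))
    (hψa : ∀ w v, ¬ InLattice τ v → AnalyticAt ℂ (ψ w) v) {e : ℂ} (he : S τ z 1 x F = e • F)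
    (w : Fin n → Fin 2) {v : ℂ} (hv : ¬ InLattice τ v) :
    -(deriv (deriv (ψ w)) v - 2 * diagCoeff τ z w x * deriv (ψ w) v +
        diagCoeff τ z w x ^ 2 * ψ w v) - diagCoeff' τ z w x * ψ w v -
      ∑ k with w k = 0, sigma τ (x - z k) v * (sigma τ (x - z k) (-v) * ψ w v +
        ∑ l with w l = 1, sigma τ (x - z l) (-v) * ψ (w ∘ Equiv.swap k l) v) = e * ψ w v := by
  have h1 : S2 τ z x F w = e • (F : VFun n) w := by
    have := congrFun (congrArg Subtype.val he) w
    simpa [S] using this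
  have r1 := (hψ w).smul e
  have hs01 : ∀ k, (sigmaLam τ (x - z k) 0 1).Rep (fun v => sigma τ (x - z k) v) := fun k => by
    have : (sigmaLam τ (x - z k) 0 1).Rep (fun v => sigma τ (x - z k) (lam 0 1 v)) := ⟨_, rfl⟩
    simpa [lam] using this
  have hs10 : ∀ k, (sigmaLam τ (x - z k) 1 0).Rep (fun v => sigma τ (x - z k) (-v)) := fun k => by
    have : (sigmaLam τ (x - z k) 1 0).Rep (fun v => sigma τ (x - z k) (lam 1 0 v)) := ⟨_, rfl⟩
    simpa [lam] using this
  rw [S2_apply τ z x F.2, map_sub, map_smul] at h1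
  have rD := (hψ w).D
  have r2 := ((((rD.sub ((hψ w).smul (diagCoeff τ z w x))).smul (diagCoeff τ z w x)).sub
    (rD.D.sub (rD.smul (diagCoeff τ z w x)))).sub ((hψ w).smul (diagCoeff' τ z w x))).sub
    (Mero.Rep.sum (Finset.univ.filter fun k => w k = 0) fun k _ => (hs01 k).mul
      (((hs10 k).mul (hψ w)).add (Mero.Rep.sum (Finset.univ.filter fun l => w l = 1) fun l _ =>
        (hs10 l).mul (hψ (w ∘ Equiv.swap k l)))))
  rw [h1] at r2
  have hv' : ¬ InLattice τ (-v) := fun h => hv (inLattice_neg.1 h)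
  have c1 : ∀ k, ContinuousAt (fun v => sigma τ (x - z k) v) v := fun k =>
    continuousAt_sigma τ (hx k) hv
  have c2 : ∀ k, ContinuousAt (fun v => sigma τ (x - z k) (-v)) v := fun k =>
    ContinuousAt.comp (g := sigma τ (x - z k)) (continuousAt_sigma τ (hx k) hv') continuousAt_neg
  have c3 : ∀ w, ContinuousAt (ψ w) v := fun w => (hψa w v hv).continuousAt
  have c4 : ContinuousAt (deriv (ψ w)) v := (hψa w v hv).deriv.continuousAt
  have c5 : ContinuousAt (deriv (deriv (ψ w))) v := (hψa w v hv).deriv.deriv.continuousAt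
  -- Equality as meromorphic classes becomes equality at the point v, since both representatives are
  -- continuous off the lattice.
  have := r2.eq_at r1 (x := v) (by
    have := c3 w
    refine ContinuousAt.sub (by fun_prop) ?_
    refine tendsto_finsetSum _ fun k _ => ?_
    refine ContinuousAt.mul (c1 k) (ContinuousAt.add ((c2 k).mul (c3 w)) ?_)
    exact tendsto_finsetSum _ fun l _ => ContinuousAt.mul (c2 l) (c3 _)) (by
    have := c3 w
    fun_prop)
  linear_combination this


/-! ### Polar parts -/

/-- `F(y) = c₂/y² + c₁/y + o(1/y)` as `y → 0`. -/
def PolarPart (F : ℂ → ℂ) (c₂ c₁ : ℂ) : Prop :=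
  Filter.Tendsto (fun y => y * (F y - c₂ / y ^ 2)) (𝓝[≠] 0) (𝓝 c₁)

namespace PolarPart

variable {F G : ℂ → ℂ} {c₁ c₂ d₁ d₂ : ℂ}

lemma congr (h : PolarPart F c₂ c₁) (e : ∀ᶠ y in 𝓝[≠] 0, F y = G y) : PolarPart G c₂ c₁ :=
  Filter.Tendsto.congr' (by filter_upwards [e] with y hy; rw [hy]) h

lemma unique (h : PolarPart F c₂ c₁) (h' : PolarPart F c₂ d₁) : c₁ = d₁ :=
  tendsto_nhds_unique h h'

lemma add (h : PolarPart F c₂ c₁) (h' : PolarPart G d₂ d₁) :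
    PolarPart (fun y => F y + G y) (c₂ + d₂) (c₁ + d₁) := by
  refine (Filter.Tendsto.add h h').congr fun y => ?_
  ring

lemma const_mul (h : PolarPart F c₂ c₁) (c : ℂ) :
    PolarPart (fun y => c * F y) (c * c₂) (c * c₁) := by
  refine (Filter.Tendsto.const_mul c h).congr fun y => ?_
  ring

lemma mul_const (h : PolarPart F c₂ c₁) (c : ℂ) :
    PolarPart (fun y => F y * c) (c₂ * c) (c₁ * c) := by
  simpa only [mul_comm c] using h.const_mul c

lemma neg (h : PolarPart F c₂ c₁) : PolarPart (fun y => -F y) (-c₂) (-c₁) := by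
  simpa using h.const_mul (-1)

lemma sub (h : PolarPart F c₂ c₁) (h' : PolarPart G d₂ d₁) :
    PolarPart (fun y => F y - G y) (c₂ - d₂) (c₁ - d₁) := by
  simpa only [sub_eq_add_neg] using h.add h'.neg

lemma of_continuousAt (h : ContinuousAt F 0) : PolarPart F 0 0 := by
  have h1 : ContinuousAt (fun y => y * F y) 0 := continuousAt_id.mul h
  have h2 := h1.tendsto.mono_left (nhdsWithin_le_nhds (s := {0}ᶜ))
  simp only [zero_mul] at h2
  simpa [PolarPart] using h2

lemma sum {ι : Type*} (s : Finset ι) {F : ι → ℂ → ℂ} {c₂ c₁ : ι → ℂ}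
    (h : ∀ i ∈ s, PolarPart (F i) (c₂ i) (c₁ i)) :
    PolarPart (fun y => ∑ i ∈ s, F i y) (∑ i ∈ s, c₂ i) (∑ i ∈ s, c₁ i) := by
  classical
  induction s using Finset.induction_on with
  | empty => simpa using of_continuousAt (F := fun _ => 0) continuousAt_const
  | insert i s hi ih =>
    simp only [Finset.sum_insert hi]
    exact (h i (Finset.mem_insert_self i s)).add (ih fun j hj => h j (Finset.mem_insert_of_mem hj))

/-- Restricted to simple poles: at a double pole the derivative of G would enter the residue. -/
lemma mul_continuousAt (h : PolarPart F 0 c₁) (hG : ContinuousAt G 0) :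
    PolarPart (fun y => F y * G y) 0 (c₁ * G 0) := by
  have h2 := hG.tendsto.mono_left (nhdsWithin_le_nhds (s := {0}ᶜ))
  refine (Filter.Tendsto.mul h h2).congr fun y => ?_
  ring

/-- `F(y) = c₂/y² + c₁/y + G(y)` with `G` continuous at `0`. -/
lemma of_expansion (hG : ContinuousAt G 0)
    (h : ∀ᶠ y in 𝓝[≠] (0 : ℂ), F y = c₂ / y ^ 2 + c₁ / y + G y) : PolarPart F c₂ c₁ := by
  have h1 : ContinuousAt (fun y => c₁ + y * G y) 0 :=
    continuousAt_const.add (continuousAt_id.mul hG)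
  have h2 := h1.tendsto.mono_left (nhdsWithin_le_nhds (s := {0}ᶜ))
  simp only [zero_mul, add_zero] at h2
  refine h2.congr' ?_
  filter_upwards [h, self_mem_nhdsWithin] with y hy hy0
  have hy0 : y ≠ 0 := hy0
  rw [hy]
  field_simp
  ring

end PolarPart

/-! ### Laurent expansions of ρ, ρ′ and σ at the origin. -/

lemma deriv_zero_of_even {f : ℂ → ℂ} (h : ∀ x, f (-x) = f x) : deriv f 0 = 0 := by
  have e : deriv (fun y => f (-y)) 0 = -deriv f (-0) := deriv_comp_neg _ _
  simp only [h, neg_zero] at e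
  linear_combination e / 2

/-- `θ(x)/x`. -/
noncomputable def thetaSlope (τ : ℍ) : ℂ → ℂ := dslope (theta τ) 0

lemma differentiable_thetaSlope (τ : ℍ) : Differentiable ℂ (thetaSlope τ) :=
  differentiableOn_univ.1 ((Complex.differentiableOn_dslope Filter.univ_mem).2
    (differentiable_theta τ).differentiableOn)

lemma theta_eq_mul_thetaSlope (τ : ℍ) (x : ℂ) : theta τ x = x * thetaSlope τ x := by
  have := sub_smul_dslope_of_zero (theta_zero τ) x
  simpa [thetaSlope] using this.symm

lemma thetaSlope_zero (τ : ℍ) : thetaSlope τ 0 = 1 := by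
  rw [thetaSlope, dslope_same, deriv_theta_zero]

lemma thetaSlope_neg (τ : ℍ) (x : ℂ) : thetaSlope τ (-x) = thetaSlope τ x := by
  rcases eq_or_ne x 0 with rfl | hx
  · simp
  · have h := theta_neg τ x
    rw [theta_eq_mul_thetaSlope, theta_eq_mul_thetaSlope] at h
    apply mul_left_cancel₀ hx
    linear_combination -h

lemma eventually_thetaSlope_ne_zero (τ : ℍ) : ∀ᶠ y in 𝓝 (0 : ℂ), thetaSlope τ y ≠ 0 :=
  (differentiable_thetaSlope τ).continuous.continuousAt.eventually_ne (by simp [thetaSlope_zero])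

/-- The regular part of `ρ` at `0`. -/
noncomputable def rhoReg (τ : ℍ) (x : ℂ) : ℂ := deriv (thetaSlope τ) x / thetaSlope τ x

lemma rho_eq (τ : ℍ) {y : ℂ} (hy : y ≠ 0) (h : thetaSlope τ y ≠ 0) :
    rho τ y = 1 / y + rhoReg τ y := by
  have e : theta τ = fun x => x * thetaSlope τ x := funext (theta_eq_mul_thetaSlope τ)
  have d : deriv (theta τ) y = 1 * thetaSlope τ y + y * deriv (thetaSlope τ) y := by
    rw [e]
    exact ((hasDerivAt_id y).mul ((differentiable_thetaSlope τ) y).hasDerivAt).deriv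
  rw [rho, d, theta_eq_mul_thetaSlope, rhoReg]
  field_simp

lemma analyticAt_rhoReg (τ : ℍ) {y : ℂ} (h : thetaSlope τ y ≠ 0) : AnalyticAt ℂ (rhoReg τ) y :=
  ((differentiable_thetaSlope τ).analyticAt y).deriv.div
    ((differentiable_thetaSlope τ).analyticAt y) h

lemma rhoReg_zero (τ : ℍ) : rhoReg τ 0 = 0 := by
  rw [rhoReg, deriv_zero_of_even (thetaSlope_neg τ), zero_div]

lemma polarPart_rho (τ : ℍ) : PolarPart (rho τ) 0 1 := by
  refine PolarPart.of_expansion (G := rhoReg τ)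
    (analyticAt_rhoReg τ (by simp [thetaSlope_zero])).continuousAt ?_
  filter_upwards [self_mem_nhdsWithin, nhdsWithin_le_nhds (eventually_thetaSlope_ne_zero τ)]
    with y hy h
  rw [rho_eq τ hy h]
  simp

/-- Since θ(x)/x is even, the regular part of ρ vanishes at 0, so the cross term 2·`rhoReg`(y)/y is
regular and no residue appears. -/
lemma polarPart_rho_sq (τ : ℍ) : PolarPart (fun y => rho τ y ^ 2) 1 0 := by
  have ha := analyticAt_rhoReg τ (y := 0) (by simp [thetaSlope_zero])
  refine PolarPart.of_expansion (G := fun y => 2 * dslope (rhoReg τ) 0 y + rhoReg τ y ^ 2) ?_ ?_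
  · have h1 := continuousAt_dslope_same.2 ha.differentiableAt
    have h2 := ha.continuousAt
    fun_prop
  · filter_upwards [self_mem_nhdsWithin, nhdsWithin_le_nhds (eventually_thetaSlope_ne_zero τ)]
      with y hy h
    have hy : y ≠ 0 := hy
    have e := sub_smul_dslope_of_zero (rhoReg_zero τ) y
    simp only [sub_zero, smul_eq_mul] at e
    rw [rho_eq τ hy h, ← e]
    field_simp
    ring

lemma polarPart_deriv_rho (τ : ℍ) : PolarPart (deriv (rho τ)) (-1) 0 := by
  have ha := analyticAt_rhoReg τ (y := 0) (by simp [thetaSlope_zero])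
  refine PolarPart.of_expansion (G := deriv (rhoReg τ)) ha.deriv.continuousAt ?_
  filter_upwards [self_mem_nhdsWithin, nhdsWithin_le_nhds (eventually_thetaSlope_ne_zero τ)]
    with y hy h
  have hy : y ≠ 0 := hy
  have e : rho τ =ᶠ[𝓝 y] fun x => x⁻¹ + rhoReg τ x := by
    filter_upwards [isOpen_ne.mem_nhds hy,
      (differentiable_thetaSlope τ).continuous.continuousAt.eventually_ne h] with x hx hx'
    rw [rho_eq τ hx hx', one_div]
  rw [e.deriv_eq,
    ((hasDerivAt_inv hy).fun_add (analyticAt_rhoReg τ h).differentiableAt.hasDerivAt).deriv]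
  ring

lemma theta_ne_zero {τ : ℍ} {v : ℂ} (hv : ¬ InLattice τ v) : theta τ v ≠ 0 :=
  fun h => hv (theta_eq_zero_iff.1 h)

lemma polarPart_sigma (τ : ℍ) {v : ℂ} (hv : ¬ InLattice τ v) :
    PolarPart (fun y => sigma τ y v) 0 1 := by
  have hv := theta_ne_zero hv
  have hc := (differentiable_thetaSlope τ).continuous
  have ht := (differentiable_theta τ).continuous
  have h1 : ContinuousAt (fun y => theta τ (y + v) / (thetaSlope τ y * theta τ v)) 0 :=
    ContinuousAt.div (by fun_prop) (by fun_prop) (by simp [thetaSlope_zero, hv])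
  have h2 := h1.tendsto.mono_left (nhdsWithin_le_nhds (s := {0}ᶜ))
  simp only [zero_add, thetaSlope_zero, one_mul, div_self hv] at h2
  refine h2.congr' ?_
  filter_upwards [self_mem_nhdsWithin, nhdsWithin_le_nhds (eventually_thetaSlope_ne_zero τ)]
    with y hy h
  have hy : y ≠ 0 := hy
  rw [sigma, theta_eq_mul_thetaSlope τ y]
  field_simp
  ring

/-- Oddness of θ turns the product into P(y)/y² with P even and P(0) = 1. As P′(0) = 0, there is no
residue. -/
lemma polarPart_sigma_mul_sigma (τ : ℍ) {v : ℂ} (hv : ¬ InLattice τ v) :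
    PolarPart (fun y => sigma τ y v * sigma τ y (-v)) 1 0 := by
  have hv := theta_ne_zero hv
  set P : ℂ → ℂ := fun y => theta τ (y + v) * theta τ (-y + v) / (thetaSlope τ y * theta τ v) ^ 2
    with hP
  have hP0 : P 0 = 1 := by
    simp only [hP, neg_zero, zero_add, thetaSlope_zero, one_mul]
    field_simp
  have hPe : ∀ y, P (-y) = P y := fun y => by
    simp only [hP, neg_neg, thetaSlope_neg]
    ring
  have hPd : DifferentiableAt ℂ P 0 := by
    have h1 := differentiable_thetaSlope τ
    have h2 := differentiable_theta τ
    refine DifferentiableAt.div ?_ ?_ (by simp [thetaSlope_zero, hv])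
    · exact ((h2.comp (by fun_prop : Differentiable ℂ fun y : ℂ => y + v)).mul
        (h2.comp (by fun_prop : Differentiable ℂ fun y : ℂ => -y + v))).differentiableAt
    · exact ((h1.mul_const _).pow 2).differentiableAt
  have h := hasDerivAt_iff_tendsto_slope.1 hPd.hasDerivAt
  rw [deriv_zero_of_even hPe] at h
  refine h.congr' ?_
  filter_upwards [self_mem_nhdsWithin, nhdsWithin_le_nhds (eventually_thetaSlope_ne_zero τ)]
    with y hy h
  have hy : y ≠ 0 := hy
  have e1 : theta τ (-y + v) = -theta τ (y + -v) := by
    rw [← theta_neg]; congr 1; ring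
  rw [slope_def_field, hP0, hP]
  simp only [sigma, theta_neg, e1, theta_eq_mul_thetaSlope τ y]
  field_simp
  ring

/-! ### The first order equations -/

/-- `½ ∑_{b ≠ a} ρ(z_a - z_b) h_b`. -/
noncomputable def offDiagCoeff (τ : ℍ) {n : ℕ} (z : Fin n → ℂ) (w : Fin n → Fin 2) (a : Fin n) : ℂ :=
  ∑ b ∈ Finset.univ.erase a, rho τ (z a - z b) * wt (w b) / 2

lemma wt_mul_self (b : Fin 2) : wt b * wt b = 1 := by
  fin_cases b <;> simp [wt]

lemma continuousAt_rho {τ : ℍ} {x : ℂ} (hx : ¬ InLattice τ x) : ContinuousAt (rho τ) x :=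
  ((differentiable_deriv_theta τ).continuous.continuousAt).div
    (differentiable_theta τ).continuous.continuousAt (theta_ne_zero hx)

lemma analyticAt_rho {τ : ℍ} {x : ℂ} (hx : ¬ InLattice τ x) : AnalyticAt ℂ (rho τ) x :=
  ((differentiable_deriv_theta τ).analyticAt x).div
    ((differentiable_theta τ).analyticAt x) (theta_ne_zero hx)

lemma polarPart_diagCoeff' {τ : ℍ} {n : ℕ} {z : Fin n → ℂ}
    (hz : ∀ i j, i ≠ j → ¬ InLattice τ (z i - z j)) (w : Fin n → Fin 2) (a : Fin n) :
    PolarPart (fun y => diagCoeff' τ z w (z a + y)) (-(wt (w a) / 2)) 0 := by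
  have h := PolarPart.sum Finset.univ
    (F := fun b y => deriv (rho τ) (z a + y - z b) * wt (w b) / 2)
    (c₂ := fun b => if b = a then -(wt (w a) / 2) else 0) (c₁ := fun b => 0) (fun b _ => by
      by_cases hb : b = a
      · subst hb
        have := (polarPart_deriv_rho τ).mul_const (wt (w b) / 2)
        simp only [add_sub_cancel_left, if_true]
        convert this using 1
        · funext y; ring
        · ring
        · ring
      · simp only [if_neg hb]
        refine PolarPart.of_continuousAt ?_
        have h1 : ContinuousAt (deriv (rho τ)) (z a + 0 - z b) := by
          rw [add_zero]
          exact (analyticAt_rho (hz a b (Ne.symm hb))).deriv.continuousAt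
        have h2 : ContinuousAt (fun y => deriv (rho τ) (z a + y - z b)) 0 :=
          ContinuousAt.comp (f := fun y => z a + y - z b) h1 (by fun_prop)
        fun_prop)
  simpa [diagCoeff'] using h

lemma continuousAt_offDiag {τ : ℍ} {n : ℕ} {z : Fin n → ℂ}
    (hz : ∀ i j, i ≠ j → ¬ InLattice τ (z i - z j)) (w : Fin n → Fin 2) (a : Fin n) :
    ContinuousAt (fun y => ∑ b ∈ Finset.univ.erase a, rho τ (z a + y - z b) * wt (w b) / 2) 0 := by
  refine tendsto_finsetSum _ fun b hb => ?_
  have h1 : ContinuousAt (rho τ) (z a + 0 - z b) := by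
    rw [add_zero]
    exact continuousAt_rho (hz a b (Finset.ne_of_mem_erase hb).symm)
  have h2 : ContinuousAt (fun y => rho τ (z a + y - z b)) 0 :=
    ContinuousAt.comp (f := fun y => z a + y - z b) h1 (by fun_prop)
  have h3 : ContinuousAt (fun y => rho τ (z a + y - z b) * wt (w b) / 2) 0 := by fun_prop
  exact h3

lemma diagCoeff_eq (τ : ℍ) {n : ℕ} (z : Fin n → ℂ) (w : Fin n → Fin 2) (a : Fin n) (y : ℂ) : diagCoeff τ z w (z a + y) =
    rho τ y * (wt (w a) / 2) +
      ∑ b ∈ Finset.univ.erase a, rho τ (z a + y - z b) * wt (w b) / 2 := by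
  rw [diagCoeff, ← Finset.add_sum_erase _ _ (Finset.mem_univ a), add_sub_cancel_left]
  ring

lemma polarPart_diagCoeff {τ : ℍ} {n : ℕ} {z : Fin n → ℂ}
    (hz : ∀ i j, i ≠ j → ¬ InLattice τ (z i - z j)) (w : Fin n → Fin 2) (a : Fin n) :
    PolarPart (fun y => diagCoeff τ z w (z a + y)) 0 (wt (w a) / 2) := by
  have h := ((polarPart_rho τ).mul_const (wt (w a) / 2)).add
    (PolarPart.of_continuousAt (continuousAt_offDiag hz w a))
  simp only [← diagCoeff_eq] at h
  simpa using h

/-- Write the coefficient as ½h_aρ(y) + R(y) with R continuous. Then ρ²/4 gives the double pole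
without residue, and the cross term h_aρR gives the residue h_aR(0). -/
lemma polarPart_diagCoeff_sq {τ : ℍ} {n : ℕ} {z : Fin n → ℂ}
    (hz : ∀ i j, i ≠ j → ¬ InLattice τ (z i - z j)) (w : Fin n → Fin 2) (a : Fin n) :
    PolarPart (fun y => diagCoeff τ z w (z a + y) ^ 2) (1 / 4)
      (wt (w a) * offDiagCoeff τ z w a) := by
  have hc := continuousAt_offDiag hz w a
  have h1 : PolarPart (fun y => rho τ y * wt (w a)) 0 (wt (w a)) := by
    simpa using (polarPart_rho τ).mul_const (wt (w a))
  have h := (((polarPart_rho_sq τ).mul_const (1 / 4)).add (h1.mul_continuousAt hc)).add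
    (PolarPart.of_continuousAt (hc.pow 2))
  have e : (fun y => diagCoeff τ z w (z a + y) ^ 2) = fun y => rho τ y ^ 2 * (1 / 4) +
      rho τ y * wt (w a) * (∑ b ∈ Finset.univ.erase a, rho τ (z a + y - z b) * wt (w b) / 2) +
      (∑ b ∈ Finset.univ.erase a, rho τ (z a + y - z b) * wt (w b) / 2) ^ 2 := by
    funext y
    rw [diagCoeff_eq]
    linear_combination rho τ y ^ 2 / 4 * wt_mul_self (w a)
  rw [e]
  have e1 : (1 : ℂ) * (1 / 4) + 0 + 0 = 1 / 4 := by ring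
  rw [e1, zero_mul, zero_add, add_zero, add_zero] at h
  exact h


lemma continuousAt_sigma_left {τ : ℍ} {x v : ℂ} (hx : ¬ InLattice τ x) (hv : ¬ InLattice τ v) :
    ContinuousAt (fun y => sigma τ (x + y) v) 0 := by
  have hc := (differentiable_theta τ).continuous
  have h : theta τ (x + 0) * theta τ v ≠ 0 := by
    rw [add_zero]
    exact mul_ne_zero (theta_ne_zero hx) (theta_ne_zero hv)
  unfold sigma
  exact ContinuousAt.div (by fun_prop) (by fun_prop) h

lemma Fin2.eq_zero_or_one (b : Fin 2) : b = 0 ∨ b = 1 := by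
  fin_cases b <;> simp

/-- The polar part at `z_a` of the contribution of `L₂₁L₁₂`. -/
lemma polarPart_sigma_sum {τ : ℍ} {n : ℕ} {z : Fin n → ℂ}
    (hz : ∀ i j, i ≠ j → ¬ InLattice τ (z i - z j)) (w : Fin n → Fin 2) (a : Fin n) {v : ℂ}
    (hv : ¬ InLattice τ v) (c : (Fin n → Fin 2) → ℂ) :
    PolarPart (fun y => ∑ k with w k = 0, sigma τ (z a + y - z k) v *
        (sigma τ (z a + y - z k) (-v) * c w +
          ∑ l with w l = 1, sigma τ (z a + y - z l) (-v) * c (w ∘ Equiv.swap k l)))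
      ((1 + wt (w a)) / 2 * c w)
      (∑ l with w l ≠ w a, sigma τ (z a - z l) (-(wt (w a) * v)) * c (w ∘ Equiv.swap a l)) := by
  have hv' : ¬ InLattice τ (-v) := fun h => hv (inLattice_neg.1 h)
  have hshift : ∀ y k, z a + y - z k = z a - z k + y := fun y k => by ring
  simp only [hshift]
  have hc : ∀ k, k ≠ a → ∀ u, ¬ InLattice τ u →
      ContinuousAt (fun y => sigma τ (z a - z k + y) u) 0 :=
    fun k hk u hu => continuousAt_sigma_left (hz a k hk.symm) hu
  rcases Fin2.eq_zero_or_one (w a) with ha | ha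
  -- If w a = 0, only the summand k = a is singular: its σσ term gives the double pole, and its
  -- outer σ multiplies a regular sum, since no l with w l = 1 equals a.
  · have h := PolarPart.sum (Finset.univ.filter fun k => w k = 0)
      (F := fun k y => sigma τ (z a - z k + y) v * (sigma τ (z a - z k + y) (-v) * c w +
          ∑ l with w l = 1, sigma τ (z a - z l + y) (-v) * c (w ∘ Equiv.swap k l)))
      (c₂ := fun k => if k = a then c w else 0)
      (c₁ := fun k => if k = a then
        ∑ l with w l = 1, sigma τ (z a - z l) (-v) * c (w ∘ Equiv.swap k l) else 0) ?_
    · convert h using 1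
      · simp [ha, wt]
      · rw [Finset.sum_ite_eq']
        simp only [ha, wt, if_true, one_mul, Finset.mem_filter, Finset.mem_univ, true_and]
        refine Finset.sum_congr ?_ fun l _ => rfl
        ext l
        simp only [Finset.mem_filter, Finset.mem_univ, true_and]
        rcases Fin2.eq_zero_or_one (w l) with h | h <;> simp [h]
    · intro k _
      have hcs : ContinuousAt (fun y => ∑ l with w l = 1,
          sigma τ (z a - z l + y) (-v) * c (w ∘ Equiv.swap k l)) 0 := by
        refine tendsto_finsetSum _ fun l hl => ?_
        have hla : l ≠ a := fun e => by
          rw [← e, (Finset.mem_filter.1 hl).2] at ha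
          exact one_ne_zero ha
        exact ContinuousAt.mul (hc l hla _ hv') continuousAt_const
      by_cases hk : k = a
      · subst hk
        have h1 := ((polarPart_sigma_mul_sigma τ hv).mul_const (c w)).add
          ((polarPart_sigma τ hv).mul_continuousAt hcs)
        simp only [add_zero, zero_mul, one_mul, zero_add] at h1
        simp only [sub_self, zero_add, if_true]
        refine h1.congr (Filter.Eventually.of_forall fun y => ?_)
        ring
      · simp only [if_neg hk]
        exact PolarPart.of_continuousAt ((hc k hk v hv).mul
          (ContinuousAt.add ((hc k hk _ hv').mul continuousAt_const) hcs))
  -- If w a = 1, no outer index equals a. The only pole comes from the inner index l = a and is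
  -- simple.
  · have h := PolarPart.sum (Finset.univ.filter fun k => w k = 0)
      (F := fun k y => sigma τ (z a - z k + y) v * (sigma τ (z a - z k + y) (-v) * c w +
          ∑ l with w l = 1, sigma τ (z a - z l + y) (-v) * c (w ∘ Equiv.swap k l)))
      (c₂ := fun k => 0)
      (c₁ := fun k => sigma τ (z a - z k) v * c (w ∘ Equiv.swap a k)) ?_
    · convert h using 1
      · simp [ha, wt]
      · simp only [ha, wt, one_ne_zero, if_false, neg_mul, one_mul, neg_neg]
        refine Finset.sum_congr ?_ fun l _ => rfl
        ext l
        simp only [Finset.mem_filter, Finset.mem_univ, true_and]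
        rcases Fin2.eq_zero_or_one (w l) with h | h <;> simp [h]
    · intro k hk
      have hka : k ≠ a := fun e => by
        rw [← e, (Finset.mem_filter.1 hk).2] at ha
        exact zero_ne_one ha
      have h1 := PolarPart.sum (Finset.univ.filter fun l => w l = 1)
        (F := fun l y => sigma τ (z a - z l + y) (-v) * c (w ∘ Equiv.swap k l))
        (c₂ := fun l => 0)
        (c₁ := fun l => if l = a then c (w ∘ Equiv.swap k l) else 0) (by
          intro l _
          by_cases hl : l = a
          · subst hl
            simpa using (polarPart_sigma τ hv').mul_const (c (w ∘ Equiv.swap k l))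
          · simp only [if_neg hl]
            exact PolarPart.of_continuousAt ((hc l hl _ hv').mul continuousAt_const))
      have h2 := (PolarPart.of_continuousAt ((hc k hka _ hv').mul
        (continuousAt_const (y := c w)))).add h1
      rw [Finset.sum_ite_eq'] at h2
      simp only [Finset.sum_const_zero, Finset.mem_filter, Finset.mem_univ, true_and, ha, if_true,
        zero_add] at h2
      have h3 := h2.mul_continuousAt (hc k hka v hv)
      rw [add_zero, Equiv.swap_comm, mul_comm (c _)] at h3
      refine h3.congr (Filter.Eventually.of_forall fun y => ?_)
      simp only [Pi.mul_apply]
      ring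

/-- The first order differential equations satisfied by the coordinates of an eigenfunction. -/
def IsFirstOrder (τ : ℍ) {n : ℕ} (z : Fin n → ℂ) (E : Fin n → ℂ)
    (ψ : (Fin n → Fin 2) → ℂ → ℂ) : Prop :=
  ∀ w a v, ¬ InLattice τ v → deriv (ψ w) v =
    (wt (w a) * E a + offDiagCoeff τ z w a) * ψ w v + wt (w a) *
      ∑ l with w l ≠ w a, sigma τ (z a - z l) (-(wt (w a) * v)) * ψ (w ∘ Equiv.swap a l) v

lemma eventually_not_inLattice {τ : ℍ} {n : ℕ} {z : Fin n → ℂ}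
    (hz : ∀ i j, i ≠ j → ¬ InLattice τ (z i - z j)) (a : Fin n) :
    ∀ᶠ y in 𝓝[≠] (0 : ℂ), ∀ k, ¬ InLattice τ (z a + y - z k) := by
  rw [Filter.eventually_all]
  intro k
  by_cases hk : k = a
  · subst hk
    filter_upwards [self_mem_nhdsWithin, nhdsWithin_le_nhds (eventually_thetaSlope_ne_zero τ)]
      with y hy h
    rw [add_sub_cancel_left, ← theta_eq_zero_iff, theta_eq_mul_thetaSlope]
    exact mul_ne_zero hy h
  · refine nhdsWithin_le_nhds ?_
    have h1 : ContinuousAt (fun y => theta τ (z a + y - z k)) 0 := by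
      have := (differentiable_theta τ).continuous
      fun_prop
    filter_upwards [h1.eventually_ne (by
      rw [add_zero]
      exact theta_ne_zero (hz a k (Ne.symm hk)) : theta τ (z a + 0 - z k) ≠ 0)] with y hy
    rwa [← theta_eq_zero_iff]

/-- Both sides of `eigen_equation` are expanded at x = z_a. The double poles add up to −1/4 + h_a/2
− (1 + h_a)/2 = −3/4, independently of the word. The second derivative in λ has no pole, so the
residue is of first order in λ. -/
lemma polarPart_eigenvalue {τ : ℍ} {n : ℕ} {z : Fin n → ℂ}
    (hz : ∀ i j, i ≠ j → ¬ InLattice τ (z i - z j)) (F : FunV0 n)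
    (ψ : (Fin n → Fin 2) → ℂ → ℂ) (hψ : ∀ w, ((F : VFun n) w).Rep (ψ w))
    (hψa : ∀ w v, ¬ InLattice τ v → AnalyticAt ℂ (ψ w) v) {e : ℂ → ℂ}
    (he : ∀ x, (∀ k, ¬ InLattice τ (x - z k)) → S τ z 1 x F = e x • F)
    (w : Fin n → Fin 2) (a : Fin n) {v : ℂ} (hv : ¬ InLattice τ v) :
    PolarPart (fun y => e (z a + y) * ψ w v) (-(3 / 4) * ψ w v)
      (wt (w a) * (deriv (ψ w) v - offDiagCoeff τ z w a * ψ w v) -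
        ∑ l with w l ≠ w a, sigma τ (z a - z l) (-(wt (w a) * v)) * ψ (w ∘ Equiv.swap a l) v) := by
  have h1 := (((PolarPart.of_continuousAt (F := fun _ => deriv (deriv (ψ w)) v)
    continuousAt_const).sub (((polarPart_diagCoeff hz w a).const_mul 2).mul_const
      (deriv (ψ w) v))).add ((polarPart_diagCoeff_sq hz w a).mul_const (ψ w v))).neg.sub
    ((polarPart_diagCoeff' hz w a).mul_const (ψ w v))
  have h2 := (h1.sub (polarPart_sigma_sum hz w a hv fun w => ψ w v)).congr (by
    filter_upwards [eventually_not_inLattice hz a] with y hy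
    exact eigen_equation τ z hy F ψ hψ hψa (he _ hy) w hv)
  convert h2 using 1
  · ring
  · ring

/-- Two joint eigenfunctions with the same eigenvalues satisfy the same first order equations. -/
lemma exists_isFirstOrder {τ : ℍ} {n : ℕ} {z : Fin n → ℂ}
    (hz : ∀ i j, i ≠ j → ¬ InLattice τ (z i - z j)) (F F' : FunV0 n)
    (ψ ψ' : (Fin n → Fin 2) → ℂ → ℂ) (hψ : ∀ w, ((F : VFun n) w).Rep (ψ w))
    (hψ' : ∀ w, ((F' : VFun n) w).Rep (ψ' w))
    (hψa : ∀ w v, ¬ InLattice τ v → AnalyticAt ℂ (ψ w) v)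
    (hψa' : ∀ w v, ¬ InLattice τ v → AnalyticAt ℂ (ψ' w) v)
    (he : ∀ x, (∀ k, ¬ InLattice τ (x - z k)) →
      ∃ e : ℂ, S τ z 1 x F = e • F ∧ S τ z 1 x F' = e • F')
    (hne : ∃ w v, ¬ InLattice τ v ∧ ψ w v ≠ 0) :
    ∃ E, IsFirstOrder τ z E ψ ∧ IsFirstOrder τ z E ψ' := by
  -- The default value 0 at the excluded points makes the eigenvalue a function of x; polar parts
  -- involve only punctured neighbourhoods.
  have he' : ∀ x, ∃ e : ℂ, (∀ k, ¬ InLattice τ (x - z k)) →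
      S τ z 1 x F = e • F ∧ S τ z 1 x F' = e • F' := by
    intro x
    by_cases hx : ∀ k, ¬ InLattice τ (x - z k)
    · obtain ⟨e, h⟩ := he x hx
      exact ⟨e, fun _ => h⟩
    · exact ⟨0, fun h => absurd h hx⟩
  choose e he using he'
  obtain ⟨w₀, v₀, hv₀, h0⟩ := hne
  -- Dividing by one nonzero value of ψ shows that the eigenvalue itself has a residue at z_a. This
  -- residue serves both eigenfunctions.
  have hE : ∀ a, ∃ E, PolarPart (fun y => e (z a + y)) (-(3 / 4)) E := by
    intro a
    have h := (polarPart_eigenvalue hz F ψ hψ hψa (fun x hx => (he x hx).1) w₀ a hv₀).mul_const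
      (ψ w₀ v₀)⁻¹
    simp only [mul_assoc, mul_inv_cancel₀ h0, mul_one] at h
    exact ⟨_, h⟩
  choose E hE using hE
  have key : ∀ (G : FunV0 n) (φ : (Fin n → Fin 2) → ℂ → ℂ), (∀ w, ((G : VFun n) w).Rep (φ w)) →
      (∀ w v, ¬ InLattice τ v → AnalyticAt ℂ (φ w) v) →
      (∀ x, (∀ k, ¬ InLattice τ (x - z k)) → S τ z 1 x G = e x • G) → IsFirstOrder τ z E φ := by
    intro G φ h1 h2 h3 w a v hv
    -- Two expressions for the residue with the same double pole are compared; multiplication by h_a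
    -- = ±1 then solves for the derivative.
    have h := (polarPart_eigenvalue hz G φ h1 h2 h3 w a hv).unique ((hE a).mul_const (φ w v))
    have hw := wt_mul_self (w a)
    linear_combination wt (w a) * h - (deriv (φ w) v - offDiagCoeff τ z w a * φ w v) * hw
  exact ⟨E, key F ψ hψ hψa fun x hx => (he x hx).1, key F' ψ' hψ' hψa' fun x hx => (he x hx).2⟩


/-! ### Bethe eigenfunctions -/

/-- The coordinates of the Bethe eigenfunction as actual functions. -/
noncomputable def psiFun {τ : ℍ} {m : ℕ} (s : BetheSolution τ m) (w : Fin (2 * m) → Fin 2)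
    (v : ℂ) : ℂ :=
  if h : (ones w).card = m then
    Complex.exp (Real.pi * Complex.I * s.mu * v) * weightFun τ s.t s.z (ones w) h v
  else 0

/-- The coordinates of the Bethe eigenfunction multiplied by `(-θ(λ))^m`. -/
noncomputable def numer {τ : ℍ} {m : ℕ} (s : BetheSolution τ m) (w : Fin (2 * m) → Fin 2)
    (v : ℂ) : ℂ :=
  if h : (ones w).card = m then
    Complex.exp (Real.pi * Complex.I * s.mu * v) * ∑ κ : Equiv.Perm (Fin m), ∏ j,
      theta τ (s.t (κ j) - s.z ((ones w).orderEmbOfFin h j) - v) /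
        theta τ (s.t (κ j) - s.z ((ones w).orderEmbOfFin h j))
  else 0

section

variable {τ : ℍ} {m : ℕ} (s : BetheSolution τ m)

lemma PsiV_rep (w : Fin (2 * m) → Fin 2) : (PsiV s w).Rep (psiFun s w) := by
  by_cases h : (ones w).card = m
  · have e : psiFun s w = fun v => Complex.exp (Real.pi * Complex.I * s.mu * v) *
      weightFun τ s.t s.z (ones w) h v := by
      funext v
      simp [psiFun, h]
    rw [e]
    refine ⟨meromorphic_weightFun τ s.mu s.t s.z (ones w) h, ?_⟩
    simp [PsiV, h]
  · have e : psiFun s w = fun v => 0 := by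
      funext v
      simp [psiFun, h]
    rw [e]
    have : PsiV s w = 0 := by simp [PsiV, h]
    rw [this]
    exact Mero.Rep.zero

/-- Each of the m factors σ(x, −v) equals −θ(x − v)/(θ(x)θ(v)), whence the sign and the power of θ.
-/
lemma psiFun_eq (w : Fin (2 * m) → Fin 2) (v : ℂ) :
    psiFun s w v = (-1) ^ m * numer s w v / theta τ v ^ m := by
  by_cases h : (ones w).card = m
  · simp only [psiFun, numer, h, dif_pos, weightFun]
    have e : ∀ x, sigma τ x (-v) = theta τ (x - v) / theta τ x * (-1 * (theta τ v)⁻¹) := by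
      intro x
      rw [sigma, theta_neg, ← sub_eq_add_neg, ← div_div, div_neg, div_eq_mul_inv _ (theta τ v)]
      ring
    simp only [e, Finset.prod_mul_distrib, Finset.prod_const, Finset.card_univ, Fintype.card_fin,
      ← Finset.sum_mul]
    rw [inv_pow]
    ring
  · simp [psiFun, numer, h]

lemma numer_of_card_ne {w : Fin (2 * m) → Fin 2} (hw : (ones w).card ≠ m) :
    numer s w = fun _ => 0 := by
  funext v
  simp [numer, hw]

lemma differentiable_numer (w : Fin (2 * m) → Fin 2) : Differentiable ℂ (numer s w) := by
  by_cases h : (ones w).card = m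
  · have e : numer s w = fun v => Complex.exp (Real.pi * Complex.I * s.mu * v) *
      ∑ κ : Equiv.Perm (Fin m), ∏ j,
      theta τ (s.t (κ j) - s.z ((ones w).orderEmbOfFin h j) - v) /
        theta τ (s.t (κ j) - s.z ((ones w).orderEmbOfFin h j)) := by
      funext v
      simp [numer, h]
    rw [e]
    refine Differentiable.mul (by fun_prop) (Differentiable.fun_sum fun κ _ =>
      Differentiable.fun_finsetProd fun j _ => Differentiable.div_const ?_ _)
    exact (differentiable_theta τ).comp (by fun_prop)
  · rw [numer_of_card_ne s h]
    fun_prop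

lemma analyticAt_psiFun (w : Fin (2 * m) → Fin 2) (v : ℂ) (hv : ¬ InLattice τ v) :
    AnalyticAt ℂ (psiFun s w) v := by
  have e : psiFun s w = fun v => (-1) ^ m * numer s w v / theta τ v ^ m :=
    funext (psiFun_eq s w)
  rw [e]
  exact (analyticAt_const.mul ((differentiable_numer s w).analyticAt v)).div
    (((differentiable_theta τ).analyticAt v).pow m) (pow_ne_zero _ (theta_ne_zero hv))

lemma theta_t_sub_z (j : Fin m) (a : Fin (2 * m)) : theta τ (s.t j - s.z a) ≠ 0 :=
  theta_ne_zero (s.t_ne_z j a)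

/-- The value at 0 depends neither on the solution nor on the word. Differences of two such families
therefore vanish at 0, as the uniqueness argument requires. -/
lemma numer_zero {w : Fin (2 * m) → Fin 2} (hw : (ones w).card = m) :
    numer s w 0 = (m.factorial : ℂ) := by
  simp only [numer, hw, dif_pos, mul_zero, Complex.exp_zero, one_mul, sub_zero]
  have : ∀ κ : Equiv.Perm (Fin m), ∏ j, theta τ (s.t (κ j) - s.z ((ones w).orderEmbOfFin hw j)) /
        theta τ (s.t (κ j) - s.z ((ones w).orderEmbOfFin hw j)) = 1 :=
    fun κ => Finset.prod_eq_one fun j _ => div_self (theta_t_sub_z s _ _)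
  simp [this, Fintype.card_perm]

/-- The sum over permutations does not depend on j, so m times it may be summed over all j, and each
permutation then contributes ∑ f. The factor m replaces a division. -/
lemma sum_perm_apply {m : ℕ} (f : Fin m → ℂ) (j : Fin m) :
    (m : ℂ) * ∑ κ : Equiv.Perm (Fin m), f (κ j) = m.factorial * ∑ i, f i := by
  have h : ∀ j', ∑ κ : Equiv.Perm (Fin m), f (κ j') = ∑ κ : Equiv.Perm (Fin m), f (κ j) := by
    intro j'
    refine Fintype.sum_equiv (Equiv.mulRight (Equiv.swap j j')) _ _ fun κ => ?_
    simp
  calc (m : ℂ) * ∑ κ : Equiv.Perm (Fin m), f (κ j)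
      = ∑ j', ∑ κ : Equiv.Perm (Fin m), f (κ j') := by simp [h]
    _ = ∑ κ : Equiv.Perm (Fin m), ∑ j', f (κ j') := Finset.sum_comm
    _ = ∑ κ : Equiv.Perm (Fin m), ∑ i, f i :=
        Finset.sum_congr rfl fun κ _ => Equiv.sum_comp κ f
    _ = _ := by simp [Fintype.card_perm]

/-- `∑_j ρ(t_j - z_a)`. -/
noncomputable def rhoSum (a : Fin (2 * m)) : ℂ := ∑ j, rho τ (s.t j - s.z a)

lemma sum_orderEmb {n m : ℕ} (I : Finset (Fin n)) (h : I.card = m) (f : Fin n → ℂ) :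
    ∑ j, f (I.orderEmbOfFin h j) = ∑ i ∈ I, f i := by
  conv_rhs => rw [← Finset.map_orderEmbOfFin_univ I h, Finset.sum_map]
  rfl

/-- Every product equals 1 at 0, so its derivative is −∑_j ρ(t_{κ(j)} − z_{i_j}). Summing over κ
weights all pairs (t_i, z_{i_j}) equally. -/
lemma deriv_numer_zero {w : Fin (2 * m) → Fin 2} (hw : (ones w).card = m) :
    (m : ℂ) * deriv (numer s w) 0 = m.factorial *
      (m * (Real.pi * Complex.I * s.mu) - ∑ i ∈ ones w, rhoSum s i) := by
  set Z : Fin m → ℂ := fun j => s.z ((ones w).orderEmbOfFin hw j) with hZ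
  have hne : ∀ i j, theta τ (s.t i - Z j) ≠ 0 := fun i j => theta_t_sub_z s _ _
  have e : numer s w = fun v => Complex.exp (Real.pi * Complex.I * s.mu * v) *
      ∑ κ : Equiv.Perm (Fin m), ∏ j, theta τ (s.t (κ j) - Z j - v) / theta τ (s.t (κ j) - Z j) := by
    funext v
    simp [numer, hw, hZ]
  have d1 : ∀ i j, HasDerivAt (fun v => theta τ (s.t i - Z j - v) / theta τ (s.t i - Z j))
      (-rho τ (s.t i - Z j)) 0 := by
    intro i j
    have h1 : HasDerivAt (fun v => theta τ (s.t i - Z j - v))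
        (-deriv (theta τ) (s.t i - Z j - 0)) 0 :=
      (hasDerivAt_theta τ (s.t i - Z j - 0)).comp_const_sub (s.t i - Z j) 0
    have h2 := h1.div_const (theta τ (s.t i - Z j))
    rwa [sub_zero, neg_div] at h2
  have d2 : ∀ κ : Equiv.Perm (Fin m), HasDerivAt
      (fun v => ∏ j, theta τ (s.t (κ j) - Z j - v) / theta τ (s.t (κ j) - Z j))
      (∑ j, -rho τ (s.t (κ j) - Z j)) 0 := by
    intro κ
    have h := HasDerivAt.fun_finsetProd (u := Finset.univ) fun j (_ : j ∈ Finset.univ) => d1 (κ j) j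
    simp only [sub_zero, div_self (hne _ _), Finset.prod_const_one, one_smul] at h
    exact h
  have d3 : HasDerivAt (fun v => Complex.exp (Real.pi * Complex.I * s.mu * v))
      (Complex.exp (Real.pi * Complex.I * s.mu * 0) * (Real.pi * Complex.I * s.mu * 1)) 0 :=
    ((hasDerivAt_id (0 : ℂ)).const_mul (Real.pi * Complex.I * s.mu)).cexp
  have d4 := d3.fun_mul (HasDerivAt.fun_sum (u := Finset.univ) fun κ _ => d2 κ)
  rw [e, d4.deriv]
  have e1 : ∀ κ : Equiv.Perm (Fin m),
      ∏ j, theta τ (s.t (κ j) - Z j - 0) / theta τ (s.t (κ j) - Z j) = 1 :=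
    fun κ => Finset.prod_eq_one fun j _ => by rw [sub_zero, div_self (hne _ _)]
  have e2 : ∑ i ∈ ones w, rhoSum s i = ∑ j, ∑ i, rho τ (s.t i - Z j) :=
    (sum_orderEmb (ones w) hw (rhoSum s)).symm
  have e3 : (m : ℂ) * ∑ κ : Equiv.Perm (Fin m), ∑ j, rho τ (s.t (κ j) - Z j) =
      m.factorial * ∑ j, ∑ i, rho τ (s.t i - Z j) := by
    rw [Finset.sum_comm, Finset.mul_sum, Finset.mul_sum]
    exact Finset.sum_congr rfl fun j _ => sum_perm_apply (fun i => rho τ (s.t i - Z j)) j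
  simp only [e1, mul_zero, Complex.exp_zero, one_mul, mul_one, Finset.sum_const, Finset.card_univ,
    Fintype.card_perm, Fintype.card_fin, nsmul_eq_mul, Finset.sum_neg_distrib]
  rw [e2]
  linear_combination -e3

/-- The multipliers of the functions `numer`. -/
lemma quasiPeriodic_numer {w : Fin (2 * m) → Fin 2} (hw : (ones w).card = m) :
    QuasiPeriodic τ m (Complex.exp (Real.pi * Complex.I * s.mu) * (-1) ^ m)
      (Complex.exp (Real.pi * Complex.I * s.mu * τ) * ((-1) ^ m *
        Complex.exp (-(Real.pi * Complex.I * m * τ) +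
          2 * Real.pi * Complex.I * (∑ j, s.t j - ∑ i ∈ ones w, s.z i)))) (numer s w) := by
  set Z : Fin m → ℂ := fun j => s.z ((ones w).orderEmbOfFin hw j) with hZ
  have hsum : QuasiPeriodic τ m ((-1) ^ m) ((-1) ^ m *
        Complex.exp (-(Real.pi * Complex.I * m * τ) +
          2 * Real.pi * Complex.I * (∑ j, s.t j - ∑ i ∈ ones w, s.z i)))
      (fun v => ∑ κ : Equiv.Perm (Fin m), ∏ j, theta τ (s.t (κ j) - Z j - v) /
        theta τ (s.t (κ j) - Z j)) := by
    refine QuasiPeriodic.sum _ (by simp) (by simp [Complex.exp_ne_zero]) fun κ _ => ?_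
    have h := QuasiPeriodic.prod_theta_sub τ (fun j => s.t (κ j) - Z j)
    have e1 : ∑ j, (s.t (κ j) - Z j) = ∑ j, s.t j - ∑ i ∈ ones w, s.z i := by
      rw [Finset.sum_sub_distrib, Equiv.sum_comp κ s.t, sum_orderEmb (ones w) hw s.z]
    rw [e1] at h
    -- Oddness of θ rewrites θ(t − z − v) through θ(v − (t − z)), so every permutation gives a theta
    -- product with the same sum of zeros and hence the same multipliers.
    have e2 : (fun v => ∏ j, theta τ (s.t (κ j) - Z j - v) / theta τ (s.t (κ j) - Z j)) =
        fun v => (∏ j, (-1) / theta τ (s.t (κ j) - Z j)) *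
          ∏ j, theta τ (v - (s.t (κ j) - Z j)) := by
      funext v
      rw [← Finset.prod_mul_distrib]
      refine Finset.prod_congr rfl fun j _ => ?_
      rw [theta_sub_comm τ _ v]
      ring
    rw [e2]
    refine ⟨h.entire.const_mul _, h.α_ne, h.β_ne, fun x => ?_, fun x => ?_⟩
    · rw [h.add_one]; ring
    · rw [h.add_tau]; ring
  have h := (QuasiPeriodic.exp τ (Real.pi * Complex.I * s.mu)).mul hsum
  rw [zero_add] at h
  convert h using 1
  funext v
  simp [numer, hw, hZ]

end

/-! ### From first order equations to the system -/

lemma wt_theta (τ : ℍ) (b : Fin 2) (v : ℂ) : theta τ (-(wt b * v)) = -(wt b) * theta τ v := by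
  rcases Fin2.eq_zero_or_one b with rfl | rfl <;> simp [wt, theta_neg]

/-- The denominators θ^{m+1} are cleared off the lattice; what results is an identity of continuous
functions and so holds everywhere. The constant ε scales out. -/
lemma IsFirstOrder.isSystemSolution {τ : ℍ} {m : ℕ} {z E : Fin (2 * m) → ℂ}
    {ψ N : (Fin (2 * m) → Fin 2) → ℂ → ℂ} (h : IsFirstOrder τ z E ψ) {ε : ℂ} (hε : ε ≠ 0)
    (hN : ∀ w, Differentiable ℂ (N w)) (hψ : ∀ w v, ψ w v = ε * N w v / theta τ v ^ m) :
    IsSystemSolution τ z (fun w a => wt (w a) * E a + offDiagCoeff τ z w a) N := by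
  intro w hw a x
  have hcd : Continuous (deriv (N w)) :=
    Differentiable.continuous (𝕜 := ℂ) fun x =>
      ((hN w).analyticAt x).deriv.differentiableAt
  have hct : Continuous (theta τ) := (differentiable_theta τ).continuous
  have hct' : Continuous (deriv (theta τ)) := (differentiable_deriv_theta τ).continuous
  have hcN := fun w => (hN w).continuous
  refine congrFun (Continuous.ext_on (dense_theta_ne_zero τ 0)
    (f := fun x => theta τ x * deriv (N w) x - m * deriv (theta τ) x * N w x)
    (g := fun x => (wt (w a) * E a + offDiagCoeff τ z w a) * theta τ x * N w x -
      ∑ l with w l ≠ w a, theta τ (z a - z l - wt (w a) * x) / theta τ (z a - z l) *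
        N (w ∘ Equiv.swap a l) x) (by fun_prop) (by fun_prop) fun v hv => ?_) x
  have hθ : theta τ v ≠ 0 := by simpa using hv
  have hv : ¬ InLattice τ v := fun h => hθ (theta_eq_zero_iff.2 h)
  have e := h w a v hv
  have hψw : ψ w = fun v => ε * N w v / theta τ v ^ m := funext (hψ w)
  have d : deriv (ψ w) v = ε * (theta τ v * deriv (N w) v - m * deriv (theta τ) v * N w v) /
      theta τ v ^ (m + 1) := by
    rw [hψw]
    have := (((hN w v).hasDerivAt.const_mul ε).fun_div ((hasDerivAt_theta τ v).fun_pow m)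
      (pow_ne_zero m hθ))
    rw [this.deriv]
    rw [div_eq_div_iff (pow_ne_zero _ (pow_ne_zero _ hθ)) (pow_ne_zero _ hθ)]
    cases m with
    | zero => simp; ring
    | succ m =>
      simp only [Nat.add_sub_cancel]
      ring
  rw [d] at e
  simp only [hψ] at e
  -- Since θ(−h_a v) = −h_aθ(v), the signs h_a cancel. If θ(x) = 0, both sides are 0 by division by
  -- zero.
  have es : ∀ x, wt (w a) * sigma τ x (-(wt (w a) * v)) * theta τ v =
      -(theta τ (x - wt (w a) * v) / theta τ x) := by
    intro x
    rw [sigma, wt_theta, ← sub_eq_add_neg]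
    have : wt (w a) ≠ 0 := fun h => by simpa [h] using wt_mul_self (w a)
    by_cases hx : theta τ x = 0
    · simp [hx]
    · field_simp
  have e2 : wt (w a) * ∑ l with w l ≠ w a, sigma τ (z a - z l) (-(wt (w a) * v)) *
        (ε * N (w ∘ Equiv.swap a l) v / theta τ v ^ m) =
      -(∑ l with w l ≠ w a, theta τ (z a - z l - wt (w a) * v) / theta τ (z a - z l) *
        N (w ∘ Equiv.swap a l) v) * ε / theta τ v ^ (m + 1) := by
    rw [← Finset.sum_neg_distrib, Finset.mul_sum, Finset.sum_mul, Finset.sum_div]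
    refine Finset.sum_congr rfl fun l _ => ?_
    have e3 : wt (w a) * (sigma τ (z a - z l) (-(wt (w a) * v)) *
        (ε * N (w ∘ Equiv.swap a l) v / theta τ v ^ m)) =
        (wt (w a) * sigma τ (z a - z l) (-(wt (w a) * v)) * theta τ v) *
          N (w ∘ Equiv.swap a l) v * ε / theta τ v ^ (m + 1) := by
      field_simp
      ring
    rw [e3, es]
    ring
  rw [e2] at e
  simp only
  generalize (∑ l with w l ≠ w a, theta τ (z a - z l - wt (w a) * v) / theta τ (z a - z l) *
        N (w ∘ Equiv.swap a l) v) = X at e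
  field_simp at e
  apply mul_left_cancel₀ (pow_ne_zero m hθ)
  linear_combination e

/-- Comparison of the derivatives at `0`. -/
lemma IsSystemSolution.deriv_zero {τ : ℍ} {m : ℕ} {z : Fin (2 * m) → ℂ}
    {C : (Fin (2 * m) → Fin 2) → Fin (2 * m) → ℂ} {N : (Fin (2 * m) → Fin 2) → ℂ → ℂ}
    (h : IsSystemSolution τ z C N) (hz : ∀ i j, i ≠ j → ¬ InLattice τ (z i - z j))
    (hN : ∀ w, Differentiable ℂ (N w)) {w : Fin (2 * m) → Fin 2}
    (hw : (ones w).card = m) (a : Fin (2 * m)) :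
    (1 - m) * deriv (N w) 0 = C w a * N w 0 -
      ∑ l with w l ≠ w a, (-(wt (w a)) * rho τ (z a - z l) * N (w ∘ Equiv.swap a l) 0 +
        deriv (N (w ∘ Equiv.swap a l)) 0) := by
  have hN' : Differentiable ℂ (deriv (N w)) :=
    fun x => ((hN w).analyticAt x).deriv.differentiableAt
  have hθ := hasDerivAt_theta τ 0
  have hθ' := ((differentiable_deriv_theta τ) 0).hasDerivAt
  -- θ′ is even, so θ″(0) = 0 and the term −mθ″N drops out.
  rw [deriv_zero_of_even (deriv_theta_neg τ)] at hθ'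
  have d1 := (hθ.fun_mul (hN' 0).hasDerivAt).fun_sub
    ((hθ'.const_mul (m : ℂ)).fun_mul (hN w 0).hasDerivAt)
  have d2 : ∀ l, HasDerivAt (fun x => theta τ (z a - z l - wt (w a) * x) / theta τ (z a - z l))
      (-(wt (w a)) * rho τ (z a - z l)) 0 := by
    intro l
    have h1 : HasDerivAt (fun x : ℂ => z a - z l - wt (w a) * x) (-(wt (w a) * 1)) 0 :=
      ((hasDerivAt_id (0 : ℂ)).const_mul (wt (w a))).const_sub _
    have h2 : HasDerivAt (theta τ) (deriv (theta τ) (z a - z l)) (z a - z l - wt (w a) * 0) := by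
      simpa using hasDerivAt_theta τ (z a - z l)
    have h3 := (h2.comp 0 h1).div_const (theta τ (z a - z l))
    refine h3.congr_deriv ?_
    simp only [rho]
    ring
  have d3 := ((hθ.const_mul (C w a)).fun_mul (hN w 0).hasDerivAt).fun_sub
    (HasDerivAt.fun_sum (u := Finset.univ.filter fun l => w l ≠ w a) fun l _ =>
      (d2 l).fun_mul (hN (w ∘ Equiv.swap a l) 0).hasDerivAt)
  have e : (fun x => theta τ x * deriv (N w) x - m * deriv (theta τ) x * N w x) =
      fun x => C w a * theta τ x * N w x - ∑ l with w l ≠ w a,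
        theta τ (z a - z l - wt (w a) * x) / theta τ (z a - z l) * N (w ∘ Equiv.swap a l) x :=
    funext (h w hw a)
  rw [e] at d1
  have := d1.unique d3
  simp only [theta_zero, deriv_theta_zero, mul_zero, zero_mul, add_zero, one_mul, mul_one,
    sub_zero, zero_add] at this
  rw [sub_mul, one_mul, this]
  congr 1
  refine Finset.sum_congr rfl fun l hl => ?_
  have hla : a ≠ l := fun e => (Finset.mem_filter.1 hl).2 (by rw [e])
  rw [div_self (theta_ne_zero (hz a l hla)), one_mul]

lemma exists_word {m : ℕ} (hm : 0 < m) (a : Fin (2 * m)) :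
    ∃ w : Fin (2 * m) → Fin 2, (ones w).card = m ∧ w a = 0 := by
  obtain ⟨I, hI, hc⟩ := Finset.exists_subset_card_eq
    (s := (Finset.univ.erase a : Finset (Fin (2 * m)))) (n := m) (by
      rw [Finset.card_erase_of_mem (Finset.mem_univ a), Finset.card_univ, Fintype.card_fin]
      omega)
  refine ⟨fun k => if k ∈ I then 1 else 0, ?_, ?_⟩
  · have : ones (fun k => if k ∈ I then (1 : Fin 2) else 0) = I := by
      ext k
      simp [ones]
    rw [this, hc]
  · have : a ∉ I := fun h => by simpa using hI h
    simp [this]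

lemma ones_comp_swap {n : ℕ} {w : Fin n → Fin 2} {a l : Fin n} (ha : w a = 0) (hl : w l = 1) :
    ones (w ∘ Equiv.swap a l) = insert a ((ones w).erase l) := by
  have hal : a ≠ l := fun e => by rw [e, hl] at ha; exact one_ne_zero ha
  ext k
  simp only [ones, Finset.mem_filter, Finset.mem_univ, true_and, Finset.mem_insert,
    Finset.mem_erase, Function.comp_apply]
  by_cases hk : k = a
  · subst hk; simp [hl]
  · by_cases hk' : k = l
    · subst hk'
      simp [ha, hk]
    · simp [hk, hk', Equiv.swap_apply_of_ne_of_ne]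

/-- The eigenvalues are determined by `μ` and `t`. -/
lemma eigenvalue_eq {τ : ℍ} {m : ℕ} (hm : 0 < m) (s : BetheSolution τ m)
    (hz : ∀ i j, i ≠ j → ¬ InLattice τ (s.z i - s.z j)) {E : Fin (2 * m) → ℂ}
    (h : IsSystemSolution τ s.z (fun w a => wt (w a) * E a + offDiagCoeff τ s.z w a) (numer s))
    (a : Fin (2 * m)) : E a = Real.pi * Complex.I * s.mu - rhoSum s a -
      ∑ b ∈ Finset.univ.erase a, rho τ (s.z a - s.z b) / 2 := by
  obtain ⟨w, hw, ha⟩ := exists_word hm a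
  have hm0 : (m : ℂ) ≠ 0 := by exact_mod_cast hm.ne'
  have hf : (m.factorial : ℂ) ≠ 0 := by exact_mod_cast m.factorial_ne_zero
  have hwt : wt (w a) = 1 := by simp [ha, wt]
  have hset : (Finset.univ.filter fun l => w l ≠ w a) = ones w := by
    ext l
    simp only [ones, Finset.mem_filter, Finset.mem_univ, true_and, ha]
    rcases Fin2.eq_zero_or_one (w l) with h | h <;> simp [h]
  have hsw : ∀ l, (ones (w ∘ Equiv.swap a l)).card = m := fun l => by rw [card_ones_comp_perm, hw]
  have e := h.deriv_zero hz (differentiable_numer s) hw a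
  simp only [hset, hwt, numer_zero s hw, numer_zero s (hsw _), one_mul] at e
  set B := ∑ i ∈ ones w, rhoSum s i with hB
  have d0 := deriv_numer_zero s hw
  have dl : ∀ l ∈ ones w, (m : ℂ) * deriv (numer s (w ∘ Equiv.swap a l)) 0 = m.factorial *
      (m * (Real.pi * Complex.I * s.mu) - (rhoSum s a + (B - rhoSum s l))) := by
    intro l hl
    have hl1 : w l = 1 := (Finset.mem_filter.1 hl).2
    have hna : a ∉ (ones w).erase l := by simp [ones, ha]
    rw [deriv_numer_zero s (hsw l), ones_comp_swap ha hl1, Finset.sum_insert hna,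
      Finset.sum_erase_eq_sub hl]
  -- A transposition with l replaces the summand of l in B by that of a. Over the m choices of l the
  -- removed summands add up to B itself.
  have dsum : (m : ℂ) * ∑ l ∈ ones w, deriv (numer s (w ∘ Equiv.swap a l)) 0 = m.factorial *
      (m * (m * (Real.pi * Complex.I * s.mu) - rhoSum s a - B) + B) := by
    rw [Finset.mul_sum, Finset.sum_congr rfl dl, ← Finset.mul_sum]
    simp only [Finset.sum_sub_distrib, Finset.sum_add_distrib, Finset.sum_const, hw, nsmul_eq_mul,
      ← hB]
    ring
  -- With a carrying the letter 0, each ρ(z_a − z_b) enters with weight ½ if b carries 0, and −½ + 1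
  -- if b carries 1. The dependence on the word disappears.
  have hoff : offDiagCoeff τ s.z w a + ∑ l ∈ ones w, rho τ (s.z a - s.z l) =
      ∑ b ∈ Finset.univ.erase a, rho τ (s.z a - s.z b) / 2 := by
    have h1 : ∑ l ∈ ones w, rho τ (s.z a - s.z l) =
        ∑ b ∈ Finset.univ.erase a, if w b = 1 then rho τ (s.z a - s.z b) else 0 := by
      rw [← Finset.sum_filter]
      refine Finset.sum_congr ?_ fun _ _ => rfl
      ext k
      simp only [ones, Finset.mem_filter, Finset.mem_univ, true_and, Finset.mem_erase]
      constructor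
      · intro hk
        refine ⟨⟨?_, trivial⟩, hk⟩
        rintro rfl
        rw [ha] at hk
        exact zero_ne_one hk
      · exact fun hk => hk.2
    rw [h1, offDiagCoeff, ← Finset.sum_add_distrib]
    refine Finset.sum_congr rfl fun b _ => ?_
    rcases Fin2.eq_zero_or_one (w b) with hb | hb
    · simp [hb, wt]
    · simp only [hb, wt, one_ne_zero, if_false, if_true]
      ring
  rw [Finset.sum_add_distrib, ← Finset.sum_mul] at e
  simp only [neg_mul, one_mul, Finset.sum_neg_distrib] at e
  have key : (m : ℂ) * m.factorial * (E a - (Real.pi * Complex.I * s.mu - rhoSum s a -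
      ∑ b ∈ Finset.univ.erase a, rho τ (s.z a - s.z b) / 2)) = 0 := by
    rw [← hoff]
    linear_combination (1 - (m : ℂ)) * d0 + dsum - m * e
  have := (mul_eq_zero.1 key).resolve_left (mul_ne_zero hm0 hf)
  linear_combination this

/-! ### The Weyl involution -/

lemma wt_one_sub (b : Fin 2) : wt (1 - b) = -wt b := by
  rcases Fin2.eq_zero_or_one b with rfl | rfl <;> simp [wt]

lemma ones_one_sub {n : ℕ} (w : Fin n → Fin 2) : ones (fun k => 1 - w k) = (ones w)ᶜ := by
  ext k
  simp only [ones, Finset.mem_filter, Finset.mem_univ, true_and, Finset.mem_compl]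
  rcases Fin2.eq_zero_or_one (w k) with h | h <;> simp [h]

lemma card_ones_one_sub {m : ℕ} {w : Fin (2 * m) → Fin 2} (hw : (ones w).card = m) :
    (ones fun k => 1 - w k).card = m := by
  rw [ones_one_sub, Finset.card_compl, hw, Fintype.card_fin]
  omega

/-- Complementing the word reverses the signs of h_a and C, and x ↦ −x reverses those of θ and of
the derivative. All arguments z_a − z_l − h_a x are preserved and the remaining signs cancel. -/
lemma IsSystemSolution.reflect {τ : ℍ} {m : ℕ} {z : Fin (2 * m) → ℂ}
    {C : (Fin (2 * m) → Fin 2) → Fin (2 * m) → ℂ} {N : (Fin (2 * m) → Fin 2) → ℂ → ℂ}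
    (h : IsSystemSolution τ z C N) (hC : ∀ w a, C (fun k => 1 - w k) a = -C w a) :
    IsSystemSolution τ z C (fun w v => N (fun k => 1 - w k) (-v)) := by
  intro w hw a x
  have e := h (fun k => 1 - w k) (card_ones_one_sub hw) a (-x)
  have d : deriv (fun v => N (fun k => 1 - w k) (-v)) x = -deriv (N fun k => 1 - w k) (-x) :=
    deriv_comp_neg _ x
  have hset : (Finset.univ.filter fun l => 1 - w l ≠ 1 - w a) =
      Finset.univ.filter fun l => w l ≠ w a := by
    ext l
    simp
  have hs : ∀ l, theta τ (z a - z l - wt (1 - w a) * -x) = theta τ (z a - z l - wt (w a) * x) := by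
    intro l
    rw [wt_one_sub, neg_mul_neg]
  simp only [theta_neg, deriv_theta_neg, hC, hset, hs] at e
  rw [d]
  have e2 : ∀ l, ((fun k => 1 - w k) ∘ Equiv.swap a l) = fun k => 1 - (w ∘ Equiv.swap a l) k :=
    fun l => rfl
  simp only [e2] at e
  linear_combination e

lemma offDiagCoeff_one_sub (τ : ℍ) {n : ℕ} (z : Fin n → ℂ) (w : Fin n → Fin 2) (a : Fin n) :
    offDiagCoeff τ z (fun k => 1 - w k) a = -offDiagCoeff τ z w a := by
  simp only [offDiagCoeff, wt_one_sub, ← Finset.sum_neg_distrib]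
  exact Finset.sum_congr rfl fun b _ => by ring

/-- The sign (−1)^m of s on a word with m letters 1 cancels the sign of θ(−v)^m. The Weyl image thus
has the same normalization as Ψ, with numerator reflected in the word and in λ. -/
lemma weyl_rep {τ : ℍ} {m : ℕ} (s : BetheSolution τ m) {w : Fin (2 * m) → Fin 2}
    (hw : (ones w).card = m) :
    (weyl (PsiV s) w).Rep (fun v => (-1) ^ m * numer s (fun k => 1 - w k) (-v) / theta τ v ^ m) := by
  have h := (PsiV_rep s fun k => 1 - w k).reflect.smul (∏ k, if w k = 1 then (-1 : ℂ) else 1)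
  have e : (∏ k, if w k = 1 then (-1 : ℂ) else 1) = (-1) ^ m := by
    rw [Finset.prod_ite]
    have : (Finset.univ.filter fun k => w k = 1).card = m := hw
    simp [this]
  have e2 : (fun v => (-1) ^ m * numer s (fun k => 1 - w k) (-v) / theta τ v ^ m) =
      fun v => (∏ k, if w k = 1 then (-1 : ℂ) else 1) * psiFun s (fun k => 1 - w k) (-v) := by
    funext v
    rw [e, psiFun_eq, theta_neg, neg_pow (theta τ v)]
    have h1 : ((-1 : ℂ)) ^ m ≠ 0 := by simp
    rw [mul_div_mul_left _ _ h1, mul_div_assoc]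
  rw [e2]
  exact h

lemma weyl_of_card_ne {τ : ℍ} {m : ℕ} (s : BetheSolution τ m) {w : Fin (2 * m) → Fin 2}
    (hw : (ones w).card ≠ m) : weyl (PsiV s) w = 0 := by
  have h : (ones fun k => 1 - w k).card ≠ m := by
    intro h
    have := card_ones_one_sub h
    simp only [sub_sub_cancel] at this
    exact hw this
  simp [weyl, PsiV, h]


/-! ### Equal eigenvalues and Wronskians -/

lemma hasDerivAt_exp_mul_prod_theta (τ : ℍ) {ι : Type*} (I : Finset ι) (t : ι → ℂ) (c : ℂ) {x : ℂ}
    (h : ∀ j ∈ I, theta τ (x - t j) ≠ 0) :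
    HasDerivAt (fun y => Complex.exp (c * y) * ∏ j ∈ I, theta τ (y - t j))
      ((Complex.exp (c * x) * ∏ j ∈ I, theta τ (x - t j)) *
        (c + ∑ j ∈ I, rho τ (x - t j))) x := by
  classical
  have d1 : HasDerivAt (fun y => ∏ j ∈ I, theta τ (y - t j))
      (∑ i ∈ I, (∏ j ∈ I.erase i, theta τ (x - t j)) • deriv (theta τ) (x - t i)) x :=
    HasDerivAt.fun_finsetProd fun j _ => (hasDerivAt_theta τ (x - t j)).comp_sub_const x (t j)
  have e : ∑ i ∈ I, (∏ j ∈ I.erase i, theta τ (x - t j)) • deriv (theta τ) (x - t i) =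
      (∏ j ∈ I, theta τ (x - t j)) * ∑ j ∈ I, rho τ (x - t j) := by
    rw [Finset.mul_sum]
    refine Finset.sum_congr rfl fun i hi => ?_
    rw [← Finset.mul_prod_erase I _ hi, rho, smul_eq_mul]
    have := h i hi
    field_simp
  rw [e] at d1
  have d2 : HasDerivAt (fun y => Complex.exp (c * y)) (Complex.exp (c * x) * (c * 1)) x :=
    ((hasDerivAt_id x).const_mul c).cexp
  refine (d2.fun_mul d1).congr_deriv ?_
  ring

/-- The function `e^{πiμx} ∏_j θ(x - t_j)`. -/
noncomputable def tildeF {τ : ℍ} {m : ℕ} (s : BetheSolution τ m) (x : ℂ) : ℂ :=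
  Complex.exp (Real.pi * Complex.I * s.mu * x) * ∏ j, theta τ (x - s.t j)

section

variable {τ : ℍ} {m : ℕ} (s : BetheSolution τ m)

lemma quasiPeriodic_tildeF : QuasiPeriodic τ m (Complex.exp (Real.pi * Complex.I * s.mu) * (-1) ^ m)
    (Complex.exp (Real.pi * Complex.I * s.mu * τ) * ((-1) ^ m *
      Complex.exp (-(Real.pi * Complex.I * m * τ) + 2 * Real.pi * Complex.I * ∑ j, s.t j)))
    (tildeF s) := by
  have h := (QuasiPeriodic.exp τ (Real.pi * Complex.I * s.mu)).mul
    (QuasiPeriodic.prod_theta_sub τ s.t)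
  rwa [zero_add] at h

lemma differentiable_tildeF : Differentiable ℂ (tildeF s) := (quasiPeriodic_tildeF s).entire

lemma tildeF_z_ne_zero (a : Fin (2 * m)) : tildeF s (s.z a) ≠ 0 :=
  mul_ne_zero (Complex.exp_ne_zero _) (Finset.prod_ne_zero_iff.2 fun j _ => by
    rw [theta_sub_comm]
    exact neg_ne_zero.2 (theta_t_sub_z s j a))

lemma tildeF_t (j : Fin m) : tildeF s (s.t j) = 0 := by
  rw [tildeF, Finset.prod_eq_zero (Finset.mem_univ j) (by rw [sub_self, theta_zero]), mul_zero]

/-- The logarithmic derivative at z_a is the part of E_a in `eigenvalue_eq` that depends on μ and t,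
so comparing eigenvalues amounts to comparing logarithmic derivatives. -/
lemma deriv_tildeF_z (a : Fin (2 * m)) : deriv (tildeF s) (s.z a) =
    tildeF s (s.z a) * (Real.pi * Complex.I * s.mu - rhoSum s a) := by
  have h := hasDerivAt_exp_mul_prod_theta τ Finset.univ s.t (Real.pi * Complex.I * s.mu)
    (x := s.z a) fun j _ => by
      rw [theta_sub_comm]
      exact neg_ne_zero.2 (theta_t_sub_z s j a)
  have h' : deriv (tildeF s) (s.z a) = _ := h.deriv
  rw [h', rhoSum, sub_eq_add_neg, ← Finset.sum_neg_distrib]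
  simp only [← rho_neg, neg_sub]
  rfl

/-- The Bethe ansatz equation as an equation for the second derivative. -/
lemma deriv_deriv_tildeF_t (j : Fin m) : deriv (deriv (tildeF s)) (s.t j) =
    deriv (tildeF s) (s.t j) * ∑ a, rho τ (s.t j - s.z a) := by
  set G : ℂ → ℂ := fun x => Complex.exp (Real.pi * Complex.I * s.mu * x) *
    ∏ k ∈ Finset.univ.erase j, theta τ (x - s.t k) with hG
  have hGd : Differentiable ℂ G := by
    refine Differentiable.mul (by fun_prop) (Differentiable.fun_finsetProd fun k _ => ?_)
    exact (differentiable_theta τ).comp (by fun_prop)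
  have hG' : Differentiable ℂ (deriv G) := fun x => (hGd.analyticAt x).deriv.differentiableAt
  have hF : tildeF s = fun x => theta τ (x - s.t j) * G x := by
    funext x
    rw [tildeF, ← Finset.mul_prod_erase _ _ (Finset.mem_univ j), hG]
    ring
  have d1 : ∀ x, HasDerivAt (fun y => theta τ (y - s.t j)) (deriv (theta τ) (x - s.t j)) x :=
    fun x => (hasDerivAt_theta τ (x - s.t j)).comp_sub_const x (s.t j)
  have hF' : deriv (tildeF s) = fun x => deriv (theta τ) (x - s.t j) * G x +
      theta τ (x - s.t j) * deriv G x := by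
    funext x
    rw [hF]
    exact ((d1 x).mul (hGd x).hasDerivAt).deriv
  have d2 : HasDerivAt (fun y => deriv (theta τ) (y - s.t j)) 0 (s.t j) := by
    have h := ((differentiable_deriv_theta τ) (s.t j - s.t j)).hasDerivAt.comp_sub_const
      (s.t j) (s.t j)
    rwa [sub_self, deriv_zero_of_even (deriv_theta_neg τ)] at h
  have d3 := (d2.fun_mul (hGd (s.t j)).hasDerivAt).fun_add
    ((d1 (s.t j)).fun_mul (hG' (s.t j)).hasDerivAt)
  have hlog : deriv G (s.t j) = G (s.t j) * (Real.pi * Complex.I * s.mu +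
      ∑ k ∈ Finset.univ.erase j, rho τ (s.t j - s.t k)) :=
    (hasDerivAt_exp_mul_prod_theta τ (Finset.univ.erase j) s.t (Real.pi * Complex.I * s.mu)
      (x := s.t j) fun k hk =>
        theta_ne_zero (s.t_distinct j k (Finset.ne_of_mem_erase hk).symm)).deriv
  -- With F = θ(x − t_j)G and θ = 0, θ′ = 1, θ″ = 0 at the origin, one gets F″(t_j) = 2G′(t_j) and
  -- F′(t_j) = G(t_j). The Bethe equation is then a formula for twice the logarithmic derivative of
  -- G.
  have h1 : deriv (deriv (tildeF s)) (s.t j) = 2 * deriv G (s.t j) := by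
    rw [hF', d3.deriv]
    simp only [sub_self, theta_zero, deriv_theta_zero]
    ring
  have h2 : deriv (tildeF s) (s.t j) = G (s.t j) := by
    rw [hF']
    simp only [sub_self, theta_zero, deriv_theta_zero]
    ring
  rw [h1, h2, hlog]
  linear_combination G (s.t j) * s.bethe_equation j

end

lemma hasDerivAt_wr {f g : ℂ → ℂ} (hf : Differentiable ℂ f) (hg : Differentiable ℂ g) (x : ℂ) :
    HasDerivAt (Wr f g) (f x * deriv (deriv g) x - deriv (deriv f) x * g x) x := by
  have hf' : HasDerivAt (deriv f) _ x := ((hf.analyticAt x).deriv.differentiableAt).hasDerivAt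
  have hg' : HasDerivAt (deriv g) _ x := ((hg.analyticAt x).deriv.differentiableAt).hasDerivAt
  refine (((hf x).hasDerivAt.fun_mul hg').fun_sub (hf'.fun_mul (hg x).hasDerivAt)).congr_deriv ?_
  ring

section

variable {τ : ℍ} {m : ℕ} {a b : BetheSolution τ m}

/-- If two solutions have equal eigenvalues, then the Wronskian of `tildeF` is proportional to
`∏_a θ(x - z_a)`. -/
lemma exists_wr_eq (hm : 0 < m) (hz : ∀ i j, i ≠ j → ¬ InLattice τ (a.z i - a.z j))
    (hab : b.z = a.z) (h : ∀ i, Real.pi * Complex.I * a.mu - rhoSum a i =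
      Real.pi * Complex.I * b.mu - rhoSum b i) :
    ∃ C : ℂ, ∀ x, Wr (tildeF a) (tildeF b) x = C * ∏ i, theta τ (x - a.z i) := by
  have hq := (quasiPeriodic_tildeF a).wr (quasiPeriodic_tildeF b)
  rw [← two_mul] at hq
  have h0 : ∀ i, Wr (tildeF a) (tildeF b) (a.z i) = 0 := by
    intro i
    have e1 := deriv_tildeF_z a i
    have e2 := deriv_tildeF_z b i
    rw [hab, ← h i] at e2
    rw [Wr, e1, e2]
    ring
  obtain ⟨C, c, hC⟩ := hq.exists_eq_prod_mul_exp a.z hz h0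
  by_cases hC0 : C = 0
  · exact ⟨0, fun x => by rw [hC, hC0]; ring⟩
  · refine ⟨C, fun x => ?_⟩
    have j : Fin m := ⟨0, hm⟩
    have hW : Wr (tildeF a) (tildeF b) =
        fun x => C * (Complex.exp (c * x) * ∏ i, theta τ (x - a.z i)) := by
      funext x
      rw [hC]
      ring
    have d1 := (hasDerivAt_exp_mul_prod_theta τ Finset.univ a.z c (x := a.t j)
      fun i _ => theta_t_sub_z a j i).const_mul C
    rw [← hW] at d1
    have d2 := d1.unique (hasDerivAt_wr (differentiable_tildeF a) (differentiable_tildeF b) (a.t j))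
    have hWt : Wr (tildeF a) (tildeF b) (a.t j) = -(deriv (tildeF a) (a.t j) * tildeF b (a.t j)) := by
      rw [Wr, tildeF_t]
      ring
    have hne : C * (Complex.exp (c * a.t j) * ∏ i, theta τ (a.t j - a.z i)) ≠ 0 :=
      mul_ne_zero hC0 (mul_ne_zero (Complex.exp_ne_zero _)
        (Finset.prod_ne_zero_iff.2 fun i _ => theta_t_sub_z a j i))
    have hWt' : C * (Complex.exp (c * a.t j) * ∏ i, theta τ (a.t j - a.z i)) =
        -(deriv (tildeF a) (a.t j) * tildeF b (a.t j)) := by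
      rw [← hWt, hW]
    rw [tildeF_t, deriv_deriv_tildeF_t] at d2
    -- The logarithmic derivative of the Wronskian at t_j is computed twice. The product formula
    -- gives c + ∑ρ(t_j − z_i). Since F(t_j) = 0, the Wronskian is −F′G and its derivative −F″G, so
    -- the Bethe equation gives ∑ρ(t_j − z_i).
    have hc : c = 0 := by
      refine (mul_eq_zero.1 (?_ : C * (Complex.exp (c * a.t j) *
        ∏ i, theta τ (a.t j - a.z i)) * c = 0)).resolve_left hne
      linear_combination d2 - (∑ i, rho τ (a.t j - a.z i)) * hWt'
    rw [hC, hc]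
    simp

/-- Consequences of a nonzero Wronskian for the multipliers. -/
lemma multipliers_of_wr {C : ℂ} (hC : C ≠ 0)
    (h : ∀ x, Wr (tildeF a) (tildeF b) x = C * ∏ i, theta τ (x - a.z i)) :
    Complex.exp (Real.pi * Complex.I * (a.mu + b.mu)) = 1 ∧
    Complex.exp (Real.pi * Complex.I * (a.mu + b.mu) * τ + 2 * Real.pi * Complex.I *
      (∑ j, a.t j + ∑ j, b.t j - ∑ i, a.z i)) = 1 := by
  have hq := (quasiPeriodic_tildeF a).wr (quasiPeriodic_tildeF b)
  rw [← two_mul] at hq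
  have hne : Wr (tildeF a) (tildeF b) ≠ 0 := by
    by_cases hm : 0 < m
    · have j : Fin m := ⟨0, hm⟩
      intro h0
      have := h (a.t j)
      rw [h0] at this
      exact mul_ne_zero hC (Finset.prod_ne_zero_iff.2 fun i _ => theta_t_sub_z a j i) this.symm
    · obtain rfl : m = 0 := by omega
      intro h0
      have := h 0
      rw [h0] at this
      simp at this
      exact hC this.symm
  obtain ⟨h1, h2⟩ := hq.multipliers_eq (QuasiPeriodic.prod_theta_sub τ a.z) h hne
  have hs : ((-1 : ℂ)) ^ m * (-1) ^ m = 1 := by rw [← mul_pow]; simp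
  have hs2 : ((-1 : ℂ)) ^ (2 * m) = 1 := by simp
  constructor
  · rw [mul_add, Complex.exp_add]
    rw [hs2] at h1
    linear_combination h1 - Complex.exp (Real.pi * Complex.I * a.mu) *
      Complex.exp (Real.pi * Complex.I * b.mu) * hs
  · rw [hs2, one_mul] at h2
    have e : Complex.exp (Real.pi * Complex.I * (a.mu + b.mu) * τ + 2 * Real.pi * Complex.I *
          (∑ j, a.t j + ∑ j, b.t j - ∑ i, a.z i)) *
        Complex.exp (-(Real.pi * Complex.I * ((2 * m : ℕ) : ℂ) * τ) +
          2 * Real.pi * Complex.I * ∑ i, a.z i) =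
        Complex.exp (Real.pi * Complex.I * a.mu * τ) *
        Complex.exp (-(Real.pi * Complex.I * m * τ) + 2 * Real.pi * Complex.I * ∑ j, a.t j) *
        (Complex.exp (Real.pi * Complex.I * b.mu * τ) *
        Complex.exp (-(Real.pi * Complex.I * m * τ) + 2 * Real.pi * Complex.I * ∑ j, b.t j)) := by
      simp only [← Complex.exp_add]
      congr 1
      push_cast
      ring
    refine mul_right_cancel₀ (Complex.exp_ne_zero (-(Real.pi * Complex.I * ((2 * m : ℕ) : ℂ) * τ) +
          2 * Real.pi * Complex.I * ∑ i, a.z i)) ?_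
    rw [e, one_mul, ← h2]
    linear_combination -(Complex.exp (Real.pi * Complex.I * a.mu * τ) *
        Complex.exp (-(Real.pi * Complex.I * m * τ) + 2 * Real.pi * Complex.I * ∑ j, a.t j) *
        (Complex.exp (Real.pi * Complex.I * b.mu * τ) *
        Complex.exp (-(Real.pi * Complex.I * m * τ) + 2 * Real.pi * Complex.I * ∑ j, b.t j))) * hs

/-! ### The pair of theta-polynomials -/

/-- Only the constant differs between the two normalizations: B absorbs the sign (−1)^m and the
factor e^{πimτ}. -/
lemma QuasiPeriodic.isThetaPoly {A β : ℂ} {f : ℂ → ℂ} (h : QuasiPeriodic τ m (A * (-1) ^ m) β f) :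
    ∃ B, IsThetaPoly τ m A B f := by
  have hs : ((-1 : ℂ)) ^ m * (-1) ^ m = 1 := by rw [← mul_pow]; simp
  refine ⟨β * (-1) ^ m * Complex.exp (Real.pi * Complex.I * m * τ), h.entire,
    left_ne_zero_of_mul h.α_ne, ?_, h.add_one, fun x => ?_⟩
  · exact mul_ne_zero (mul_ne_zero h.β_ne (by simp)) (Complex.exp_ne_zero _)
  · have e : Complex.exp (-(2 * Real.pi * Complex.I * m * x)) =
        Complex.exp (Real.pi * Complex.I * m * τ) *
        Complex.exp (-(Real.pi * Complex.I * m * τ) - 2 * Real.pi * Complex.I * m * x) := by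
      rw [← Complex.exp_add]
      congr 1
      ring
    rw [h.add_tau, e]
    linear_combination -(β * Complex.exp (Real.pi * Complex.I * m * τ) *
        Complex.exp (-(Real.pi * Complex.I * m * τ) - 2 * Real.pi * Complex.I * m * x) * f x) * hs

lemma QuasiPeriodic.const_mul {d : ℕ} {α β : ℂ} {f : ℂ → ℂ} (h : QuasiPeriodic τ d α β f) (c : ℂ) :
    QuasiPeriodic τ d α β (fun x => c * f x) where
  entire := h.entire.const_mul c
  α_ne := h.α_ne
  β_ne := h.β_ne
  add_one x := by rw [h.add_one]; ring
  add_tau x := by rw [h.add_tau]; ring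

lemma tildeF_eq (s : BetheSolution τ m) (x : ℂ) : ∏ j, theta τ (x - s.t j) =
    Complex.exp (-(Real.pi * Complex.I * s.mu) * x) * tildeF s x := by
  rw [tildeF, ← mul_assoc, ← Complex.exp_add]
  simp

lemma exists_prod_theta_ne_zero (s : BetheSolution τ m) :
    (fun x => ∏ j, theta τ (x - s.t j)) ≠ 0 := by
  rcases Nat.eq_zero_or_pos m with rfl | hm
  · intro h
    have := congrFun h 0
    simp at this
  · intro h
    have a : Fin (2 * m) := ⟨0, by omega⟩
    have h1 := tildeF_z_ne_zero s a
    have h2 := congrFun h (s.z a)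
    simp only [Pi.zero_apply] at h2
    rw [tildeF, h2, mul_zero] at h1
    exact h1 rfl

/-- The two exponentials differ by the factor e^{2πiμ} of the first solution; if both were 1, that μ
would be an integer. -/
lemma exp_mu_sub_ne_one (h : Complex.exp (Real.pi * Complex.I * (a.mu + b.mu)) = 1) :
    Complex.exp (Real.pi * Complex.I * (b.mu - a.mu)) ≠ 1 := by
  intro h1
  have h2 : Complex.exp (2 * Real.pi * Complex.I * a.mu) = 1 := by
    have : Complex.exp (2 * Real.pi * Complex.I * a.mu) *
        Complex.exp (Real.pi * Complex.I * (b.mu - a.mu)) =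
        Complex.exp (Real.pi * Complex.I * (a.mu + b.mu)) := by
      rw [← Complex.exp_add]
      congr 1
      ring
    rwa [h, h1, mul_one] at this
  obtain ⟨n, hn⟩ := Complex.exp_eq_one_iff.1 h2
  refine a.mu_not_int n ?_
  apply mul_left_cancel₀ Complex.two_pi_I_ne_zero
  linear_combination hn

/-- The pair `(∏_j θ(x - t_j), c e^{πi(μ'-μ)x} ∏_j θ(x - t'_j))`. -/
noncomputable def solutionPair (a b : BetheSolution τ m)
    (h : Complex.exp (Real.pi * Complex.I * (a.mu + b.mu)) = 1) (c : ℂ) (hc : c ≠ 0) :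
    ThetaPair τ m where
  f x := ∏ j, theta τ (x - a.t j)
  g x := c * (Complex.exp (Real.pi * Complex.I * (b.mu - a.mu) * x) * ∏ j, theta τ (x - b.t j))
  A := Complex.exp (Real.pi * Complex.I * (b.mu - a.mu))
  f_theta := by
    have h := QuasiPeriodic.prod_theta_sub τ a.t
    rw [← one_mul ((-1 : ℂ) ^ m)] at h
    exact h.isThetaPoly
  g_theta := by
    have h := ((QuasiPeriodic.exp τ (Real.pi * Complex.I * (b.mu - a.mu))).mul
      (QuasiPeriodic.prod_theta_sub τ b.t)).const_mul c
    rw [zero_add] at h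
    exact h.isThetaPoly
  f_ne := exists_prod_theta_ne_zero a
  g_ne := by
    obtain ⟨x, hx⟩ := Function.ne_iff.1 (exists_prod_theta_ne_zero b)
    exact Function.ne_iff.2 ⟨x, mul_ne_zero hc (mul_ne_zero (Complex.exp_ne_zero _) hx)⟩
  A_ne_one := exp_mu_sub_ne_one h

lemma wr_exp_mul {f g : ℂ → ℂ} (hf : Differentiable ℂ f) (hg : Differentiable ℂ g) (k c x : ℂ) :
    Wr (fun x => Complex.exp (k * x) * f x) (fun x => c * (Complex.exp (k * x) * g x)) x =
      c * Complex.exp (2 * k * x) * Wr f g x := by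
  have d : HasDerivAt (fun y => Complex.exp (k * y)) (Complex.exp (k * x) * (k * 1)) x :=
    ((hasDerivAt_id x).const_mul k).cexp
  have e : Complex.exp (2 * k * x) = Complex.exp (k * x) * Complex.exp (k * x) := by
    rw [← Complex.exp_add]
    congr 1
    ring
  rw [Wr, Wr, (d.fun_mul (hf x).hasDerivAt).deriv,
    ((d.fun_mul (hg x).hasDerivAt).const_mul c).deriv, e]
  ring

/-- Dividing both functions `tildeF` by e^{πiμx}, with μ taken from the first solution, multiplies
their Wronskian by e^{−2πiμx}, as β prescribes. The factor C⁻¹ removes the constant. -/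
lemma beta_solutionPair (h : Complex.exp (Real.pi * Complex.I * (a.mu + b.mu)) = 1)
    {C : ℂ} (hC : C ≠ 0)
    (hW : ∀ x, Wr (tildeF a) (tildeF b) x = C * ∏ i, theta τ (x - a.z i)) :
    Beta (⟦a⟧ : Sol1 τ m) ⟦solutionPair a b h C⁻¹ (inv_ne_zero hC)⟧ := by
  refine ⟨a, _, rfl, rfl, fun x => rfl, fun x => ?_⟩
  have e1 : (solutionPair a b h C⁻¹ (inv_ne_zero hC)).f =
      fun x => Complex.exp (-(Real.pi * Complex.I * a.mu) * x) * tildeF a x := by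
    funext x
    exact tildeF_eq a x
  have e2 : (solutionPair a b h C⁻¹ (inv_ne_zero hC)).g =
      fun x => C⁻¹ * (Complex.exp (-(Real.pi * Complex.I * a.mu) * x) * tildeF b x) := by
    funext x
    simp only [solutionPair, tildeF]
    rw [← mul_assoc (Complex.exp (-(Real.pi * Complex.I * a.mu) * x)), ← Complex.exp_add]
    congr 3
    ring
  rw [e1, e2, wr_exp_mul (differentiable_tildeF a) (differentiable_tildeF b), hW]
  have e3 : Complex.exp (2 * -(Real.pi * Complex.I * a.mu) * x) =
      Complex.exp (-(2 * Real.pi * Complex.I * a.mu * x)) := by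
    congr 1
    ring
  rw [e3]
  field_simp

/-- The exponent ν of the involution satisfies e^{2πiν}e^{πi(μ_a − μ_b)} = 1. So swapping reproduces
the other pair up to constants and a common factor e^{2πinx} with n an integer, which the
equivalence of pairs allows. -/
lemma rel_swap_solutionPair (h : Complex.exp (Real.pi * Complex.I * (a.mu + b.mu)) = 1)
    (h' : Complex.exp (Real.pi * Complex.I * (b.mu + a.mu)) = 1) {c c' : ℂ} (hc : c ≠ 0)
    (hc' : c' ≠ 0) :
    (solutionPair a b h c hc).Rel (solutionPair b a h' c' hc').swap := by
  set p := solutionPair b a h' c' hc' with hp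
  have hν := p.exp_mu
  have hA : p.A = Complex.exp (Real.pi * Complex.I * (a.mu - b.mu)) := rfl
  have h1 : Complex.exp (2 * Real.pi * Complex.I * p.mu + Real.pi * Complex.I * (a.mu - b.mu)) = 1 := by
    rw [Complex.exp_add, hν, hA, inv_mul_cancel₀ (Complex.exp_ne_zero _)]
  obtain ⟨n, hn⟩ := Complex.exp_eq_one_iff.1 h1
  refine ⟨c', c⁻¹, n, hc', inv_ne_zero hc, fun x => ?_, fun x => ?_⟩
  · change Complex.exp (2 * Real.pi * Complex.I * p.mu * x) * (c' *
      (Complex.exp (Real.pi * Complex.I * (a.mu - b.mu) * x) * ∏ j, theta τ (x - a.t j))) =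
      c' * Complex.exp (2 * Real.pi * Complex.I * n * x) * ∏ j, theta τ (x - a.t j)
    have e : Complex.exp (2 * Real.pi * Complex.I * n * x) =
        Complex.exp (2 * Real.pi * Complex.I * p.mu * x) *
        Complex.exp (Real.pi * Complex.I * (a.mu - b.mu) * x) := by
      rw [← Complex.exp_add]
      congr 1
      linear_combination -x * hn
    rw [e]
    ring
  · change Complex.exp (2 * Real.pi * Complex.I * p.mu * x) * ∏ j, theta τ (x - b.t j) =
      c⁻¹ * Complex.exp (2 * Real.pi * Complex.I * n * x) *
        (c * (Complex.exp (Real.pi * Complex.I * (b.mu - a.mu) * x) * ∏ j, theta τ (x - b.t j)))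
    have e : Complex.exp (2 * Real.pi * Complex.I * p.mu * x) =
        Complex.exp (2 * Real.pi * Complex.I * n * x) *
        Complex.exp (Real.pi * Complex.I * (b.mu - a.mu) * x) := by
      rw [← Complex.exp_add]
      congr 1
      linear_combination x * hn
    rw [e]
    field_simp

/-- The Wronskian is antisymmetric, so the construction of the pair applies to both orderings of the
solutions, with constants C and −C. The two resulting pairs are exchanged by the involution. -/
lemma isAnalyticImage_of_wr (hab : b.z = a.z)
    (h : Complex.exp (Real.pi * Complex.I * (a.mu + b.mu)) = 1) {C : ℂ} (hC : C ≠ 0)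
    (hW : ∀ x, Wr (tildeF a) (tildeF b) x = C * ∏ i, theta τ (x - a.z i)) :
    IsAnalyticImage (⟦a⟧ : Sol1 τ m) ⟦b⟧ := by
  have h' : Complex.exp (Real.pi * Complex.I * (b.mu + a.mu)) = 1 := by rwa [add_comm]
  have hW' : ∀ x, Wr (tildeF b) (tildeF a) x = -C * ∏ i, theta τ (x - b.z i) := by
    intro x
    have e : Wr (tildeF b) (tildeF a) x = -Wr (tildeF a) (tildeF b) x := by
      rw [Wr, Wr]
      ring
    rw [e, hW, hab]
    ring
  refine ⟨_, beta_solutionPair h' (neg_ne_zero.2 hC) hW', ?_⟩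
  have e : analyticInvolution ⟦solutionPair b a h' (-C)⁻¹ (inv_ne_zero (neg_ne_zero.2 hC))⟧ =
      ⟦solutionPair a b h C⁻¹ (inv_ne_zero hC)⟧ :=
    (Quotient.sound (rel_swap_solutionPair h h' _ _)).symm
  rw [e]
  exact beta_solutionPair h hC hW

end


/-! ### Translations of solutions -/

section

variable {τ : ℍ} {m : ℕ}

lemma not_inLattice_add {x y : ℂ} (hx : ¬ InLattice τ x) (hy : InLattice τ y) :
    ¬ InLattice τ (x + y) := by
  intro h
  refine hx ?_
  have := h.add hy.neg
  rwa [add_neg_cancel_right] at this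

/-- The solution with `t_j` replaced by `t_j + k_j + l_j τ`. -/
noncomputable def BetheSolution.translate (a : BetheSolution τ m) (k l : Fin m → ℤ) :
    BetheSolution τ m where
  mu := a.mu - 2 * ∑ j, (l j : ℂ)
  t j := a.t j + (k j + l j * τ)
  z := a.z
  t_distinct i j hij := by
    have e : a.t i + (k i + l i * τ) - (a.t j + (k j + l j * τ)) =
      a.t i - a.t j + (((k i - k j : ℤ) : ℂ) + ((l i - l j : ℤ) : ℂ) * τ) := by push_cast; ring
    rw [e]
    exact not_inLattice_add (a.t_distinct i j hij) ⟨_, _, rfl⟩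
  t_ne_z j i := by
    rw [add_sub_right_comm]
    exact not_inLattice_add (a.t_ne_z j i) ⟨_, _, rfl⟩
  -- Put Λ = ∑ l_i. The differences of the t contribute −4πi(m l_j − Λ), the 2m terms with z
  -- contribute +4πim l_j, and the change of μ by −2Λ contributes −4πiΛ; the total is zero.
  bethe_equation j := by
    have e1 : ∀ i ∈ Finset.univ.erase j, rho τ (a.t j + (k j + l j * τ) - (a.t i + (k i + l i * τ))) =
        rho τ (a.t j - a.t i) - 2 * Real.pi * Complex.I * ((l j : ℂ) - l i) := by
      intro i hi
      have e : a.t j + (k j + l j * τ) - (a.t i + (k i + l i * τ)) =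
        a.t j - a.t i + (((k j - k i : ℤ) : ℂ) + ((l j - l i : ℤ) : ℂ) * τ) := by push_cast; ring
      rw [e, InLattice.rho_add (a.t_distinct j i (Finset.ne_of_mem_erase hi).symm)]
      push_cast
      ring
    have e2 : ∀ i, rho τ (a.t j + (k j + l j * τ) - a.z i) =
        rho τ (a.t j - a.z i) - 2 * Real.pi * Complex.I * l j := by
      intro i
      rw [add_sub_right_comm, InLattice.rho_add (a.t_ne_z j i)]
    have e3 : ∑ i ∈ Finset.univ.erase j, ((l j : ℂ) - l i) = m * l j - ∑ i, (l i : ℂ) := by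
      rw [Finset.sum_erase _ (by simp), Finset.sum_sub_distrib]
      simp
    rw [Finset.sum_congr rfl e1]
    simp only [e2, Finset.sum_sub_distrib (f := fun i => rho τ (a.t j - a.t i)),
      Finset.sum_sub_distrib (f := fun i => rho τ (a.t j - a.z i)), ← Finset.mul_sum]
    rw [e3]
    simp only [Finset.sum_const, Finset.card_univ, Fintype.card_fin, nsmul_eq_mul]
    push_cast
    linear_combination a.bethe_equation j
  mu_not_int i h := a.mu_not_int (i + 2 * ∑ j, l j) (by push_cast; linear_combination h)

lemma sound_step {a b : BetheSolution τ m} (h : Step a b) : (⟦a⟧ : Sol1 τ m) = ⟦b⟧ :=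
  Quotient.sound (Relation.EqvGen.rel _ _ h)

lemma translate_add_single (a : BetheSolution τ m) (k l : Fin m → ℤ) (j : Fin m) :
    (⟦a.translate (k + Pi.single j 1) l⟧ : Sol1 τ m) = ⟦a.translate k l⟧ := by
  refine Eq.symm (sound_step (a := a.translate k l) (b := a.translate (k + Pi.single j 1) l)
    (Step.t_one j rfl ?_ rfl))
  funext i
  by_cases hi : i = j
  · subst hi
    simp only [BetheSolution.translate, Pi.add_apply, Pi.single_eq_same, Function.update_self]
    push_cast
    ring
  · simp [BetheSolution.translate, hi]

lemma translate_add_single_tau (a : BetheSolution τ m) (k l : Fin m → ℤ) (j : Fin m) :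
    (⟦a.translate k (l + Pi.single j 1)⟧ : Sol1 τ m) = ⟦a.translate k l⟧ := by
  refine Eq.symm (sound_step (a := a.translate k l) (b := a.translate k (l + Pi.single j 1))
    (Step.t_tau j ?_ ?_ rfl))
  · simp only [BetheSolution.translate, Pi.add_apply]
    push_cast
    rw [Finset.sum_add_distrib]
    have : ∑ i, (((Pi.single j 1 : Fin m → ℤ) i : ℤ) : ℂ) = 1 := by
      rw [Finset.sum_eq_single j] <;> simp +contextual
    rw [this]
    ring
  · funext i
    by_cases hi : i = j
    · subst hi
      simp only [BetheSolution.translate, Pi.add_apply, Pi.single_eq_same, Function.update_self]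
      push_cast
      ring
    · simp [BetheSolution.translate, hi]

/-- Reduces invariance under arbitrary integer translations to the elementary ones: the translations
that preserve classes form a subgroup containing the unit vectors. -/
lemma mem_of_single_mem {m : ℕ} (S : AddSubgroup (Fin m → ℤ)) (h : ∀ j, Pi.single j 1 ∈ S)
    (v : Fin m → ℤ) : v ∈ S := by
  have e : v = ∑ j, v j • (Pi.single j 1 : Fin m → ℤ) := by
    funext i
    simp [Finset.sum_apply, Pi.single_apply]
  rw [e]
  exact S.sum_mem fun j _ => S.zsmul_mem (h j) _

lemma translate_eq (a : BetheSolution τ m) (k l : Fin m → ℤ) :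
    (⟦a.translate k l⟧ : Sol1 τ m) = ⟦a⟧ := by
  have h1 : ∀ v k l, (⟦a.translate (k + v) l⟧ : Sol1 τ m) = ⟦a.translate k l⟧ := fun v =>
    mem_of_single_mem
      { carrier := {v | ∀ k l, (⟦a.translate (k + v) l⟧ : Sol1 τ m) = ⟦a.translate k l⟧}
        add_mem' := fun {v v'} hv hv' k l => by rw [← add_assoc, hv', hv]
        zero_mem' := fun k l => by rw [add_zero]
        neg_mem' := fun {v} hv k l => by rw [← hv, neg_add_cancel_right] }
      (fun j k l => translate_add_single a k l j) v
  have h2 : ∀ v k l, (⟦a.translate k (l + v)⟧ : Sol1 τ m) = ⟦a.translate k l⟧ := fun v =>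
    mem_of_single_mem
      { carrier := {v | ∀ k l, (⟦a.translate k (l + v)⟧ : Sol1 τ m) = ⟦a.translate k l⟧}
        add_mem' := fun {v v'} hv hv' k l => by rw [← add_assoc, hv', hv]
        zero_mem' := fun k l => by rw [add_zero]
        neg_mem' := fun {v} hv k l => by rw [← hv, neg_add_cancel_right] }
      (fun j k l => translate_add_single_tau a k l j) v
  have e1 := h1 k 0 l
  have e2 := h2 l 0 0
  rw [zero_add] at e1 e2
  rw [e1, e2]
  -- The zero translation is linked to the original solution by the identity permutation of the t_j.
  refine Eq.symm (sound_step (a := a) (b := a.translate 0 0) (Step.perm_t 1 ?_ ?_ rfl))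
  · simp [BetheSolution.translate]
  · funext j
    simp [BetheSolution.translate]

/-! ### Proportional functions -/

/-- The quotient g/f has zero derivative on a ball where f does not vanish, hence is constant there;
the identity theorem extends the relation to the whole plane. -/
lemma exists_eq_const_mul_of_wr_eq_zero {f g : ℂ → ℂ} (hf : Differentiable ℂ f)
    (hg : Differentiable ℂ g) (h : ∀ x, Wr f g x = 0) {p : ℂ} (hp : f p ≠ 0) :
    ∃ c : ℂ, ∀ x, g x = c * f x := by
  obtain ⟨r, hr, hball⟩ := Metric.eventually_nhds_iff_ball.1 (hf.continuous.continuousAt.eventually_ne hp)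
  have hd : ∀ x ∈ Metric.ball p r, HasDerivAt (fun y => g y / f y) 0 x := by
    intro x hx
    refine ((hg x).hasDerivAt.fun_div (hf x).hasDerivAt (hball x hx)).congr_deriv ?_
    have := h x
    rw [Wr] at this
    rw [div_eq_zero_iff]
    left
    linear_combination this
  refine ⟨g p / f p, ?_⟩
  have hev : g =ᶠ[𝓝 p] fun x => g p / f p * f x := by
    filter_upwards [Metric.ball_mem_nhds p hr] with x hx
    have e := Metric.isOpen_ball.is_const_of_deriv_eq_zero (convex_ball p r).isPreconnected
      (fun y hy => (hd y hy).differentiableAt.differentiableWithinAt)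
      (fun y hy => (hd y hy).deriv) hx (Metric.mem_ball_self hr)
    have hx0 := hball x hx
    have e : g x / f x = g p / f p := e
    rw [← e]
    field_simp
  have ha : AnalyticOnNhd ℂ g Set.univ := fun x _ => hg.analyticAt x
  have hb : AnalyticOnNhd ℂ (fun x => g p / f p * f x) Set.univ :=
    fun x _ => (hf.const_mul _).analyticAt x
  exact congrFun (ha.eq_of_eventuallyEq hb hev)

/-- Proportional functions have the same zeros, so the two sets of t agree modulo the lattice up to
a permutation. Comparing the remaining exponentials fixes the difference of the μ as exactly the
change produced by the τ-translations. -/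
lemma class_eq_of_proportional {a b : BetheSolution τ m} (hm : 0 < m) (hab : b.z = a.z) {c : ℂ}
    (h : ∀ x, tildeF b x = c * tildeF a x) : (⟦a⟧ : Sol1 τ m) = ⟦b⟧ := by
  have hex : ∀ j, ∃ i, InLattice τ (a.t j - b.t i) := by
    intro j
    have e := h (a.t j)
    rw [tildeF_t, mul_zero, tildeF] at e
    obtain ⟨i, _, hi⟩ := Finset.prod_eq_zero_iff.1
      ((mul_eq_zero.1 e).resolve_left (Complex.exp_ne_zero _))
    exact ⟨i, theta_eq_zero_iff.1 hi⟩
  choose π hπ using hex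
  have hinj : Function.Injective π := by
    intro i j hij
    by_contra hne
    refine a.t_distinct i j hne ?_
    have e : a.t i - a.t j = (a.t i - b.t (π i)) + -(a.t j - b.t (π j)) := by rw [hij]; ring
    rw [e]
    exact (hπ i).add (hπ j).neg
  choose k l hkl using hπ
  -- An injective self-map of a finite set is a permutation; injectivity comes from the t_j being
  -- incongruent.
  set σ : Equiv.Perm (Fin m) := Equiv.ofBijective π (Finite.injective_iff_bijective.1 hinj) with hσ
  have hbt : ∀ j, b.t (σ j) = a.t j - (k j + l j * τ) := fun j => by
    have : σ j = π j := rfl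
    rw [this]
    linear_combination -hkl j
  have hθ : ∀ j, ∃ d : ℂ, d ≠ 0 ∧ ∀ x, theta τ (x - b.t (σ j)) =
      d * Complex.exp (2 * Real.pi * Complex.I * (-l j) * x) * theta τ (x - a.t j) := by
    intro j
    obtain ⟨d, hd, e⟩ := theta_sub_lattice τ (-k j) (-l j)
    refine ⟨d * Complex.exp (2 * Real.pi * Complex.I * (-l j) * -a.t j),
      mul_ne_zero hd (Complex.exp_ne_zero _), fun x => ?_⟩
    have e' := e (x - a.t j)
    rw [hbt]
    rw [show x - (a.t j - (k j + l j * τ)) =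
      x - a.t j - (((-k j : ℤ) : ℂ) + ((-l j : ℤ) : ℂ) * τ) by push_cast; ring, e']
    have e3 : Complex.exp (2 * Real.pi * Complex.I * ((-l j : ℤ) : ℂ) * (x - a.t j)) =
        Complex.exp (2 * Real.pi * Complex.I * (-l j) * -a.t j) *
        Complex.exp (2 * Real.pi * Complex.I * (-l j) * x) := by
      rw [← Complex.exp_add]
      congr 1
      push_cast
      ring
    rw [e3]
    ring
  choose d hd0 hd using hθ
  set K := ∏ j, d j with hK
  have hK0 : K ≠ 0 := Finset.prod_ne_zero_iff.2 fun j _ => hd0 j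
  set Λ : ℂ := ∑ j, (l j : ℂ) with hΛ
  have hprod : ∀ x, ∏ j, theta τ (x - b.t j) =
      K * Complex.exp (-(2 * Real.pi * Complex.I * Λ) * x) * ∏ j, theta τ (x - a.t j) := by
    intro x
    rw [← Equiv.prod_comp σ]
    simp only [hd, Finset.prod_mul_distrib, ← Complex.exp_sum]
    congr 3
    rw [← Finset.sum_mul, ← Finset.mul_sum, Finset.sum_neg_distrib]
    ring
  have p : Fin (2 * m) := ⟨0, by omega⟩
  have hp := tildeF_z_ne_zero a p
  set κ : ℂ := Real.pi * Complex.I * b.mu - 2 * Real.pi * Complex.I * Λ - Real.pi * Complex.I * a.mu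
    with hκ
  have hconst : (fun x => K * Complex.exp (κ * x)) =ᶠ[𝓝 (a.z p)] fun _ => c := by
    filter_upwards [(differentiable_tildeF a).continuous.continuousAt.eventually_ne hp] with x hx
    have e := h x
    have e2 : tildeF b x = K * Complex.exp (κ * x) * tildeF a x := by
      have e3 : Complex.exp (Real.pi * Complex.I * b.mu * x) *
          Complex.exp (-(2 * Real.pi * Complex.I * Λ) * x) =
          Complex.exp (κ * x) * Complex.exp (Real.pi * Complex.I * a.mu * x) := by
        rw [← Complex.exp_add, ← Complex.exp_add]
        congr 1
        rw [hκ]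
        ring
      rw [tildeF, tildeF, hprod]
      linear_combination K * (∏ j, theta τ (x - a.t j)) * e3
    rw [e2] at e
    exact mul_right_cancel₀ hx e
  have hd1 : HasDerivAt (fun x => K * Complex.exp (κ * x))
      (K * (Complex.exp (κ * a.z p) * (κ * 1))) (a.z p) :=
    (((hasDerivAt_id (a.z p)).const_mul κ).cexp).const_mul K
  -- A nonzero multiple of e^{κx} is constant near a point where F does not vanish, so its
  -- derivative forces κ = 0. This is the relation between the two μ.
  have hκ0 : κ = 0 := by
    have e := hconst.deriv_eq
    rw [hd1.deriv, deriv_const, mul_one] at e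
    exact ((mul_eq_zero.1 ((mul_eq_zero.1 e).resolve_left hK0)).resolve_left (Complex.exp_ne_zero _))
  have hmu : b.mu = a.mu + 2 * Λ := by
    have hpi : (Real.pi : ℂ) * Complex.I ≠ 0 :=
      mul_ne_zero (by exact_mod_cast Real.pi_ne_zero) Complex.I_ne_zero
    apply mul_left_cancel₀ hpi
    linear_combination hκ0
  rw [← translate_eq a (-k) (-l)]
  refine (sound_step (Step.perm_t σ ?_ ?_ ?_)).symm
  · simp only [BetheSolution.translate, Pi.neg_apply, Int.cast_neg, Finset.sum_neg_distrib]
    rw [hmu]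
    ring
  · funext j
    rw [Function.comp_apply, hbt]
    simp only [BetheSolution.translate, Pi.neg_apply]
    push_cast
    ring
  · exact hab.symm

/-! ### Comparison of the Bethe eigenfunctions -/

lemma QuasiPeriodic.reflect {d : ℕ} {α β : ℂ} {f : ℂ → ℂ} (h : QuasiPeriodic τ d α β f) :
    QuasiPeriodic τ d α⁻¹ (β⁻¹ * Complex.exp (-(2 * Real.pi * Complex.I * d * τ)))
      (fun x => f (-x)) where
  entire := h.entire.comp differentiable_neg
  α_ne := inv_ne_zero h.α_ne
  β_ne := mul_ne_zero (inv_ne_zero h.β_ne) (Complex.exp_ne_zero _)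
  add_one x := by
    have e := h.add_one (-(x + 1))
    rw [show -(x + 1) + 1 = -x by ring] at e
    rw [e, inv_mul_cancel_left₀ h.α_ne]
  add_tau x := by
    have e := h.add_tau (-(x + τ))
    rw [show -(x + (τ : ℂ)) + τ = -x by ring] at e
    have e2 : Complex.exp (-(2 * Real.pi * Complex.I * d * τ)) *
        Complex.exp (-(2 * Real.pi * Complex.I * d * x)) *
        Complex.exp (-(2 * Real.pi * Complex.I * d * -(x + τ))) = 1 := by
      rw [← Complex.exp_add, ← Complex.exp_add, ← Complex.exp_zero]
      congr 1
      ring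
    rw [e]
    have := h.β_ne
    calc f (-(x + τ)) = (β⁻¹ * β) * 1 * f (-(x + τ)) := by rw [inv_mul_cancel₀ this]; ring
      _ = _ := by rw [← e2]; ring

lemma PsiV_eq_of_numer_eq {a b : BetheSolution τ m} (h : ∀ w v, numer b w v = numer a w v) :
    PsiV b = PsiV a := by
  funext w
  refine (PsiV_rep b w).eq (f := psiFun b w) ?_
  have e : psiFun b w = psiFun a w := by
    funext v
    rw [psiFun_eq, psiFun_eq, h]
  rw [e]
  exact PsiV_rep a w

lemma PsiV_eq_weyl_of_numer_eq {a b : BetheSolution τ m}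
    (h : ∀ w, (ones w).card = m → ∀ v, numer b w v = numer a (fun k => 1 - w k) (-v)) :
    PsiV b = weyl (PsiV a) := by
  funext w
  by_cases hw : (ones w).card = m
  · refine (PsiV_rep b w).eq (f := psiFun b w) ?_
    have e : psiFun b w =
        fun v => (-1) ^ m * numer a (fun k => 1 - w k) (-v) / theta τ v ^ m := by
      funext v
      rw [psiFun_eq, h w hw]
    rw [e]
    exact weyl_rep a hw
  · rw [weyl_of_card_ne a hw]
    simp [PsiV, hw]

/-- Near 0 the numerator is close to m! ≠ 0, and in a punctured neighbourhood θ has no zero. -/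
lemma exists_psiFun_ne_zero (hm : 0 < m) (s : BetheSolution τ m) :
    ∃ w v, ¬ InLattice τ v ∧ psiFun s w v ≠ 0 := by
  obtain ⟨w, hw, _⟩ := exists_word hm ⟨0, by omega⟩
  have h1 : ∀ᶠ v in 𝓝[≠] (0 : ℂ), numer s w v ≠ 0 := by
    refine nhdsWithin_le_nhds ((differentiable_numer s w).continuous.continuousAt.eventually_ne ?_)
    rw [numer_zero s hw]
    exact_mod_cast m.factorial_ne_zero
  have h2 : ∀ᶠ v in 𝓝[≠] (0 : ℂ), theta τ v ≠ 0 := by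
    filter_upwards [self_mem_nhdsWithin, nhdsWithin_le_nhds (eventually_thetaSlope_ne_zero τ)]
      with y hy h
    rw [theta_eq_mul_thetaSlope]
    exact mul_ne_zero hy h
  obtain ⟨v, hv1, hv2⟩ := (h1.and h2).exists
  refine ⟨w, v, fun h => hv2 (theta_eq_zero_iff.2 h), ?_⟩
  rw [psiFun_eq]
  exact div_ne_zero (mul_ne_zero (by simp) hv1) (pow_ne_zero _ hv2)

/-- Joint eigenfunctions with equal eigenvalues solve the same system. -/
lemma exists_isSystemSolution {a b : BetheSolution τ m} (hm : 0 < m)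
    (hz : ∀ i j, i ≠ j → ¬ InLattice τ (a.z i - a.z j))
    (heig : ∀ T ∈ betheAlgebra τ a.z, ∃ e : ℂ, T (Psi a) = e • Psi a ∧ T (Psi b) = e • Psi b) :
    ∃ E : Fin (2 * m) → ℂ,
      IsSystemSolution τ a.z (fun w i => wt (w i) * E i + offDiagCoeff τ a.z w i) (numer a) ∧
      IsSystemSolution τ a.z (fun w i => wt (w i) * E i + offDiagCoeff τ a.z w i) (numer b) := by
  obtain ⟨E, h1, h2⟩ := exists_isFirstOrder hz (Psi a) (Psi b) (psiFun a) (psiFun b)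
    (PsiV_rep a) (PsiV_rep b) (analyticAt_psiFun a) (analyticAt_psiFun b)
    -- The generators S₂(x) at nonsingular x are all that the residue argument needs.
    (fun x hx => heig _ (Algebra.subset_adjoin ⟨1, x, hx, rfl⟩)) (exists_psiFun_ne_zero hm a)
  have hε : ((-1 : ℂ)) ^ m ≠ 0 := by simp
  exact ⟨E, h1.isSystemSolution hε (differentiable_numer a) (psiFun_eq a),
    h2.isSystemSolution hε (differentiable_numer b) (psiFun_eq b)⟩

/-- Both numerators solve one system, have equal multipliers because `tildeF` does, and equal m! at
0. Their difference is zero by uniqueness. -/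
lemma numer_eq_of_proportional {a b : BetheSolution τ m} (hm : 0 < m)
    (hz : ∀ i j, i ≠ j → ¬ InLattice τ (a.z i - a.z j)) (hab : b.z = a.z)
    {C : (Fin (2 * m) → Fin 2) → Fin (2 * m) → ℂ} (ha : IsSystemSolution τ a.z C (numer a))
    (hb : IsSystemSolution τ a.z C (numer b)) {c : ℂ} (h : ∀ x, tildeF b x = c * tildeF a x)
    (w : Fin (2 * m) → Fin 2) (v : ℂ) : numer b w v = numer a w v := by
  by_cases hw : (ones w).card = m
  · have hne : tildeF b ≠ 0 := fun e =>
      tildeF_z_ne_zero b ⟨0, by omega⟩ (by rw [e]; rfl)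
    obtain ⟨h1, h2⟩ := (quasiPeriodic_tildeF b).multipliers_eq (quasiPeriodic_tildeF a) h hne
    refine sub_eq_zero.1 ((hb.sub ha (differentiable_numer b) (differentiable_numer a)).eq_zero
      hm hz (α := fun _ => Complex.exp (Real.pi * Complex.I * a.mu) * (-1) ^ m)
      (β := fun w => Complex.exp (Real.pi * Complex.I * a.mu * τ) * ((-1) ^ m *
        Complex.exp (-(Real.pi * Complex.I * m * τ) +
          2 * Real.pi * Complex.I * (∑ j, a.t j - ∑ i ∈ ones w, a.z i))))
      (fun w hw => ?_) (fun w hw => ?_) hw v)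
    · refine QuasiPeriodic.sub ?_ (quasiPeriodic_numer a hw)
      have q := quasiPeriodic_numer b hw
      rw [h1, hab] at q
      convert q using 1
      -- The second multiplier of the numerator is that of `tildeF` times a factor depending only on
      -- z and the word.
      have e : ∀ s : BetheSolution τ m, Complex.exp (-(Real.pi * Complex.I * m * τ) +
          2 * Real.pi * Complex.I * (∑ j, s.t j - ∑ i ∈ ones w, a.z i)) =
          Complex.exp (-(Real.pi * Complex.I * m * τ) + 2 * Real.pi * Complex.I * ∑ j, s.t j) *
          Complex.exp (-(2 * Real.pi * Complex.I * ∑ i ∈ ones w, a.z i)) := by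
        intro s
        rw [← Complex.exp_add]
        congr 1
        ring
      rw [e, e]
      linear_combination -Complex.exp (-(2 * Real.pi * Complex.I * ∑ i ∈ ones w, a.z i)) * h2
    · simp [numer_zero _ hw]
  · rw [numer_of_card_ne b hw, numer_of_card_ne a hw]

/-- Reflection preserves the system and the value m! at 0 but inverts multipliers. The relations h1
and h2 coming from the Wronskian are precisely what makes the inverted multipliers of a those of b,
so uniqueness applies. -/
lemma numer_eq_reflect {a b : BetheSolution τ m} (hm : 0 < m)
    (hz : ∀ i j, i ≠ j → ¬ InLattice τ (a.z i - a.z j)) (hab : b.z = a.z) {E : Fin (2 * m) → ℂ}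
    (ha : IsSystemSolution τ a.z
      (fun w i => wt (w i) * E i + offDiagCoeff τ a.z w i) (numer a))
    (hb : IsSystemSolution τ a.z
      (fun w i => wt (w i) * E i + offDiagCoeff τ a.z w i) (numer b))
    (h1 : Complex.exp (Real.pi * Complex.I * (a.mu + b.mu)) = 1)
    (h2 : Complex.exp (Real.pi * Complex.I * (a.mu + b.mu) * τ + 2 * Real.pi * Complex.I *
      (∑ j, a.t j + ∑ j, b.t j - ∑ i, a.z i)) = 1)
    {w : Fin (2 * m) → Fin 2} (hw : (ones w).card = m) (v : ℂ) :
    numer b w v = numer a (fun k => 1 - w k) (-v) := by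
  have hs : ((-1 : ℂ)) ^ m * (-1) ^ m = 1 := by rw [← mul_pow]; simp
  have hr := ha.reflect fun w i => by
    rw [wt_one_sub, offDiagCoeff_one_sub]
    ring
  refine sub_eq_zero.1 ((hb.sub hr (differentiable_numer b)
    (fun w => (differentiable_numer a _).comp differentiable_neg)).eq_zero
      hm hz (α := fun _ => Complex.exp (Real.pi * Complex.I * b.mu) * (-1) ^ m)
      (β := fun w => Complex.exp (Real.pi * Complex.I * b.mu * τ) * ((-1) ^ m *
        Complex.exp (-(Real.pi * Complex.I * m * τ) +
          2 * Real.pi * Complex.I * (∑ j, b.t j - ∑ i ∈ ones w, a.z i))))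
      (fun w hw => ?_) (fun w hw => ?_) hw v)
  · have q := quasiPeriodic_numer b hw
    rw [hab] at q
    refine q.sub ?_
    have q' := (quasiPeriodic_numer a (card_ones_one_sub hw)).reflect
    convert q' using 1
    · have h1' := h1
      rw [mul_add, Complex.exp_add] at h1'
      refine eq_inv_of_mul_eq_one_left ?_
      linear_combination h1' + Complex.exp (Real.pi * Complex.I * b.mu) *
        Complex.exp (Real.pi * Complex.I * a.mu) * hs
    -- The complementary word carries the complementary sum of z, which turns ∑z in h2 into the two
    -- partial sums in the multipliers.
    · have hz1 : ∑ i ∈ ones (fun k => 1 - w k), a.z i = ∑ i, a.z i - ∑ i ∈ ones w, a.z i := by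
        rw [ones_one_sub]
        linear_combination Finset.sum_add_sum_compl (ones w) a.z
      rw [eq_comm, inv_mul_eq_iff_eq_mul₀ (quasiPeriodic_numer a (card_ones_one_sub hw)).β_ne, hz1]
      have e : Complex.exp (Real.pi * Complex.I * a.mu * τ) *
          Complex.exp (-(Real.pi * Complex.I * m * τ) + 2 * Real.pi * Complex.I *
            (∑ j, a.t j - (∑ i, a.z i - ∑ i ∈ ones w, a.z i))) *
          (Complex.exp (Real.pi * Complex.I * b.mu * τ) *
          Complex.exp (-(Real.pi * Complex.I * m * τ) + 2 * Real.pi * Complex.I *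
            (∑ j, b.t j - ∑ i ∈ ones w, a.z i))) =
          Complex.exp (Real.pi * Complex.I * (a.mu + b.mu) * τ + 2 * Real.pi * Complex.I *
            (∑ j, a.t j + ∑ j, b.t j - ∑ i, a.z i)) *
          Complex.exp (-(2 * Real.pi * Complex.I * m * τ)) := by
        simp only [← Complex.exp_add]
        congr 1
        ring
      rw [h2, one_mul] at e
      rw [← e]
      linear_combination -(Complex.exp (Real.pi * Complex.I * a.mu * τ) *
          Complex.exp (-(Real.pi * Complex.I * m * τ) + 2 * Real.pi * Complex.I *
            (∑ j, a.t j - (∑ i, a.z i - ∑ i ∈ ones w, a.z i))) *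
          (Complex.exp (Real.pi * Complex.I * b.mu * τ) *
          Complex.exp (-(Real.pi * Complex.I * m * τ) + 2 * Real.pi * Complex.I *
            (∑ j, b.t j - ∑ i ∈ ones w, a.z i)))) * hs
  · simp [numer_zero _ hw, numer_zero _ (card_ones_one_sub hw)]

end

end EllipticBethe

theorem mainTheorem3 (τ : UpperHalfPlane) (m : ℕ) (hm : 0 < m)
    (a b : EllipticBethe.BetheSolution τ m)
    (hz : ∀ i j, i ≠ j → ¬ EllipticBethe.InLattice τ (a.z i - a.z j))
    (hab : b.z = a.z)
    (ha : (⟦a⟧ : EllipticBethe.Sol1 τ m) ∈ EllipticBethe.Sol τ m)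
    (hb : (⟦b⟧ : EllipticBethe.Sol1 τ m) ∈ EllipticBethe.Sol τ m)
    (heig : ∀ T ∈ EllipticBethe.betheAlgebra τ a.z, ∃ e : ℂ,
      T (EllipticBethe.Psi a) = e • EllipticBethe.Psi a ∧
      T (EllipticBethe.Psi b) = e • EllipticBethe.Psi b) :
    ((⟦a⟧ : EllipticBethe.Sol1 τ m) = ⟦b⟧ ∨ EllipticBethe.IsAnalyticImage ⟦a⟧ ⟦b⟧) ∧
    (∃ c : ℂ, c ≠ 0 ∧
      ((EllipticBethe.Psi b : EllipticBethe.VFun (2 * m)) = c • EllipticBethe.Psi a ∨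
        (EllipticBethe.Psi b : EllipticBethe.VFun (2 * m)) =
          c • EllipticBethe.weyl (EllipticBethe.Psi a))) := by
  obtain ⟨E, hsa, hsb⟩ := EllipticBethe.exists_isSystemSolution hm hz heig
  have hE : ∀ i, Real.pi * Complex.I * a.mu - EllipticBethe.rhoSum a i =
      Real.pi * Complex.I * b.mu - EllipticBethe.rhoSum b i := by
    intro i
    have e1 := EllipticBethe.eigenvalue_eq hm a hz hsa i
    have e2 := EllipticBethe.eigenvalue_eq hm b (E := E) (by rwa [hab]) (by rwa [hab]) i
    rw [hab] at e2
    linear_combination e2 - e1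
  obtain ⟨C, hC⟩ := EllipticBethe.exists_wr_eq hm hz hab hE
  -- The vanishing of the Wronskian constant separates equality of classes from the analytic
  -- involution.
  by_cases hC0 : C = 0
  · obtain ⟨c, hc⟩ := EllipticBethe.exists_eq_const_mul_of_wr_eq_zero
      (EllipticBethe.differentiable_tildeF a) (EllipticBethe.differentiable_tildeF b)
      (fun x => by rw [hC, hC0, zero_mul])
      (EllipticBethe.tildeF_z_ne_zero a ⟨0, by omega⟩)
    -- The constant is 1 because all numerators have the common value m! at 0; the same
    -- normalization serves the Weyl case.
    refine ⟨Or.inl (EllipticBethe.class_eq_of_proportional hm hab hc), 1, one_ne_zero, Or.inl ?_⟩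
    rw [one_smul]
    exact EllipticBethe.PsiV_eq_of_numer_eq
      (EllipticBethe.numer_eq_of_proportional hm hz hab hsa hsb hc)
  · obtain ⟨h1, h2⟩ := EllipticBethe.multipliers_of_wr hC0 hC
    refine ⟨Or.inr (EllipticBethe.isAnalyticImage_of_wr hab h1 hC0 hC), 1, one_ne_zero, Or.inr ?_⟩
    rw [one_smul]
    exact EllipticBethe.PsiV_eq_weyl_of_numer_eq fun w hw v =>
      EllipticBethe.numer_eq_reflect hm hz hab hsa hsb h1 h2 hw v
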